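/- Let $A$ be a C*-weak Hopf algebra, i.e. a finite dimensional C*-algebra with a coassociative counital coproduct $\Delta(x)=x_{(1)}\otimes x_{(2)}$ which is a multiplicative $*$-map (not necessarily unital), counit $\varepsilon$ and antipode $S$ satisfying $$1_{(1)}\otimes 1_{(2)}\otimes 1_{(3)}=(\Delta(1)\otimes 1)(1\otimes\Delta(1))=(1\otimes\Delta(1))(\Delta(1)\otimes 1),$$ $$\varepsilon(xyz)=\varepsilon(xy_{(1)})\varepsilon(y_{(2)}z)=\varepsilon(xy_{(2)})\varepsilon(y_{(1)}z),$$ $$x_{(1)}S(x_{(2)})=\varepsilon(1_{(1)}x)1_{(2)},\quad S(x_{(1)})x_{(2)}=1_{(1)}\varepsilon(x1_{(2)}),\quad S(x_{(1)})x_{(2)}S(x_{(3)})=S(x).$$ *Notation.* Let $A^L=\{\varepsilon(1_{(1)}x)1_{(2)}: x\in A\}$ and $A^R=\{1_{(1)}\varepsilon(x1_{(2)}): x\in A\}$; these are subalgebras of $A$. Let $\mathrm{Sec}\,A$ be the set of sectors, i.e. of classes $q$ of irreducible left $A$-modules $V_q$, with minimal central projections $e_q$. The set $\mathrm{Vac}\,A$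 of vacua $\mu$ labels the minimal projections $z^L_\mu$ of $Z^L=A^L\cap\mathrm{Center}\,A$; put $z^R_\mu=S(z^L_\mu)$. The left and right vacua $q^L,q^R$ of a sector $q$ are determined by $z^L_{q^L}e_q=e_q=e_qz^R_{q^R}$. The set $\mathrm{Hyp}\,A$ of hyperselection sectors $H$ labels the minimal projections $z_H$ of $\mathrm{Hypercenter}\,A=A^L\cap A^R\cap\mathrm{Center}\,A$, and $[\mu]=H$ means $z_Hz^L_\mu=z^L_\mu$. *Dimensions.* Let $V_\varepsilon$ be the space of functionals $x\rightharpoonup\varepsilon=\varepsilon(\,\cdot\,x)$, $x\in A$, with the action $(x\rightharpoonup\varphi)(y)=\varphi(yx)$, and let $P_\nu$ be the action of $z^L_\nu$ on $V_\varepsilon$. For an invertible $g'\in A$ and a finite dimensional left $A$-module $V$ with basis $v_i$ and dual basis $f^i$, put for $T\in\mathrm{End}_A V$ and $\varphi\in V_\varepsilon$ $$\phi_V(T)\varphi=\sum_i f^i\big(g'^{-1}1_{(1)}T(1_{(1')}v_i)\big)\,\varphi(1_{(2')})\;1_{(2)}\rightharpoonup\varepsilon,$$ $$\psi_V(T)\varphi=\sum_i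 f^i\big(g'1_{(2)}T(1_{(2')}v_i)\big)\,\varphi(1_{(1')})\;1_{(1)}\rightharpoonup\varepsilon$$ (the left and right inverses built from the rigidity intertwiners of $V$; $1_{(1')}\otimes 1_{(2')}$ is a second copy of $\Delta(1)$). A standard metric is a positive invertible $g'\in A$ with $S^2(x)=g'xg'^{-1}$, $\Delta(g')=(g'\otimes g')\Delta(1)$ and $S(g')=g'^{-1}$ for which there are numbers $d_q$, $q\in\mathrm{Sec}\,A$, such that $\phi_{V_q}(\mathrm{id})=d_qP_{q^R}$ and $\psi_{V_q}(\mathrm{id})=d_qP_{q^L}$ on $V_\varepsilon$. The dimension matrix of a left $A$-module $V$ is the matrix $\mathbf d_V^{\mu\nu}=\sum_{q:\,q^L=\mu,\,q^R=\nu}N_V^q\,d_q$, $\mu,\nu\in\mathrm{Vac}\,A$, where $N_V^q$ is the multiplicity of $V_q$ in $V$. *Index.* A quasi-basis of a conditional expectation $E\colon A\to N$ is $\sum_i a_i\otimes b_i\in A\otimes A$ with $\sum_i a_iE(b_ix)=x=\sum_iE(xa_i)b_i$ for all $x\in A$, and $\mathrm{Index}\,E=\sum_i a_ib_i$. For a subalgebra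 $N\subset A$ ($N=A^L$ or $A^R$) and a projection $z\in N\cap\mathrm{Center}\,A$, the inclusion matrix $\Lambda$ of $zN\subset zA$ consists of the multiplicities of the irreducibles of $zN$ in the restrictions of the irreducibles of $zA$; $zN\subset zA$ is connected if $\mathrm{Center}(zN)\cap\mathrm{Center}(zA)=\mathbb C z\neq 0$, and then its index is $\|\Lambda\|^2$. Norms of matrices are $L^2$-operator norms. **Theorem.** The numbers $d_q$ exist and are unique (they come from a standard metric). Moreover: (i) There is a unique faithful positive trace $\tau_M\colon A\to\mathbb C$ (the Markov trace) such that the $\tau_M$-preserving conditional expectations $E^L_M\colon A\to A^L$ and $E^R_M\colon A\to A^R$ have equal hypercentral index $$\mathrm{Index}\,E^L_M=\mathrm{Index}\,E^R_M=I^M\in\mathrm{Hypercenter}\,A,$$ and $\tau_M(z_H)=1$ for all $H\in\mathrm{Hyp}\,A$. Write $I^M=\sum_H I^M_Hz_H$; the $I^M_H$ are real numbers. (ii) For every $H\in\mathrm{Hyp}\,A$ and every vacuum $\mu$ with $[\mu]=H$ the inclusions $z^L_\mu A^L\subset z^L_\mu A$ and $A^Rz^R_\mu\subset Az^R_\mu$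 are connected, and both have index $I^M_H$, i.e. the norms of their inclusion matrices are equal to $\sqrt{I^M_H}$. In particular all these inclusions, for fixed $H$, have the same index. (iii) For every $H$ the norm of the $H$-block $(\mathbf d_A^{\mu\nu})_{[\mu]=[\nu]=H}$ of the dimension matrix of the left regular $A$-module is $I^M_H$, and there are numbers $f_\mu>0$, $\mu\in\mathrm{Vac}\,A$, such that $$\sum_{\nu\in\mathrm{Vac}\,A}\mathbf d_A^{\mu\nu}f_\nu=I^M_{[\mu]}f_\mu\qquad(\mu\in\mathrm{Vac}\,A).$$ -/

import Mathlib

open scoped TensorProduct ComplexOrder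

namespace WHA

/-! ### Finite dimensional algebras: minimal central idempotents, irreducibles, multiplicities -/

section Algebras

variable {B : Type*} [Ring B] [Algebra ℂ B]

/-- `e` is a minimal idempotent of the commutative algebra `C ∩ Center B`.  (When `B` is a
C*-algebra every central idempotent is self-adjoint, so that these are the minimal projections.) -/
structure IsMinCentralIdem (C : Subalgebra ℂ B) (e : B) : Prop where
  mem : e ∈ C
  central : e ∈ Subalgebra.center ℂ B
  idem : e * e = e
  ne_zero : e ≠ 0
  minimal : ∀ f ∈ C, f ∈ Subalgebra.center ℂ B → f * f = f → f * e = f → f = 0 ∨ f = e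

/-- The set of minimal idempotents of `C ∩ Center B`. -/
def MinCentralIdem (C : Subalgebra ℂ B) : Type _ := {e : B // IsMinCentralIdem C e}

/-- The underlying element of a minimal central idempotent. -/
def MinCentralIdem.elt {C : Subalgebra ℂ B} (e : MinCentralIdem C) : B := e.1

theorem MinCentralIdem.mul_eq_zero {C : Subalgebra ℂ B} (e f : MinCentralIdem C) (h : e ≠ f) :
    e.elt * f.elt = 0 := by
  obtain ⟨e, he⟩ := e
  obtain ⟨f, hf⟩ := f
  change e * f = 0
  have hc : e * f = f * e := ((Subalgebra.mem_center_iff.1 he.central) f).symm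
  have hC : e * f ∈ C := C.mul_mem he.mem hf.mem
  have hZ : e * f ∈ Subalgebra.center ℂ B := Subalgebra.mul_mem _ he.central hf.central
  have hi : e * f * (e * f) = e * f := by
    calc e * f * (e * f) = e * (f * e) * f := by simp only [mul_assoc]
      _ = e * e * (f * f) := by rw [← hc]; simp only [mul_assoc]
      _ = e * f := by rw [he.idem, hf.idem]
  have h1 : e * f * e = e * f := by rw [mul_assoc, ← hc, ← mul_assoc, he.idem]
  have h2 : e * f * f = e * f := by rw [mul_assoc, hf.idem]
  rcases he.minimal _ hC hZ hi h1 with h0 | h0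
  · exact h0
  rcases hf.minimal _ hC hZ hi h2 with h3 | h3
  · exact h3
  · exact absurd (Subtype.ext (h0.symm.trans h3)) h

instance [FiniteDimensional ℂ B] (C : Subalgebra ℂ B) : Finite (MinCentralIdem C) := by
  have hli : LinearIndependent ℂ (fun e : MinCentralIdem C => e.elt) := by
    rw [linearIndependent_iff']
    intro s g hg i hi
    have h := congrArg (fun x => x * i.elt) hg
    simp only [Finset.sum_mul, zero_mul, smul_mul_assoc] at h
    rw [Finset.sum_eq_single i] at h
    · have hid : i.elt * i.elt = i.elt := i.2.idem
      rw [hid] at h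
      exact (smul_eq_zero.1 h).resolve_right i.2.ne_zero
    · intro j _ hj
      rw [MinCentralIdem.mul_eq_zero j i hj, smul_zero]
    · intro h'
      exact absurd hi h'
  exact hli.finite

noncomputable instance [FiniteDimensional ℂ B] (C : Subalgebra ℂ B) :
    Fintype (MinCentralIdem C) := Fintype.ofFinite _

variable (B) in
/-- The sectors of `B`, labelled by the minimal central idempotents of `B`. -/
abbrev Sector : Type _ := MinCentralIdem (⊤ : Subalgebra ℂ B)

theorem exists_irrep [FiniteDimensional ℂ B] (q : Sector B) :
    ∃ I : Submodule B B, IsSimpleModule B I ∧ ∀ x ∈ I, q.elt * x = x := by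
  have : IsArtinian B B := isArtinian_of_tower ℂ inferInstance
  obtain ⟨e, he⟩ := q
  let J : Submodule B B :=
    { carrier := {x | e * x = x}
      add_mem' := fun {a b} ha hb => by
        change e * (a + b) = a + b
        rw [mul_add, show e * a = a from ha, show e * b = b from hb]
      zero_mem' := mul_zero e
      smul_mem' := fun c x hx => by
        change e * (c * x) = c * x
        rw [← mul_assoc, ← Subalgebra.mem_center_iff.1 he.central c, mul_assoc,
          show e * x = x from hx] }
  have hJ : J ≠ ⊥ := by
    intro h
    have h1 : e ∈ J := he.idem
    rw [h] at h1
    exact he.ne_zero ((Submodule.mem_bot B).1 h1)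
  obtain ⟨I, hI, hIJ⟩ := (IsAtomic.eq_bot_or_exists_atom_le J).resolve_left hJ
  exact ⟨I, isSimpleModule_iff_isAtom.2 hI, fun x hx => hIJ hx⟩

/-- A representative `V_q` of the irreducible left `B`-modules in the class `q`, i.e. of the simple
modules on which the central idempotent of `q` acts as the identity. -/
noncomputable def irrep [FiniteDimensional ℂ B] (q : Sector B) : Submodule B B :=
  (exists_irrep q).choose

/-- The multiplicity `N_V^q` of the irreducible `V_q` in the left `B`-module `V`. -/
noncomputable def mult [FiniteDimensional ℂ B] (q : Sector B) (V : Type*) [AddCommGroup V]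
    [Module ℂ V] [Module B V] [IsScalarTower ℂ B V] : ℕ :=
  Module.finrank ℂ (irrep q →ₗ[B] V)

/-- The L²-operator norm of a real matrix. -/
noncomputable def l2Norm {m n : Type*} [Fintype m] [Fintype n] [DecidableEq n]
    (M : Matrix m n ℝ) : ℝ :=
  ‖LinearMap.toContinuousLinearMap (Matrix.toEuclideanLin M)‖

variable [FiniteDimensional ℂ B]

/-- The inclusion matrix `Λ(z)` of `z N ⊆ z B`, for a subalgebra `N ⊆ B` and a central idempotent
`z ∈ N` of `B`.  Its rows are labelled by the irreducibles of `N` and its columns by the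
irreducibles of `B` which belong to `z`; the entries are the multiplicities of the former in
the restrictions of the latter. -/
noncomputable def inclusionMatrix (N : Subalgebra ℂ B) (z : B) :
    Matrix {a : Sector N // z * (a.elt : B) = a.elt} {q : Sector B // z * q.elt = q.elt} ℝ :=
  fun a q => (mult (B := N) a.1 (irrep q.1) : ℝ)

open Classical in
/-- The norm of the inclusion matrix of `z N ⊆ z B`. -/
noncomputable def inclusionNorm (N : Subalgebra ℂ B) (z : B) : ℝ :=
  l2Norm (inclusionMatrix N z)

/-- The inclusion `z N ⊆ z B` is connected: the intersection of the centers of `z N` and `z B`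
is `ℂ z`. -/
def IsConnectedInclusion (N : Subalgebra ℂ B) (z : B) : Prop :=
  z ≠ 0 ∧ ∀ x ∈ N, z * x = x → (∀ y : B, x * (z * y) = (z * y) * x) → ∃ c : ℂ, x = c • z

end Algebras

/-! ### Traces, conditional expectations, index -/

section Index

variable {A : Type*} [CStarAlgebra A]

/-- A faithful (positive) trace. -/
structure IsFaithfulTrace (τ : A →ₗ[ℂ] ℂ) : Prop where
  trace : ∀ a b, τ (a * b) = τ (b * a)
  pos : ∀ a, a ≠ 0 → 0 < τ (star a * a)

/-- `E` is a `τ`-preserving conditional expectation of `A` onto the subalgebra `N`. -/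
structure IsCondExp (τ : A →ₗ[ℂ] ℂ) (N : Subalgebra ℂ A) (E : A →ₗ[ℂ] A) : Prop where
  mem : ∀ a, E a ∈ N
  fix : ∀ n ∈ N, E n = n
  mul_left : ∀ n ∈ N, ∀ a, E (n * a) = n * E a
  mul_right : ∀ n ∈ N, ∀ a, E (a * n) = E a * n
  pos : ∀ a, ∃ b, E (star a * a) = star b * b
  preserves : ∀ a, τ (E a) = τ a

/-- `c` is the index (in the sense of Watatani) of the conditional expectation `E`: there is a
quasi-basis `∑ aᵢ ⊗ bᵢ` of `E` with `c = ∑ aᵢ bᵢ`. -/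
def HasIndex (E : A →ₗ[ℂ] A) (c : A) : Prop :=
  ∃ (n : ℕ) (a b : Fin n → A), (∀ x, ∑ i, a i * E (b i * x) = x) ∧
    (∀ x, ∑ i, E (x * a i) * b i = x) ∧ ∑ i, a i * b i = c

end Index

end WHA

/-! ### C*-weak Hopf algebras -/

/-- The structure of a C*-weak Hopf algebra on a (finite dimensional) C*-algebra `A`. -/
class CStarWeakHopfAlgebra (A : Type*) [CStarAlgebra A] extends Coalgebra ℂ A where
  /-- The coproduct is multiplicative. -/
  comul_mul : ∀ x y : A, comul (x * y) = comul x * comul y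
  /-- The coproduct is a `*`-map. -/
  comul_star : ∀ x : A, comul (star x) = star (comul x)
  /-- `1₍₁₎ ⊗ 1₍₂₎ ⊗ 1₍₃₎ = (Δ(1) ⊗ 1)(1 ⊗ Δ(1))`. -/
  comul_one : comul.lTensor A (comul (1 : A)) =
    TensorProduct.assoc ℂ A A A (comul (1 : A) ⊗ₜ[ℂ] (1 : A)) *
      ((1 : A) ⊗ₜ[ℂ] comul (1 : A))
  /-- `1₍₁₎ ⊗ 1₍₂₎ ⊗ 1₍₃₎ = (1 ⊗ Δ(1))(Δ(1) ⊗ 1)`. -/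
  comul_one' : comul.lTensor A (comul (1 : A)) =
    ((1 : A) ⊗ₜ[ℂ] comul (1 : A)) *
      TensorProduct.assoc ℂ A A A (comul (1 : A) ⊗ₜ[ℂ] (1 : A))
  /-- `ε(xyz) = ε(x y₍₁₎) ε(y₍₂₎ z)`. -/
  counit_mul : ∀ x y z : A, counit (x * y * z) =
    LinearMap.mul' ℂ ℂ (TensorProduct.map (counit ∘ₗ LinearMap.mulLeft ℂ x)
      (counit ∘ₗ LinearMap.mulRight ℂ z) (comul y))
  /-- `ε(xyz) = ε(x y₍₂₎) ε(y₍₁₎ z)`. -/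
  counit_mul' : ∀ x y z : A, counit (x * y * z) =
    LinearMap.mul' ℂ ℂ (TensorProduct.map (counit ∘ₗ LinearMap.mulRight ℂ z)
      (counit ∘ₗ LinearMap.mulLeft ℂ x) (comul y))
  /-- The antipode. -/
  antipode : A →ₗ[ℂ] A
  /-- `x₍₁₎ S(x₍₂₎) = ε(1₍₁₎ x) 1₍₂₎`. -/
  mul_antipode : ∀ x : A, LinearMap.mul' ℂ A (antipode.lTensor A (comul x)) =
    TensorProduct.lid ℂ A (counit.rTensor A (comul (1 : A) * (x ⊗ₜ[ℂ] (1 : A))))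
  /-- `S(x₍₁₎) x₍₂₎ = 1₍₁₎ ε(x 1₍₂₎)`. -/
  antipode_mul : ∀ x : A, LinearMap.mul' ℂ A (antipode.rTensor A (comul x)) =
    TensorProduct.rid ℂ A (counit.lTensor A (((1 : A) ⊗ₜ[ℂ] x) * comul (1 : A)))
  /-- `S(x₍₁₎) x₍₂₎ S(x₍₃₎) = S(x)`. -/
  antipode_mul_antipode : ∀ x : A,
    LinearMap.mul' ℂ A (TensorProduct.map antipode (LinearMap.mul' ℂ A ∘ₗ antipode.lTensor A)
      (comul.lTensor A (comul x))) = antipode x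

namespace WHA

section WeakHopf

open Coalgebra CStarWeakHopfAlgebra

variable (A : Type*) [CStarAlgebra A] [CStarWeakHopfAlgebra A]

/-- `Δ(1)`. -/
noncomputable def Δ1 : A ⊗[ℂ] A := comul (R := ℂ) (1 : A)

variable {A}

theorem comul_eq_mul_Δ1 (x : A) : comul (R := ℂ) x = comul (R := ℂ) x * Δ1 A := by
  rw [Δ1, ← comul_mul, mul_one]

theorem comul_eq_Δ1_mul (x : A) : comul (R := ℂ) x = Δ1 A * comul (R := ℂ) x := by
  rw [Δ1, ← comul_mul, one_mul]

variable (A)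

/-- The left subalgebra `A^L`: all `x` with `Δ(x) = x 1₍₁₎ ⊗ 1₍₂₎ = 1₍₁₎ x ⊗ 1₍₂₎`. -/
noncomputable def leftSub : Subalgebra ℂ A where
  carrier := {x | comul (R := ℂ) x = (x ⊗ₜ[ℂ] (1 : A)) * Δ1 A ∧
    comul (R := ℂ) x = Δ1 A * (x ⊗ₜ[ℂ] (1 : A))}
  mul_mem' := by
    rintro a b ⟨ha, ha'⟩ ⟨hb, hb'⟩
    have e : (a * b) ⊗ₜ[ℂ] (1 : A) = (a ⊗ₜ[ℂ] (1 : A)) * (b ⊗ₜ[ℂ] (1 : A)) := by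
      rw [Algebra.TensorProduct.tmul_mul_tmul, one_mul]
    constructor
    · rw [comul_mul, ha, mul_assoc, ← comul_eq_Δ1_mul, hb, e, mul_assoc]
    · rw [comul_mul, hb', ← mul_assoc, ← comul_eq_mul_Δ1, ha', e, mul_assoc]
  add_mem' := by
    rintro a b ⟨ha, ha'⟩ ⟨hb, hb'⟩
    constructor
    · rw [map_add, ha, hb, TensorProduct.add_tmul, add_mul]
    · rw [map_add, ha', hb', TensorProduct.add_tmul, mul_add]
  algebraMap_mem' := by
    intro r
    have e : (algebraMap ℂ A r) ⊗ₜ[ℂ] (1 : A) = r • (1 : A ⊗[ℂ] A) := by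
      rw [Algebra.algebraMap_eq_smul_one, ← TensorProduct.smul_tmul',
        Algebra.TensorProduct.one_def]
    constructor
    · rw [e, Algebra.algebraMap_eq_smul_one, map_smul, smul_mul_assoc, one_mul, Δ1]
    · rw [e, Algebra.algebraMap_eq_smul_one, map_smul, mul_smul_comm, mul_one, Δ1]

/-- The right subalgebra `A^R`: all `x` with `Δ(x) = 1₍₁₎ ⊗ x 1₍₂₎ = 1₍₁₎ ⊗ 1₍₂₎ x`. -/
noncomputable def rightSub : Subalgebra ℂ A where
  carrier := {x | comul (R := ℂ) x = ((1 : A) ⊗ₜ[ℂ] x) * Δ1 A ∧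
    comul (R := ℂ) x = Δ1 A * ((1 : A) ⊗ₜ[ℂ] x)}
  mul_mem' := by
    rintro a b ⟨ha, ha'⟩ ⟨hb, hb'⟩
    have e : (1 : A) ⊗ₜ[ℂ] (a * b) = ((1 : A) ⊗ₜ[ℂ] a) * ((1 : A) ⊗ₜ[ℂ] b) := by
      rw [Algebra.TensorProduct.tmul_mul_tmul, one_mul]
    constructor
    · rw [comul_mul, ha, mul_assoc, ← comul_eq_Δ1_mul, hb, e, mul_assoc]
    · rw [comul_mul, hb', ← mul_assoc, ← comul_eq_mul_Δ1, ha', e, mul_assoc]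
  add_mem' := by
    rintro a b ⟨ha, ha'⟩ ⟨hb, hb'⟩
    constructor
    · rw [map_add, ha, hb, TensorProduct.tmul_add, add_mul]
    · rw [map_add, ha', hb', TensorProduct.tmul_add, mul_add]
  algebraMap_mem' := by
    intro r
    have e : (1 : A) ⊗ₜ[ℂ] (algebraMap ℂ A r) = r • (1 : A ⊗[ℂ] A) := by
      rw [Algebra.algebraMap_eq_smul_one, TensorProduct.tmul_smul,
        Algebra.TensorProduct.one_def]
    constructor
    · rw [e, Algebra.algebraMap_eq_smul_one, map_smul, smul_mul_assoc, one_mul, Δ1]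
    · rw [e, Algebra.algebraMap_eq_smul_one, map_smul, mul_smul_comm, mul_one, Δ1]

variable {A}

/-- `⊓^L(y) = ε(1₍₁₎ y) 1₍₂₎`. -/
noncomputable def piL (y : A) : A :=
  TensorProduct.lid ℂ A ((counit (R := ℂ)).rTensor A (Δ1 A * (y ⊗ₜ[ℂ] (1 : A))))

/-- `⊓^R(y) = 1₍₁₎ ε(y 1₍₂₎)`. -/
noncomputable def piR (y : A) : A :=
  TensorProduct.rid ℂ A ((counit (R := ℂ)).lTensor A (((1 : A) ⊗ₜ[ℂ] y) * Δ1 A))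

/-- `A^L` is the image of `⊓^L`. -/
theorem mem_leftSub_iff (x : A) : x ∈ leftSub A ↔ ∃ y, piL y = x := by
  constructor
  · rintro ⟨-, h⟩
    refine ⟨x, ?_⟩
    rw [piL, ← h, rTensor_counit_comul, TensorProduct.lid_tmul, one_smul]
  · rintro ⟨y, rfl⟩
    let k : A →ₗ[ℂ] ℂ := counit (R := ℂ) ∘ₗ LinearMap.mulRight ℂ y
    let F : A ⊗[ℂ] A →ₗ[ℂ] A := (TensorProduct.lid ℂ A).toLinearMap ∘ₗ k.rTensor A
    let G : A ⊗[ℂ] (A ⊗[ℂ] A) →ₗ[ℂ] A ⊗[ℂ] A :=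
      (TensorProduct.lid ℂ (A ⊗[ℂ] A)).toLinearMap ∘ₗ k.rTensor (A ⊗[ℂ] A)
    have hF : piL y = F (Δ1 A) := by
      have : ∀ t : A ⊗[ℂ] A, TensorProduct.lid ℂ A
          ((counit (R := ℂ)).rTensor A (t * (y ⊗ₜ[ℂ] (1 : A)))) = F t := by
        intro t
        induction t with
        | zero => simp
        | tmul a b => simp [F, k]
        | add a b ha hb => rw [add_mul, map_add, map_add, map_add, ha, hb]
      exact this _
    have h1 : ∀ t : A ⊗[ℂ] A, G ((comul (R := ℂ)).lTensor A t) = comul (R := ℂ) (F t) := by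
      intro t
      induction t with
      | zero => simp
      | tmul a b => simp [F, G, k]
      | add a b ha hb => simp only [map_add, ha, hb]
    have h2 : ∀ t w : A ⊗[ℂ] A,
        G (TensorProduct.assoc ℂ A A A (t ⊗ₜ[ℂ] (1 : A)) * ((1 : A) ⊗ₜ[ℂ] w)) =
          (F t ⊗ₜ[ℂ] (1 : A)) * w := by
      intro t w
      induction t with
      | zero => simp
      | tmul a b => simp [F, G, k, ← TensorProduct.smul_tmul']
      | add a b ha hb => simp only [TensorProduct.add_tmul, map_add, add_mul, ha, hb]
    have h3 : ∀ t w : A ⊗[ℂ] A,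
        G (((1 : A) ⊗ₜ[ℂ] w) * TensorProduct.assoc ℂ A A A (t ⊗ₜ[ℂ] (1 : A))) =
          w * (F t ⊗ₜ[ℂ] (1 : A)) := by
      intro t w
      induction t with
      | zero => simp
      | tmul a b => simp [F, G, k, ← TensorProduct.smul_tmul']
      | add a b ha hb => simp only [TensorProduct.add_tmul, map_add, mul_add, ha, hb]
    rw [hF]
    constructor
    · rw [← h1, ← h2]
      exact congrArg G comul_one
    · rw [← h1, ← h3]
      exact congrArg G comul_one'

/-- `A^R` is the image of `⊓^R`. -/
theorem mem_rightSub_iff (x : A) : x ∈ rightSub A ↔ ∃ y, piR y = x := by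
  constructor
  · rintro ⟨h, -⟩
    refine ⟨x, ?_⟩
    rw [piR, ← h, lTensor_counit_comul, TensorProduct.rid_tmul, one_smul]
  · rintro ⟨y, rfl⟩
    let k : A →ₗ[ℂ] ℂ := counit (R := ℂ) ∘ₗ LinearMap.mulLeft ℂ y
    let F : A ⊗[ℂ] A →ₗ[ℂ] A := (TensorProduct.rid ℂ A).toLinearMap ∘ₗ k.lTensor A
    let G : A ⊗[ℂ] (A ⊗[ℂ] A) →ₗ[ℂ] A ⊗[ℂ] A := F.lTensor A
    have hF : piR y = F (Δ1 A) := by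
      have : ∀ t : A ⊗[ℂ] A, TensorProduct.rid ℂ A
          ((counit (R := ℂ)).lTensor A (((1 : A) ⊗ₜ[ℂ] y) * t)) = F t := by
        intro t
        induction t with
        | zero => simp
        | tmul a b => simp [F, k]
        | add a b ha hb => rw [mul_add, map_add, map_add, map_add, ha, hb]
      exact this _
    have h0 : ∀ (w : A ⊗[ℂ] A) (b : A),
        G (TensorProduct.assoc ℂ A A A (w ⊗ₜ[ℂ] b)) = k b • w := by
      intro w b
      induction w with
      | zero => simp
      | tmul c d => simp [F, G]
      | add c d hc hd => simp only [TensorProduct.add_tmul, map_add, smul_add, hc, hd]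
    have h1 : ∀ t : A ⊗[ℂ] A,
        G (TensorProduct.assoc ℂ A A A ((comul (R := ℂ)).rTensor A t)) =
          comul (R := ℂ) (F t) := by
      intro t
      induction t with
      | zero => simp
      | tmul a b => rw [LinearMap.rTensor_tmul, h0]; simp [F]
      | add a b ha hb => simp only [map_add, ha, hb]
    have h2 : ∀ t w : A ⊗[ℂ] A,
        G (TensorProduct.assoc ℂ A A A (w ⊗ₜ[ℂ] (1 : A)) * ((1 : A) ⊗ₜ[ℂ] t)) =
          w * ((1 : A) ⊗ₜ[ℂ] F t) := by
      intro t w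
      induction w with
      | zero => simp
      | tmul a b =>
        induction t with
        | zero => simp
        | tmul c d => simp [F, G]
        | add c d hc hd => simp only [TensorProduct.tmul_add, map_add, mul_add, hc, hd]
      | add a b ha hb => simp only [TensorProduct.add_tmul, map_add, add_mul, ha, hb]
    have h3 : ∀ t w : A ⊗[ℂ] A,
        G (((1 : A) ⊗ₜ[ℂ] t) * TensorProduct.assoc ℂ A A A (w ⊗ₜ[ℂ] (1 : A))) =
          ((1 : A) ⊗ₜ[ℂ] F t) * w := by
      intro t w
      induction w with
      | zero => simp
      | tmul a b =>
        induction t with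
        | zero => simp
        | tmul c d => simp [F, G]
        | add c d hc hd => simp only [TensorProduct.tmul_add, map_add, add_mul, hc, hd]
      | add a b ha hb => simp only [TensorProduct.add_tmul, map_add, mul_add, ha, hb]
    rw [hF]
    have hco := coassoc_apply (R := ℂ) (1 : A)
    constructor
    · rw [← h1, ← h3]
      exact congrArg G (hco.trans comul_one')
    · rw [← h1, ← h2]
      exact congrArg G (hco.trans comul_one)

variable (A)

/-- The vacua, labelled by the minimal projections `z_μ^L` of `Z^L = A^L ∩ Center A`. -/
abbrev Vac : Type _ := MinCentralIdem (leftSub A)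

/-- The hyperselection sectors, labelled by the minimal projections `z_H` of the hypercenter
`A^L ∩ A^R ∩ Center A`. -/
abbrev Hyp : Type _ := MinCentralIdem (leftSub A ⊓ rightSub A)

variable {A}

/-- The projection `z_μ^L`. -/
noncomputable def Vac.zL (μ : Vac A) : A := μ.elt

/-- The projection `z_μ^R = S(z_μ^L)`. -/
noncomputable def Vac.zR (μ : Vac A) : A := antipode μ.zL

/-- `[μ] = H`: the hypercentral support of `z_μ^L` is `z_H`. -/
def Vac.InHyp (μ : Vac A) (H : Hyp A) : Prop := H.elt * μ.zL = μ.zL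

/-- `μ` is the left vacuum `q^L` of the sector `q`. -/
def IsLeftVac (q : Sector A) (μ : Vac A) : Prop := μ.zL * q.elt = q.elt

/-- `ν` is the right vacuum `q^R` of the sector `q`. -/
def IsRightVac (q : Sector A) (ν : Vac A) : Prop := q.elt * ν.zR = q.elt

/-! #### The trivial representation and the rigidity intertwiners -/

/-- The left action `(x ⇀ φ)(y) = φ(y x)` of `A` on its dual. -/
noncomputable def hit (x : A) (φ : Module.Dual ℂ A) : Module.Dual ℂ A :=
  φ ∘ₗ LinearMap.mulRight ℂ x

variable (A) in
/-- The space of the trivial representation: all functionals `x ⇀ ε`, `x ∈ A`. -/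
def trivialRep : Set (Module.Dual ℂ A) := Set.range fun x : A => hit x counit

/-- `φ ⇀ 1 = 1₍₁₎ φ(1₍₂₎)`. -/
noncomputable def hitOne (φ : Module.Dual ℂ A) : A :=
  TensorProduct.rid ℂ A (φ.lTensor A (Δ1 A))

/-- `1 ↼ φ = φ(1₍₁₎) 1₍₂₎`. -/
noncomputable def oneHit (φ : Module.Dual ℂ A) : A :=
  TensorProduct.lid ℂ A (φ.rTensor A (Δ1 A))

section Rigidity

variable (V : Type*) [AddCommGroup V] [Module ℂ V] [Module A V] [IsScalarTower ℂ A V]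

/-- The operator `D_V(x)` by which `x` acts on the module `V`. -/
noncomputable def act (x : A) : V →ₗ[ℂ] V := Algebra.lsmul ℂ ℂ V x

/-- The functional `x ↦ f(x · v)` on `A`. -/
noncomputable def coeff (f : Module.Dual ℂ V) (v : V) : Module.Dual ℂ A :=
  f ∘ₗ (Algebra.lsmul ℂ ℂ V).toLinearMap.flip v

/-- Evaluation of the left dual, `f ⊗ v ↦ f(1₍₁₎ · v) 1₍₂₎ ⇀ ε`. -/
noncomputable def evLeft : Module.Dual ℂ V ⊗[ℂ] V →ₗ[ℂ] Module.Dual ℂ A :=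
  TensorProduct.lift <| LinearMap.mk₂ ℂ
    (fun f v => hit (TensorProduct.lid ℂ A ((coeff V f v).rTensor A (Δ1 A))) counit)
    (fun f g v => by
      ext y
      simp [hit, coeff, LinearMap.add_comp, LinearMap.rTensor_add, mul_add])
    (fun c f v => by
      ext y
      simp [hit, coeff, LinearMap.smul_comp, LinearMap.rTensor_smul])
    (fun f v w => by
      ext y
      simp [hit, coeff, LinearMap.comp_add, LinearMap.rTensor_add, mul_add])
    (fun c f v => by
      ext y
      simp [hit, coeff, LinearMap.comp_smul, LinearMap.rTensor_smul])

/-- Evaluation of the right dual, `v ⊗ f ↦ f(1₍₂₎ · v) 1₍₁₎ ⇀ ε`. -/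
noncomputable def evRight : V ⊗[ℂ] Module.Dual ℂ V →ₗ[ℂ] Module.Dual ℂ A :=
  TensorProduct.lift <| LinearMap.mk₂ ℂ
    (fun v f => hit (TensorProduct.rid ℂ A ((coeff V f v).lTensor A (Δ1 A))) counit)
    (fun v w f => by
      ext y
      simp [hit, coeff, LinearMap.comp_add, LinearMap.lTensor_add, mul_add])
    (fun c v f => by
      ext y
      simp [hit, coeff, LinearMap.comp_smul, LinearMap.lTensor_smul])
    (fun v f g => by
      ext y
      simp [hit, coeff, LinearMap.add_comp, LinearMap.lTensor_add, mul_add])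
    (fun c v f => by
      ext y
      simp [hit, coeff, LinearMap.smul_comp, LinearMap.lTensor_smul])

variable [FiniteDimensional ℂ V]

/-- Coevaluation of the left dual, `φ ↦ ∑ᵢ (1 ↼ φ) · vᵢ ⊗ fⁱ`. -/
noncomputable def coevLeft (φ : Module.Dual ℂ A) : V ⊗[ℂ] Module.Dual ℂ V :=
  (act V (oneHit φ)).rTensor (Module.Dual ℂ V) (coevaluation ℂ V 1)

/-- Coevaluation of the right dual, `φ ↦ ∑ᵢ fⁱ ⊗ (φ ⇀ 1) · vᵢ`. -/
noncomputable def coevRight (φ : Module.Dual ℂ A) : Module.Dual ℂ V ⊗[ℂ] V :=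
  (act V (hitOne φ)).lTensor (Module.Dual ℂ V)
    (TensorProduct.comm ℂ V (Module.Dual ℂ V) (coevaluation ℂ V 1))

/-- The isomorphism `γ_V` from the left dual to the right dual of `V` given by the metric `g`,
`f ↦ f(g · )`. -/
noncomputable def gam (g : A) : Module.Dual ℂ V →ₗ[ℂ] Module.Dual ℂ V :=
  (act V g).dualMap

/-- The left inverse: `φ_V(T)` is the evaluation of the left dual composed with `γ_V⁻¹ ⊗ T` and with
the coevaluation of the right dual. -/
noncomputable def leftInverse (g : Aˣ) (T : V →ₗ[ℂ] V) (φ : Module.Dual ℂ A) :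
    Module.Dual ℂ A :=
  evLeft V (TensorProduct.map (gam V (↑g⁻¹ : A)) T (coevRight V φ))

/-- The right inverse: `ψ_V(T)` is the evaluation of the right dual composed with `T ⊗ γ_V` and with
the coevaluation of the left dual. -/
noncomputable def rightInverse (g : Aˣ) (T : V →ₗ[ℂ] V) (φ : Module.Dual ℂ A) :
    Module.Dual ℂ A :=
  evRight V (TensorProduct.map T (gam V (g : A)) (coevLeft V φ))

end Rigidity

/-! #### Dimensions of sectors and dimension matrices -/

/-- `g` is positive, invertible, implements `S²`, and is grouplike. -/
structure IsMetric (g : Aˣ) : Prop where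
  pos : ∃ b : A, (g : A) = star b * b
  implements : ∀ x : A, antipode (antipode x) = g * x * (↑g⁻¹ : A)
  comul_eq : comul (R := ℂ) (g : A) = ((g : A) ⊗ₜ[ℂ] (g : A)) * Δ1 A
  antipode_eq : antipode (g : A) = (↑g⁻¹ : A)

variable [FiniteDimensional ℂ A]

/-- `g` is a standard metric and `d` is the corresponding dimension function on the sectors:
for each sector `q` one has `φ_{V_q}(1) = d_q P_{q^R}` and `ψ_{V_q}(1) = d_q P_{q^L}` on the trivial
representation, where `P_ν` is the action of `z_ν^L` there. -/
structure IsStandardMetric (g : Aˣ) (d : Sector A → ℝ) : Prop where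
  metric : IsMetric g
  left : ∀ (q : Sector A) (ν : Vac A), IsRightVac q ν → ∀ φ ∈ trivialRep A,
    leftInverse (irrep q) g LinearMap.id φ = (d q : ℂ) • hit ν.zL φ
  right : ∀ (q : Sector A) (μ : Vac A), IsLeftVac q μ → ∀ φ ∈ trivialRep A,
    rightInverse (irrep q) g LinearMap.id φ = (d q : ℂ) • hit μ.zL φ

/-- `d` is the dimension function on the sectors: it comes from a standard metric. -/
def IsDimension (d : Sector A → ℝ) : Prop := ∃ g : Aˣ, IsStandardMetric g d

open Classical in
/-- The dimension matrix of the left `A`-module `V`, with entries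
`∑ N_V^q d_q` (sum over the sectors `q` with `q^L = μ` and `q^R = ν`). -/
noncomputable def dimMatrix (d : Sector A → ℝ) (V : Type*) [AddCommGroup V]
    [Module ℂ V] [Module A V] [IsScalarTower ℂ A V] : Matrix (Vac A) (Vac A) ℝ :=
  fun μ ν => ∑ q : Sector A with IsLeftVac q μ ∧ IsRightVac q ν, (mult q V : ℝ) * d q

open Classical in
/-- The norm of the block of a matrix over the vacua that belongs to the hyperselection
sector `H`. -/
noncomputable def blockNorm (M : Matrix (Vac A) (Vac A) ℝ) (H : Hyp A) : ℝ :=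
  l2Norm (M.submatrix (fun μ : {μ : Vac A // μ.InHyp H} => μ.1)
    (fun ν : {ν : Vac A // ν.InHyp H} => ν.1))

/-! #### The Markov trace -/

/-- `τ` is a Markov trace with index `c`. -/
structure IsMarkovTrace (τ : A →ₗ[ℂ] ℂ) (c : A) : Prop where
  trace : IsFaithfulTrace τ
  hypercentral : c ∈ leftSub A ⊓ rightSub A ⊓ Subalgebra.center ℂ A
  left : ∃ E, IsCondExp τ (leftSub A) E ∧ HasIndex E c
  right : ∃ E, IsCondExp τ (rightSub A) E ∧ HasIndex E c
  normalized : ∀ H : Hyp A, τ H.elt = 1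

end WeakHopf

end WHA

set_option linter.unusedSectionVars false

namespace WHA

/-! ### The projections ⊓ᴸ, ⊓ᴿ and the coproduct -/

section Basics

open Coalgebra CStarWeakHopfAlgebra

variable {A : Type*} [CStarAlgebra A] [CStarWeakHopfAlgebra A]

/-! Three ingredients are combined: a canonical metric, a formula for Watatani indices, and
Perron–Frobenius theory. Throughout, tr is the trace of the left regular representation, p_q = `prim
q` is an idempotent generating the left ideal V_q, and e_q is the central idempotent of q.

Metric. Slicing Δ(l l*) by tr, for a normalized left integral l, gives a positive k implementing S²
(`exists_implements`). For such k the slice (tr ⊗ id)((k⁻¹e_q ⊗ 1)Δ(1)) is central and lies in A^L,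
hence is a positive multiple of z^L with index q^R; on the other side one gets a multiple of z^R
with index q^L (`exists_dimL`, `exists_dimR`). Rescaling k on each sector makes the two multiples
equal to one number D_q, and D does not depend on the choices (`IsBalanced`). Since tr restricted to
e_q is N_A^q times the character of V_q, D_q = N_A^q d_q. That a balanced g is grouplike follows
from a positivity argument (`IsBalanced.comul_eq`). So standard metrics and balanced elements
coincide, which gives existence and uniqueness of the dimensions.

Index. For a *-subalgebra N with inclusion matrix Λ, the index c of the τ-preserving expectation
satisfies τ(c p_q) = (ΛᵀΛt)_q with t_q = τ(p_q). A scalar index on a block therefore makes t a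
positive eigenvector of ΛᵀΛ, and ‖Λ‖² is that scalar; this is (ii), and it also shows that the
Markov index is unique.

Existence. For N = A^R the element 1₍₁₎ ⊗ S(1₍₂₎) is a separability element, and a trace computation
with the Galois map a ⊗ v ↦ Δ(a)(1 ⊗ v) gives τ(cx) = (tr ⊗ τ)Δ(x); for A^L one gets (τ ⊗ tr)Δ(x).
The Markov condition thus says that τ is an eigenvector of convolution by tr on both sides. The
matrix of sums of D_q over sectors with given vacua is the dimension matrix of the regular module;
it is symmetric, and its hyperselection blocks are irreducible. With f its Perron–Frobenius vector,
the trace with τ(e_q) = f_{q^L} f_{q^R} D_q is S-invariant and has as index the norms of the blocks;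
a hypercentral rescaling normalizes it. This gives (iii) as well.

Uniqueness. For two Markov traces the vectors t, t' are positive eigenvectors of ΛᵀΛ with the same
eigenvalues. Their ratio is constant along connected components, so it defines an element of A^L and
of A^R, i.e. of the hypercenter, and the normalization makes it 1. -/

theorem exists_tensor_rep {M N : Type*} [AddCommGroup M] [Module ℂ M] [AddCommGroup N] [Module ℂ N]
    (t : M ⊗[ℂ] N) :
    ∃ (n : ℕ) (a : Fin n → M) (b : Fin n → N), t = ∑ i, a i ⊗ₜ[ℂ] b i := by
  induction t with
  | zero => exact ⟨0, Fin.elim0, Fin.elim0, by simp⟩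
  | tmul a b => exact ⟨1, fun _ => a, fun _ => b, by simp⟩
  | add x y hx hy =>
    obtain ⟨n, a, b, rfl⟩ := hx
    obtain ⟨m, c, d, rfl⟩ := hy
    refine ⟨n + m, Fin.append a c, Fin.append b d, ?_⟩
    simp [Fin.sum_univ_add]

/-- `⊓^L` as a linear map. -/
noncomputable def piLₗ : A →ₗ[ℂ] A :=
  (TensorProduct.lid ℂ A).toLinearMap ∘ₗ (counit (R := ℂ)).rTensor A ∘ₗ
    LinearMap.mulLeft ℂ (Δ1 A) ∘ₗ (TensorProduct.mk ℂ A A).flip 1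

/-- `⊓^R` as a linear map. -/
noncomputable def piRₗ : A →ₗ[ℂ] A :=
  (TensorProduct.rid ℂ A).toLinearMap ∘ₗ (counit (R := ℂ)).lTensor A ∘ₗ
    LinearMap.mulRight ℂ (Δ1 A) ∘ₗ TensorProduct.mk ℂ A A 1

theorem piLₗ_apply (x : A) : piLₗ x = piL x := rfl
theorem piRₗ_apply (x : A) : piRₗ x = piR x := rfl

theorem piL_mem (x : A) : piL x ∈ leftSub A := (mem_leftSub_iff _).2 ⟨x, rfl⟩
theorem piR_mem (x : A) : piR x ∈ rightSub A := (mem_rightSub_iff _).2 ⟨x, rfl⟩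

theorem piL_of_mem {l : A} (h : l ∈ leftSub A) : piL l = l := by
  rw [piL, ← h.2, rTensor_counit_comul, TensorProduct.lid_tmul, one_smul]

theorem piR_of_mem {r : A} (h : r ∈ rightSub A) : piR r = r := by
  rw [piR, ← h.1, lTensor_counit_comul, TensorProduct.rid_tmul, one_smul]

theorem mul_antipode_eq (x : A) :
    LinearMap.mul' ℂ A (antipode.lTensor A (comul (R := ℂ) x)) = piL x := mul_antipode x

theorem antipode_mul_eq (x : A) :
    LinearMap.mul' ℂ A (antipode.rTensor A (comul (R := ℂ) x)) = piR x := antipode_mul x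

section rep

variable {n : ℕ} {a b : Fin n → A}

theorem piL_eq_sum (h : Δ1 A = ∑ i, a i ⊗ₜ[ℂ] b i) (x : A) :
    piL x = ∑ i, counit (R := ℂ) (a i * x) • b i := by
  simp [piL, h, Finset.sum_mul]

theorem piR_eq_sum (h : Δ1 A = ∑ i, a i ⊗ₜ[ℂ] b i) (x : A) :
    piR x = ∑ i, counit (R := ℂ) (x * b i) • a i := by
  simp [piR, h, Finset.mul_sum]

theorem sum_mul_antipode {x : A} (h : comul (R := ℂ) x = ∑ i, a i ⊗ₜ[ℂ] b i) :
    ∑ i, a i * antipode (b i) = piL x := by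
  rw [← mul_antipode_eq, h]; simp

theorem sum_antipode_mul {x : A} (h : comul (R := ℂ) x = ∑ i, a i ⊗ₜ[ℂ] b i) :
    ∑ i, antipode (a i) * b i = piR x := by
  rw [← antipode_mul_eq, h]; simp

theorem sum_counit_left {x : A} (h : comul (R := ℂ) x = ∑ i, a i ⊗ₜ[ℂ] b i) :
    ∑ i, counit (R := ℂ) (a i) • b i = x := by
  have := congrArg (TensorProduct.lid ℂ A) (rTensor_counit_comul (R := ℂ) x)
  rw [h] at this; simpa using this

theorem sum_counit_right {x : A} (h : comul (R := ℂ) x = ∑ i, a i ⊗ₜ[ℂ] b i) :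
    ∑ i, counit (R := ℂ) (b i) • a i = x := by
  have := congrArg (TensorProduct.rid ℂ A) (lTensor_counit_comul (R := ℂ) x)
  rw [h] at this; simpa using this

end rep

theorem Δ1_eq : comul (R := ℂ) (1 : A) = Δ1 A := rfl

theorem piL_one : piL (1 : A) = 1 := piL_of_mem (leftSub A).one_mem
theorem piR_one : piR (1 : A) = 1 := piR_of_mem (rightSub A).one_mem

theorem counit_mul_eq (x y z : A) {n : ℕ} {a b : Fin n → A}
    (h : comul (R := ℂ) y = ∑ i, a i ⊗ₜ[ℂ] b i) :
    counit (R := ℂ) (x * y * z) =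
      ∑ i, counit (R := ℂ) (x * a i) * counit (R := ℂ) (b i * z) := by
  rw [counit_mul, h]; simp

theorem counit_mul_eq' (x y z : A) {n : ℕ} {a b : Fin n → A}
    (h : comul (R := ℂ) y = ∑ i, a i ⊗ₜ[ℂ] b i) :
    counit (R := ℂ) (x * y * z) =
      ∑ i, counit (R := ℂ) (x * b i) * counit (R := ℂ) (a i * z) := by
  rw [counit_mul', h]; simp [mul_comm]

/-- This is the second weak multiplicativity of ε at middle argument 1, where 1₍₂₎ meets y and 1₍₁₎
meets x. -/
theorem counit_mul_piL (y x : A) : counit (R := ℂ) (y * piL x) = counit (R := ℂ) (y * x) := by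
  obtain ⟨n, a, b, h⟩ := exists_tensor_rep (Δ1 A)
  rw [piL_eq_sum h, Finset.mul_sum, map_sum]
  have := counit_mul_eq' y 1 x h
  rw [mul_one] at this
  rw [this]
  exact Finset.sum_congr rfl fun i _ => by rw [mul_smul_comm, map_smul, smul_eq_mul, mul_comm]

theorem counit_piR_mul (x y : A) : counit (R := ℂ) (piR x * y) = counit (R := ℂ) (x * y) := by
  obtain ⟨n, a, b, h⟩ := exists_tensor_rep (Δ1 A)
  rw [piR_eq_sum h, Finset.sum_mul, map_sum]
  have := counit_mul_eq' x 1 y h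
  rw [mul_one] at this
  rw [this]
  exact Finset.sum_congr rfl fun i _ => by rw [smul_mul_assoc, map_smul, smul_eq_mul]

theorem piL_mul_piL (x y : A) : piL (x * piL y) = piL (x * y) := by
  obtain ⟨n, a, b, h⟩ := exists_tensor_rep (Δ1 A)
  simp only [piL_eq_sum h (x * _), ← mul_assoc, counit_mul_piL]

/-- The left side is Δ(x) ⊗ 1 multiplied by 1 ⊗ Δ(1), with ε on the middle leg. Writing Δ(x) =
Δ(1)Δ(x) brings in (1 ⊗ Δ(1))(Δ(1) ⊗ 1), which is the iterated coproduct of 1; multiplicativity then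
gives (Δ ⊗ id)(Δ(1)(x ⊗ 1)), and ε in the middle undoes Δ. -/
theorem lTensor_piL_comul (x : A) :
    piLₗ.lTensor A (comul (R := ℂ) x) = Δ1 A * (x ⊗ₜ[ℂ] (1 : A)) := by
  let F : A ⊗[ℂ] (A ⊗[ℂ] A) →ₗ[ℂ] A ⊗[ℂ] A :=
    LinearMap.lTensor A ((TensorProduct.lid ℂ A).toLinearMap ∘ₗ (counit (R := ℂ)).rTensor A)
  have h1 : ∀ t w : A ⊗[ℂ] A, F (((1 : A) ⊗ₜ[ℂ] w) *
      TensorProduct.assoc ℂ A A A (t ⊗ₜ[ℂ] (1 : A))) = LinearMap.lTensor A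
        ((TensorProduct.lid ℂ A).toLinearMap ∘ₗ (counit (R := ℂ)).rTensor A ∘ₗ
    LinearMap.mulLeft ℂ w ∘ₗ (TensorProduct.mk ℂ A A).flip 1) t := by
    intro t w
    induction t with
    | zero => simp
    | tmul a b => simp [F]
    | add a b ha hb => simp only [TensorProduct.add_tmul, map_add, mul_add, ha, hb]
  have h2 : ∀ t : A ⊗[ℂ] A, F (TensorProduct.assoc ℂ A A A ((comul (R := ℂ)).rTensor A t)) = t := by
    intro t
    induction t with
    | zero => simp
    | tmul a b =>
      obtain ⟨n, c, d, h⟩ := exists_tensor_rep (comul (R := ℂ) a)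
      simp only [LinearMap.rTensor_tmul, h, TensorProduct.sum_tmul, map_sum,
        TensorProduct.assoc_tmul, F, LinearMap.lTensor_tmul, LinearMap.comp_apply,
        LinearMap.rTensor_tmul, LinearEquiv.coe_coe, TensorProduct.lid_tmul]
      simp only [← TensorProduct.smul_tmul]
      rw [← TensorProduct.sum_tmul, sum_counit_right h]
    | add a b ha hb => simp only [map_add, ha, hb]
  have h3 : ∀ t : A ⊗[ℂ] A, TensorProduct.assoc ℂ A A A ((comul (R := ℂ)).rTensor A t) *
      TensorProduct.assoc ℂ A A A (comul (R := ℂ) x ⊗ₜ[ℂ] (1 : A)) =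
      TensorProduct.assoc ℂ A A A ((comul (R := ℂ)).rTensor A (t * (x ⊗ₜ[ℂ] (1 : A)))) := by
    intro t
    have hm : ∀ u v : (A ⊗[ℂ] A) ⊗[ℂ] A, TensorProduct.assoc ℂ A A A u *
        TensorProduct.assoc ℂ A A A v = TensorProduct.assoc ℂ A A A (u * v) :=
      fun u v => (map_mul (Algebra.TensorProduct.assoc ℂ ℂ ℂ A A A) u v).symm
    rw [hm]
    congr 1
    induction t with
    | zero => simp
    | tmul a b => simp [comul_mul]
    | add a b ha hb => simp only [map_add, add_mul, ha, hb]
  have e : piLₗ.lTensor A (comul (R := ℂ) x) =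
      F (((1 : A) ⊗ₜ[ℂ] Δ1 A) * TensorProduct.assoc ℂ A A A (comul (R := ℂ) x ⊗ₜ[ℂ] (1 : A))) :=
    (h1 _ _).symm
  rw [e, comul_eq_Δ1_mul]
  have hm : TensorProduct.assoc ℂ A A A ((Δ1 A * comul (R := ℂ) x) ⊗ₜ[ℂ] (1 : A)) =
      TensorProduct.assoc ℂ A A A (Δ1 A ⊗ₜ[ℂ] (1 : A)) *
      TensorProduct.assoc ℂ A A A (comul (R := ℂ) x ⊗ₜ[ℂ] (1 : A)) := by
    rw [show (Δ1 A * comul (R := ℂ) x) ⊗ₜ[ℂ] (1 : A) = (Δ1 A ⊗ₜ[ℂ] (1 : A)) *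
      (comul (R := ℂ) x ⊗ₜ[ℂ] (1 : A)) by rw [Algebra.TensorProduct.tmul_mul_tmul, one_mul]]
    exact map_mul (Algebra.TensorProduct.assoc ℂ ℂ ℂ A A A) _ _
  rw [hm, ← mul_assoc, show (1 : A) ⊗ₜ[ℂ] Δ1 A * TensorProduct.assoc ℂ A A A (Δ1 A ⊗ₜ[ℂ] (1 : A)) =
    TensorProduct.assoc ℂ A A A ((comul (R := ℂ)).rTensor A (Δ1 A)) from
      comul_one'.symm.trans (coassoc_apply (R := ℂ) (1 : A)).symm, h3, h2]

theorem rTensor_piR_comul (x : A) :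
    piRₗ.rTensor A (comul (R := ℂ) x) = ((1 : A) ⊗ₜ[ℂ] x) * Δ1 A := by
  let F : A ⊗[ℂ] (A ⊗[ℂ] A) →ₗ[ℂ] A ⊗[ℂ] A :=
    LinearMap.lTensor A ((TensorProduct.lid ℂ A).toLinearMap ∘ₗ (counit (R := ℂ)).rTensor A)
  have h1 : ∀ t w : A ⊗[ℂ] A, F (((1 : A) ⊗ₜ[ℂ] t) *
      TensorProduct.assoc ℂ A A A (w ⊗ₜ[ℂ] (1 : A))) = LinearMap.rTensor A
        ((TensorProduct.rid ℂ A).toLinearMap ∘ₗ (counit (R := ℂ)).lTensor A ∘ₗ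
    LinearMap.mulRight ℂ w ∘ₗ TensorProduct.mk ℂ A A 1) t := by
    intro t w
    induction t with
    | zero => simp
    | tmul a b =>
      induction w with
      | zero => simp
      | tmul c d => simp [F, TensorProduct.smul_tmul]
      | add c d hc hd =>
        simp only [TensorProduct.add_tmul, map_add, mul_add, hc, hd]
        simp only [LinearMap.rTensor_tmul, LinearMap.comp_apply, LinearMap.mulRight_apply, mul_add,
          map_add, TensorProduct.add_tmul]
    | add a b ha hb => simp only [TensorProduct.tmul_add, map_add, add_mul, ha, hb]
  have h2 : ∀ t : A ⊗[ℂ] A, F ((comul (R := ℂ)).lTensor A t) = t := by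
    intro t
    induction t with
    | zero => simp
    | tmul a b =>
      obtain ⟨n, c, d, h⟩ := exists_tensor_rep (comul (R := ℂ) b)
      simp only [LinearMap.lTensor_tmul, h, F, map_sum, LinearMap.comp_apply,
        LinearMap.rTensor_tmul, LinearEquiv.coe_coe, TensorProduct.lid_tmul]
      rw [sum_counit_left h]
    | add a b ha hb => simp only [map_add, ha, hb]
  have h3 : ∀ t : A ⊗[ℂ] A, ((1 : A) ⊗ₜ[ℂ] comul (R := ℂ) x) * (comul (R := ℂ)).lTensor A t =
      (comul (R := ℂ)).lTensor A (((1 : A) ⊗ₜ[ℂ] x) * t) := by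
    intro t
    induction t with
    | zero => simp
    | tmul a b => simp [comul_mul]
    | add a b ha hb => simp only [map_add, mul_add, ha, hb]
  have e : piRₗ.rTensor A (comul (R := ℂ) x) =
      F (((1 : A) ⊗ₜ[ℂ] comul (R := ℂ) x) * TensorProduct.assoc ℂ A A A (Δ1 A ⊗ₜ[ℂ] (1 : A))) :=
    (h1 _ _).symm
  rw [e, comul_eq_mul_Δ1]
  have hm : (1 : A) ⊗ₜ[ℂ] (comul (R := ℂ) x * Δ1 A) = ((1 : A) ⊗ₜ[ℂ] comul (R := ℂ) x) *
      ((1 : A) ⊗ₜ[ℂ] Δ1 A) := by rw [Algebra.TensorProduct.tmul_mul_tmul, one_mul]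
  rw [hm, mul_assoc, show (1 : A) ⊗ₜ[ℂ] Δ1 A * TensorProduct.assoc ℂ A A A (Δ1 A ⊗ₜ[ℂ] (1 : A)) =
    (comul (R := ℂ)).lTensor A (Δ1 A) from comul_one'.symm, h3, h2]

end Basics

/-! ### Module properties of maps acting on one tensor leg -/

section TensorMaps

variable {A : Type*} [CStarAlgebra A]

theorem lTensor_mul_left (f : A →ₗ[ℂ] A) (x : A) (t : A ⊗[ℂ] A) :
    f.lTensor A ((x ⊗ₜ[ℂ] (1 : A)) * t) = (x ⊗ₜ[ℂ] (1 : A)) * f.lTensor A t := by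
  induction t with
  | zero => simp
  | tmul a b => simp
  | add a b ha hb => simp only [map_add, mul_add, ha, hb]

theorem rTensor_mul_right (f : A →ₗ[ℂ] A) (x : A) (t : A ⊗[ℂ] A) :
    f.rTensor A (t * ((1 : A) ⊗ₜ[ℂ] x)) = f.rTensor A t * ((1 : A) ⊗ₜ[ℂ] x) := by
  induction t with
  | zero => simp
  | tmul a b => simp
  | add a b ha hb => simp only [map_add, add_mul, ha, hb]

theorem mul'_left (x : A) (t : A ⊗[ℂ] A) :
    LinearMap.mul' ℂ A ((x ⊗ₜ[ℂ] (1 : A)) * t) = x * LinearMap.mul' ℂ A t := by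
  induction t with
  | zero => simp
  | tmul a b => simp [mul_assoc]
  | add a b ha hb => simp only [map_add, mul_add, ha, hb]

theorem mul'_right (x : A) (t : A ⊗[ℂ] A) :
    LinearMap.mul' ℂ A (t * ((1 : A) ⊗ₜ[ℂ] x)) = LinearMap.mul' ℂ A t * x := by
  induction t with
  | zero => simp
  | tmul a b => simp [mul_assoc]
  | add a b ha hb => simp only [map_add, add_mul, ha, hb]

end TensorMaps

/-! ### The antipode is antimultiplicative and anticomultiplicative -/

section Antipode

open Coalgebra CStarWeakHopfAlgebra

variable {A : Type*} [CStarAlgebra A] [CStarWeakHopfAlgebra A]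

section left_right

theorem comul_mul_left {l : A} (hl : l ∈ leftSub A) (x : A) :
    comul (R := ℂ) (l * x) = (l ⊗ₜ[ℂ] (1 : A)) * comul (R := ℂ) x := by
  rw [comul_mul, hl.1, mul_assoc, ← comul_eq_Δ1_mul]

theorem comul_mul_left' {l : A} (hl : l ∈ leftSub A) (x : A) :
    comul (R := ℂ) (x * l) = comul (R := ℂ) x * (l ⊗ₜ[ℂ] (1 : A)) := by
  rw [comul_mul, hl.2, ← mul_assoc, ← comul_eq_mul_Δ1]

theorem comul_mul_right {r : A} (hr : r ∈ rightSub A) (x : A) :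
    comul (R := ℂ) (r * x) = ((1 : A) ⊗ₜ[ℂ] r) * comul (R := ℂ) x := by
  rw [comul_mul, hr.1, mul_assoc, ← comul_eq_Δ1_mul]

theorem comul_mul_right' {r : A} (hr : r ∈ rightSub A) (x : A) :
    comul (R := ℂ) (x * r) = comul (R := ℂ) x * ((1 : A) ⊗ₜ[ℂ] r) := by
  rw [comul_mul, hr.2, ← mul_assoc, ← comul_eq_mul_Δ1]

theorem piL_left_mul {l : A} (hl : l ∈ leftSub A) (x : A) : piL (l * x) = l * piL x := by
  rw [← mul_antipode_eq, comul_mul_left hl, lTensor_mul_left, mul'_left, mul_antipode_eq]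

theorem piR_mul_right {r : A} (hr : r ∈ rightSub A) (x : A) : piR (x * r) = piR x * r := by
  rw [← antipode_mul_eq, comul_mul_right' hr, rTensor_mul_right, mul'_right, antipode_mul_eq]

theorem lTensor_piL_Δ1 : piLₗ.lTensor A (Δ1 A) = Δ1 A := by
  have := lTensor_piL_comul (1 : A)
  rwa [← Algebra.TensorProduct.one_def, mul_one] at this

theorem rTensor_piR_Δ1 : piRₗ.rTensor A (Δ1 A) = Δ1 A := by
  have := rTensor_piR_comul (1 : A)
  rwa [← Algebra.TensorProduct.one_def, one_mul] at this

/-- Applying ⊓ᴿ to the first leg and ⊓ᴸ to the second leaves Δ(1) unchanged, and the images of these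
maps are A^R and A^L. -/
theorem exists_Δ1_rep : ∃ (n : ℕ) (r l : Fin n → A), (∀ i, r i ∈ rightSub A) ∧
    (∀ i, l i ∈ leftSub A) ∧ Δ1 A = ∑ i, r i ⊗ₜ[ℂ] l i := by
  obtain ⟨n, a, b, h⟩ := exists_tensor_rep (Δ1 A)
  refine ⟨n, fun i => piR (a i), fun i => piL (b i), fun i => piR_mem _, fun i => piL_mem _, ?_⟩
  conv_lhs => rw [← rTensor_piR_Δ1, ← lTensor_piL_Δ1, h]
  simp [piLₗ_apply, piRₗ_apply]

end left_right

theorem antipode_eq_sum_piL {x : A} {n : ℕ} {a b : Fin n → A}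
    (h : comul (R := ℂ) x = ∑ i, a i ⊗ₜ[ℂ] b i) : ∑ i, antipode (a i) * piL (b i) = antipode x := by
  rw [← antipode_mul_antipode x, h]
  simp only [map_sum, LinearMap.lTensor_tmul]
  refine Finset.sum_congr rfl fun i _ => ?_
  rw [← mul_antipode_eq]
  simp [TensorProduct.map_tmul]

/-- Coassociativity in the form used for Sweedler computations: `F` encodes the expression in x₍₁₎,
x₍₂₎, x₍₃₎ that is to be evaluated in two ways. -/
theorem coassoc_sum {M : Type*} [AddCommGroup M] [Module ℂ M] (F : A ⊗[ℂ] (A ⊗[ℂ] A) →ₗ[ℂ] M)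
    {x : A} {n : ℕ} {a b : Fin n → A} (h : comul (R := ℂ) x = ∑ i, a i ⊗ₜ[ℂ] b i) :
    ∑ i, F (TensorProduct.assoc ℂ A A A (comul (R := ℂ) (a i) ⊗ₜ[ℂ] b i)) =
      ∑ i, F (a i ⊗ₜ[ℂ] comul (R := ℂ) (b i)) := by
  have := congrArg F (coassoc_apply (R := ℂ) x)
  rw [h] at this
  simpa using this

theorem antipode_eq_sum_piR {x : A} {n : ℕ} {a b : Fin n → A}
    (h : comul (R := ℂ) x = ∑ i, a i ⊗ₜ[ℂ] b i) : ∑ i, piR (a i) * antipode (b i) = antipode x := by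
  have := coassoc_sum (LinearMap.mul' ℂ A ∘ₗ
    TensorProduct.map antipode (LinearMap.mul' ℂ A ∘ₗ antipode.lTensor A)) h
  rw [← antipode_eq_sum_piL h]
  refine Eq.trans ?_ (this.trans ?_)
  · refine Finset.sum_congr rfl fun i _ => ?_
    obtain ⟨m, c, d, h'⟩ := exists_tensor_rep (comul (R := ℂ) (a i))
    rw [← sum_antipode_mul h', h']
    simp [TensorProduct.sum_tmul, Finset.sum_mul, mul_assoc]
  · refine Finset.sum_congr rfl fun i _ => ?_
    rw [← mul_antipode_eq]
    simp [TensorProduct.map_tmul]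

/-- `S(x₍₁₎) x₍₂₎ ⊗ x₍₃₎ = (1 ⊗ x) Δ(1)`. -/
theorem sum_antipode_comul {x : A} {n : ℕ} {a b : Fin n → A}
    (h : comul (R := ℂ) x = ∑ i, a i ⊗ₜ[ℂ] b i) :
    ∑ i, (antipode (a i) ⊗ₜ[ℂ] (1 : A)) * comul (R := ℂ) (b i) = ((1 : A) ⊗ₜ[ℂ] x) * Δ1 A := by
  have := coassoc_sum ((LinearMap.mul' ℂ A).rTensor A ∘ₗ
    (TensorProduct.assoc ℂ A A A).symm.toLinearMap ∘ₗ antipode.rTensor (A ⊗[ℂ] A)) h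
  rw [← rTensor_piR_comul]
  refine Eq.trans ?_ (this.symm.trans ?_)
  · refine Finset.sum_congr rfl fun i _ => ?_
    obtain ⟨m, c, d, h'⟩ := exists_tensor_rep (comul (R := ℂ) (b i))
    rw [h']
    simp [TensorProduct.tmul_sum, Finset.mul_sum]
  · rw [h, map_sum]
    refine Finset.sum_congr rfl fun i _ => ?_
    obtain ⟨m, c, d, h'⟩ := exists_tensor_rep (comul (R := ℂ) (a i))
    rw [LinearMap.rTensor_tmul, piRₗ_apply, ← sum_antipode_mul h', h']
    simp [TensorProduct.sum_tmul]

/-- `x₍₁₎ ⊗ x₍₂₎ S(x₍₃₎) = Δ(1) (x ⊗ 1)`. -/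
theorem sum_comul_antipode {x : A} {n : ℕ} {a b : Fin n → A}
    (h : comul (R := ℂ) x = ∑ i, a i ⊗ₜ[ℂ] b i) :
    ∑ i, comul (R := ℂ) (a i) * ((1 : A) ⊗ₜ[ℂ] antipode (b i)) = Δ1 A * (x ⊗ₜ[ℂ] (1 : A)) := by
  have := coassoc_sum ((LinearMap.mul' ℂ A).lTensor A ∘ₗ
    (antipode.lTensor A).lTensor A) h
  rw [← lTensor_piL_comul]
  refine Eq.trans ?_ (this.trans ?_)
  · refine Finset.sum_congr rfl fun i _ => ?_
    obtain ⟨m, c, d, h'⟩ := exists_tensor_rep (comul (R := ℂ) (a i))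
    rw [h']
    simp [TensorProduct.sum_tmul, Finset.sum_mul]
  · rw [h, map_sum]
    refine Finset.sum_congr rfl fun i _ => ?_
    rw [LinearMap.lTensor_tmul, piLₗ_apply, ← mul_antipode_eq]
    simp

/-- With (1 ⊗ x)Δ(1) = S(x₍₁₎)x₍₂₎ ⊗ x₍₃₎ the left side becomes S(x₍₁₎)⊓ᴸ(x₍₂₎). The gain is that x
occurs as a plain factor, so that a product xy can be treated one factor at a time. -/
theorem mul'_antipode_mul_Δ1 (x : A) :
    LinearMap.mul' ℂ A (antipode.lTensor A (((1 : A) ⊗ₜ[ℂ] x) * Δ1 A)) = antipode x := by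
  obtain ⟨n, a, b, h⟩ := exists_tensor_rep (comul (R := ℂ) x)
  rw [← sum_antipode_comul h, map_sum, map_sum, ← antipode_eq_sum_piL h]
  refine Finset.sum_congr rfl fun i _ => ?_
  rw [lTensor_mul_left, mul'_left, mul_antipode_eq]

/-- The antipode is antimultiplicative. -/
theorem antipode_mul_rev (x y : A) :
    antipode (x * y) = (antipode y * antipode x : A) := by
  obtain ⟨n, a, b, h⟩ := exists_tensor_rep (comul (R := ℂ) x)
  obtain ⟨m, c, d, h'⟩ := exists_tensor_rep (comul (R := ℂ) y)
  -- Since l ∈ A^L passes through Δ(1) in the first leg, it can be pulled out to the left of S(x).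
  -- Below, S(xy) is expanded as S(y₍₁₎)S(x₍₁₎)⊓ᴸ(x₍₂₎⊓ᴸ(y₍₂₎)), and this is applied with l =
  -- ⊓ᴸ(y₍₂₎).
  have key : ∀ l ∈ leftSub A, ∑ i, antipode (a i) * piL (b i * l) = l * antipode x := by
    intro l hl
    have e : ((1 : A) ⊗ₜ[ℂ] x) * Δ1 A * (l ⊗ₜ[ℂ] (1 : A)) =
        (l ⊗ₜ[ℂ] (1 : A)) * (((1 : A) ⊗ₜ[ℂ] x) * Δ1 A) := by
      rw [mul_assoc, ← hl.2, hl.1, ← mul_assoc, ← mul_assoc]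
      simp
    have := congrArg (fun t => LinearMap.mul' ℂ A (antipode.lTensor A t)) e
    simp only [lTensor_mul_left antipode l, mul'_left, mul'_antipode_mul_Δ1] at this
    rw [← this, ← sum_antipode_comul h, Finset.sum_mul, map_sum, map_sum]
    refine Finset.sum_congr rfl fun i _ => ?_
    rw [mul_assoc, ← comul_mul_left' hl, lTensor_mul_left, mul'_left, mul_antipode_eq]
  calc antipode (x * y)
      = LinearMap.mul' ℂ A (antipode.lTensor A (((1 : A) ⊗ₜ[ℂ] x) *
          (((1 : A) ⊗ₜ[ℂ] y) * Δ1 A))) := by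
        rw [← mul'_antipode_mul_Δ1 (x * y), ← mul_assoc]; simp
    _ = ∑ j, antipode (c j) * ∑ i, antipode (a i) * piL (b i * piL (d j)) := by
        rw [← sum_antipode_comul h', Finset.mul_sum, map_sum, map_sum]
        refine Finset.sum_congr rfl fun j _ => ?_
        rw [← mul_assoc, show ((1 : A) ⊗ₜ[ℂ] x) * (antipode (c j) ⊗ₜ[ℂ] (1 : A)) =
          (antipode (c j) ⊗ₜ[ℂ] (1 : A)) * ((1 : A) ⊗ₜ[ℂ] x) by simp, mul_assoc,
          comul_eq_Δ1_mul, ← mul_assoc (_ ⊗ₜ[ℂ] x), ← sum_antipode_comul h, lTensor_mul_left,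
          mul'_left, Finset.sum_mul, map_sum, map_sum]
        congr 1
        refine Finset.sum_congr rfl fun i _ => ?_
        rw [mul_assoc, ← comul_mul, lTensor_mul_left, mul'_left, mul_antipode_eq, piL_mul_piL]
    _ = antipode y * antipode x := by
        rw [← antipode_eq_sum_piL h', Finset.sum_mul]
        refine Finset.sum_congr rfl fun j _ => ?_
        rw [key _ (piL_mem _), mul_assoc]

/-- As Δ(r) = 1₍₁₎ ⊗ 1₍₂₎r with 1₍₂₎ ∈ A^L, one has S(r) = S(1₍₁₎)⊓ᴸ(1₍₂₎r) = S(1₍₁₎)1₍₂₎⊓ᴸ(r), and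
the first factor is 1. -/
theorem antipode_of_mem_rightSub {r : A} (hr : r ∈ rightSub A) : antipode r = piL r := by
  obtain ⟨n, a, b, ha, hb, h⟩ := exists_Δ1_rep (A := A)
  have h' : comul (R := ℂ) r = ∑ i, a i ⊗ₜ[ℂ] (b i * r) := by
    rw [hr.2, h]; simp [Finset.sum_mul]
  have h1 : comul (R := ℂ) (1 : A) = ∑ i, a i ⊗ₜ[ℂ] b i := h
  have h2 := sum_antipode_mul h1
  rw [piR_one] at h2
  rw [← antipode_eq_sum_piL h', ← one_mul (piL r), ← h2, Finset.sum_mul]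
  refine Finset.sum_congr rfl fun i _ => ?_
  rw [piL_left_mul (hb i), mul_assoc]

theorem antipode_of_mem_leftSub {l : A} (hl : l ∈ leftSub A) : antipode l = piR l := by
  obtain ⟨n, a, b, ha, hb, h⟩ := exists_Δ1_rep (A := A)
  have h' : comul (R := ℂ) l = ∑ i, (l * a i) ⊗ₜ[ℂ] b i := by
    rw [hl.1, h]; simp [Finset.mul_sum]
  have h1 : comul (R := ℂ) (1 : A) = ∑ i, a i ⊗ₜ[ℂ] b i := h
  have h2 := sum_mul_antipode h1
  rw [piL_one] at h2
  rw [← antipode_eq_sum_piR h', ← mul_one (piR l), ← h2, Finset.mul_sum]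
  refine Finset.sum_congr rfl fun i _ => ?_
  rw [piR_mul_right (ha i), mul_assoc]

theorem antipode_one : antipode (1 : A) = 1 := by
  rw [antipode_of_mem_leftSub (leftSub A).one_mem, piR_one]

theorem antipode_mem_leftSub {r : A} (hr : r ∈ rightSub A) : antipode r ∈ leftSub A := by
  rw [antipode_of_mem_rightSub hr]; exact piL_mem _

theorem antipode_mem_rightSub {l : A} (hl : l ∈ leftSub A) : antipode l ∈ rightSub A := by
  rw [antipode_of_mem_leftSub hl]; exact piR_mem _

theorem counit_antipode (x : A) : counit (R := ℂ) (antipode x : A) = counit (R := ℂ) x := by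
  obtain ⟨n, a, b, h⟩ := exists_tensor_rep (comul (R := ℂ) x)
  rw [← antipode_eq_sum_piL h, map_sum]
  simp only [counit_mul_piL]
  rw [← map_sum, sum_antipode_mul h]
  simpa using counit_piR_mul x 1

/-- `Δ(1)` is invariant under `S ⊗ S` followed by the flip. -/
theorem antipode_flip_Δ1 {n : ℕ} {a b : Fin n → A} (h : Δ1 A = ∑ i, a i ⊗ₜ[ℂ] b i) :
    ∑ i, (antipode (b i) ⊗ₜ[ℂ] antipode (a i) : A ⊗[ℂ] A) = Δ1 A := by
  have flip : ∀ (m : ℕ) (c d : Fin m → A), Δ1 A = ∑ i, c i ⊗ₜ[ℂ] d i →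
      ∑ i, (antipode (d i) ⊗ₜ[ℂ] antipode (c i) : A ⊗[ℂ] A) =
      TensorProduct.comm ℂ A A (TensorProduct.map antipode antipode (Δ1 A)) := by
    intro m c d h'
    rw [h']; simp
  rw [flip n a b h]
  obtain ⟨m, r, l, hr, hl, h'⟩ := exists_Δ1_rep (A := A)
  rw [← flip m r l h']
  simp only [antipode_of_mem_leftSub (hl _), antipode_of_mem_rightSub (hr _)]
  calc ∑ i, piR (l i) ⊗ₜ[ℂ] piL (r i)
      = ∑ j, r j ⊗ₜ[ℂ] piL (l j) := by
        simp only [piR_eq_sum h', piL_eq_sum h', TensorProduct.sum_tmul, TensorProduct.tmul_sum,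
          TensorProduct.smul_tmul_smul]
        conv_rhs => rw [Finset.sum_comm]
        rw [Finset.sum_comm]
        refine Finset.sum_congr rfl fun j _ => ?_
        rw [Finset.sum_comm]
        refine Finset.sum_congr rfl fun k _ => ?_
        rw [← Finset.sum_smul, TensorProduct.tmul_smul]
        congr 1
        have := counit_mul_eq (r j) 1 (l k) h'
        rw [mul_one] at this
        rw [this]
        exact Finset.sum_congr rfl fun i _ => mul_comm _ _
    _ = Δ1 A := by
        rw [h']
        exact Finset.sum_congr rfl fun j _ => by rw [piL_of_mem (hl j)]

/-- `S(x₍₂₎) ⊗ S(x₍₁₎)`. -/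
noncomputable def antipodeComulFlip : A →ₗ[ℂ] A ⊗[ℂ] A :=
  (TensorProduct.comm ℂ A A).toLinearMap ∘ₗ TensorProduct.map antipode antipode ∘ₗ comul (R := ℂ)

theorem antipodeComulFlip_eq {x : A} {n : ℕ} {a b : Fin n → A}
    (h : comul (R := ℂ) x = ∑ i, a i ⊗ₜ[ℂ] b i) :
    antipodeComulFlip x = ∑ i, (antipode (b i) ⊗ₜ[ℂ] antipode (a i) : A ⊗[ℂ] A) := by
  simp [antipodeComulFlip, h]

theorem antipodeComulFlip_mul (x y : A) :
    antipodeComulFlip (x * y) = antipodeComulFlip y * antipodeComulFlip x := by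
  obtain ⟨n, a, b, h⟩ := exists_tensor_rep (comul (R := ℂ) x)
  obtain ⟨m, c, d, h'⟩ := exists_tensor_rep (comul (R := ℂ) y)
  rw [antipodeComulFlip_eq h, antipodeComulFlip_eq h']
  simp [antipodeComulFlip, comul_mul, h, h', Finset.sum_mul, Finset.mul_sum, antipode_mul_rev]
  exact Finset.sum_comm

theorem antipodeComulFlip_one : antipodeComulFlip (1 : A) = Δ1 A := by
  obtain ⟨n, a, b, h⟩ := exists_tensor_rep (Δ1 A)
  rw [antipodeComulFlip_eq (x := (1 : A)) h, antipode_flip_Δ1 h]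

/-- The antipode is anticomultiplicative. -/
theorem comul_antipode (x : A) :
    comul (R := ℂ) (antipode x : A) = antipodeComulFlip x := by
  -- Uniqueness of convolution inverses in weak form. With T = `antipodeComulFlip`, the convolution
  -- Δ * T is Δ ∘ ⊓ᴸ and (Δ ∘ S) * Δ is Δ ∘ ⊓ᴿ; evaluating (Δ ∘ S) * Δ * T in both ways yields
  -- Δ(S(x)) = Δ(1)T(x).
  have hA : ∀ {x : A} {n : ℕ} {a b : Fin n → A}, comul (R := ℂ) x = ∑ i, a i ⊗ₜ[ℂ] b i →
      ∑ i, comul (R := ℂ) (a i) * antipodeComulFlip (b i) = comul (R := ℂ) (piL x) := by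
    intro x n a b h
    have := coassoc_sum (LinearMap.mul' ℂ (A ⊗[ℂ] A) ∘ₗ
      TensorProduct.map (comul (R := ℂ)) ((TensorProduct.comm ℂ A A).toLinearMap ∘ₗ
        TensorProduct.map antipode antipode)) h
    refine Eq.trans ?_ (this.symm.trans ?_)
    · exact Finset.sum_congr rfl fun i _ => by simp [antipodeComulFlip]
    · have : ∀ i, (LinearMap.mul' ℂ (A ⊗[ℂ] A) ∘ₗ
          TensorProduct.map (comul (R := ℂ)) ((TensorProduct.comm ℂ A A).toLinearMap ∘ₗ
          TensorProduct.map antipode antipode)) (TensorProduct.assoc ℂ A A A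
            (comul (R := ℂ) (a i) ⊗ₜ[ℂ] b i)) =
          Δ1 A * ((a i * antipode (b i)) ⊗ₜ[ℂ] (1 : A)) := by
        intro i
        obtain ⟨m, c, d, h'⟩ := exists_tensor_rep (comul (R := ℂ) (a i))
        rw [show (a i * antipode (b i)) ⊗ₜ[ℂ] (1 : A) =
          (a i ⊗ₜ[ℂ] (1 : A)) * (antipode (b i) ⊗ₜ[ℂ] (1 : A)) by simp, ← mul_assoc,
          ← sum_comul_antipode h', h', Finset.sum_mul]
        simp [TensorProduct.sum_tmul, mul_assoc]
      simp only [this]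
      rw [← Finset.mul_sum, ← TensorProduct.sum_tmul, sum_mul_antipode h]
      exact (piL_mem x).2.symm
  obtain ⟨n, a, b, h⟩ := exists_tensor_rep (comul (R := ℂ) x)
  have h3 := coassoc_sum (LinearMap.mul' ℂ (A ⊗[ℂ] A) ∘ₗ
    TensorProduct.map (comul (R := ℂ) ∘ₗ antipode) (LinearMap.mul' ℂ (A ⊗[ℂ] A) ∘ₗ
      TensorProduct.map (comul (R := ℂ)) antipodeComulFlip)) h
  calc comul (R := ℂ) (antipode x : A)
      = ∑ i, comul (R := ℂ) (antipode (a i) : A) * comul (R := ℂ) (piL (b i)) := by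
        simp only [← comul_mul]
        rw [← map_sum, antipode_eq_sum_piL h]
    _ = ∑ i, comul (R := ℂ) (piR (a i)) * antipodeComulFlip (b i) := by
        refine Eq.trans ?_ (h3.symm.trans ?_)
        · refine Finset.sum_congr rfl fun i _ => ?_
          obtain ⟨m, c, d, h'⟩ := exists_tensor_rep (comul (R := ℂ) (b i))
          rw [← hA h', h']
          simp [TensorProduct.tmul_sum, Finset.mul_sum]
        · refine Finset.sum_congr rfl fun i _ => ?_
          obtain ⟨m, c, d, h'⟩ := exists_tensor_rep (comul (R := ℂ) (a i))
          rw [← sum_antipode_mul h', h']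
          simp [TensorProduct.sum_tmul, Finset.sum_mul, mul_assoc, comul_mul]
    _ = Δ1 A * antipodeComulFlip x := by
        have h4 := coassoc_sum ((TensorProduct.comm ℂ A A).toLinearMap ∘ₗ
          TensorProduct.map (LinearMap.mul' ℂ A ∘ₗ TensorProduct.map piRₗ antipode) antipode ∘ₗ
          (TensorProduct.assoc ℂ A A A).symm.toLinearMap) h
        have h5 : ∑ i, ((1 : A) ⊗ₜ[ℂ] piR (a i)) * antipodeComulFlip (b i) =
            antipodeComulFlip x := by
          refine Eq.trans ?_ (h4.symm.trans ?_)
          · refine Finset.sum_congr rfl fun i _ => ?_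
            obtain ⟨m, c, d, h'⟩ := exists_tensor_rep (comul (R := ℂ) (b i))
            rw [antipodeComulFlip_eq h', h']
            simp [TensorProduct.tmul_sum, Finset.mul_sum, piRₗ_apply]
          · rw [antipodeComulFlip_eq h]
            refine Finset.sum_congr rfl fun i _ => ?_
            obtain ⟨m, c, d, h'⟩ := exists_tensor_rep (comul (R := ℂ) (a i))
            rw [← antipode_eq_sum_piR h', h']
            simp [TensorProduct.sum_tmul, TensorProduct.tmul_sum, piRₗ_apply]
        rw [← h5, Finset.mul_sum]
        refine Finset.sum_congr rfl fun i _ => ?_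
        rw [(piR_mem (a i)).2, mul_assoc]
    _ = antipodeComulFlip x := by
        rw [← antipodeComulFlip_one, ← antipodeComulFlip_mul, mul_one]

theorem comul_antipode_eq {x : A} {n : ℕ} {a b : Fin n → A}
    (h : comul (R := ℂ) x = ∑ i, a i ⊗ₜ[ℂ] b i) :
    comul (R := ℂ) (antipode x : A) = ∑ i, (antipode (b i) ⊗ₜ[ℂ] antipode (a i) : A ⊗[ℂ] A) := by
  rw [comul_antipode, antipodeComulFlip_eq h]

end Antipode

/-! ### The star, invertibility of the antipode, and separability of A^L and A^R -/

section TensorStar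

variable {A : Type*} [CStarAlgebra A]

theorem tensor_star_mul (s t : A ⊗[ℂ] A) : star (s * t) = star t * star s := by
  induction s with
  | zero => simp
  | add a b ha hb => simp only [add_mul, mul_add, star_add, ha, hb]
  | tmul a b =>
    induction t with
    | zero => simp
    | add a b ha hb => simp only [add_mul, mul_add, star_add, ha, hb]
    | tmul c d => simp [TensorProduct.star_tmul]

end TensorStar

section Star

open Coalgebra CStarWeakHopfAlgebra

variable {A : Type*} [CStarAlgebra A] [CStarWeakHopfAlgebra A]

theorem star_Δ1 : star (Δ1 A) = Δ1 A := by
  rw [Δ1, ← comul_star, star_one]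

theorem Δ1_mul_Δ1 : Δ1 A * Δ1 A = Δ1 A := (comul_eq_mul_Δ1 (1 : A)).symm

theorem comul_star_eq {x : A} {n : ℕ} {a b : Fin n → A}
    (h : comul (R := ℂ) x = ∑ i, a i ⊗ₜ[ℂ] b i) :
    comul (R := ℂ) (star x) = ∑ i, star (a i) ⊗ₜ[ℂ] star (b i) := by
  rw [comul_star, h, star_sum]
  exact Finset.sum_congr rfl fun i _ => TensorProduct.star_tmul _ _

theorem star_mem_leftSub {x : A} (h : x ∈ leftSub A) : star x ∈ leftSub A := by
  constructor
  · rw [comul_star, h.2, tensor_star_mul, star_Δ1, TensorProduct.star_tmul, star_one]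
  · rw [comul_star, h.1, tensor_star_mul, star_Δ1, TensorProduct.star_tmul, star_one]

theorem star_mem_rightSub {x : A} (h : x ∈ rightSub A) : star x ∈ rightSub A := by
  constructor
  · rw [comul_star, h.2, tensor_star_mul, star_Δ1, TensorProduct.star_tmul, star_one]
  · rw [comul_star, h.1, tensor_star_mul, star_Δ1, TensorProduct.star_tmul, star_one]

/-- Write Δ(x) = Δ(1)Δ(x). For r = 1₍₁₎ one has Δ(r) = 1₍₁'₎ ⊗ r1₍₂'₎, so weak multiplicativity of ε
splits ⊓ᴸ(r x₍₁₎), and the remaining ε is absorbed by the counit axiom for 1₍₂'₎x. On A^L this is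
the separability relation. -/
theorem rTensor_piL_comul (x : A) :
    piLₗ.rTensor A (comul (R := ℂ) x) = piLₗ.rTensor A (Δ1 A) * ((1 : A) ⊗ₜ[ℂ] x) := by
  obtain ⟨n, r, l, hr, hl, h⟩ := exists_Δ1_rep (A := A)
  obtain ⟨m, a, b, h'⟩ := exists_tensor_rep (comul (R := ℂ) x)
  have hΔr : ∀ i, comul (R := ℂ) (r i) = ∑ k, r k ⊗ₜ[ℂ] (r i * l k) := by
    intro i
    rw [(hr i).1, h]; simp [Finset.mul_sum]
  have key : ∀ k, ∑ i, ∑ j, counit (R := ℂ) (r i * l k * a j) • (l i * b j) = l k * x := by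
    intro k
    have e : comul (R := ℂ) (l k * x) = ∑ i, ∑ j, (r i * l k * a j) ⊗ₜ[ℂ] (l i * b j) := by
      rw [comul_mul, (hl k).2, h, h']; simp [Finset.sum_mul, Finset.mul_sum]
      exact Finset.sum_comm
    have := congrArg (TensorProduct.lid ℂ A) (rTensor_counit_comul (R := ℂ) (l k * x))
    rw [e] at this
    simpa using this
  calc piLₗ.rTensor A (comul (R := ℂ) x)
      = ∑ i, ∑ j, piL (r i * a j) ⊗ₜ[ℂ] (l i * b j) := by
        rw [comul_eq_Δ1_mul, h, h']
        simp only [Finset.sum_mul, Finset.mul_sum, Algebra.TensorProduct.tmul_mul_tmul, map_sum,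
          LinearMap.rTensor_tmul, piLₗ_apply]
        exact Finset.sum_comm
    _ = ∑ i, ∑ j, ∑ k, piL (r k) ⊗ₜ[ℂ] (counit (R := ℂ) (r i * l k * a j) • (l i * b j)) := by
        refine Finset.sum_congr rfl fun i _ => Finset.sum_congr rfl fun j _ => ?_
        simp only [piL_eq_sum h, TensorProduct.sum_tmul]
        rw [Finset.sum_comm]
        refine Finset.sum_congr rfl fun p _ => ?_
        have := counit_mul_eq (r p) (r i) (a j) (hΔr i)
        rw [← mul_assoc, this, Finset.sum_smul, TensorProduct.sum_tmul]
        exact Finset.sum_congr rfl fun k _ => by rw [mul_comm, mul_smul, TensorProduct.smul_tmul,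
          TensorProduct.tmul_smul]
    _ = ∑ k, piL (r k) ⊗ₜ[ℂ] (l k * x) := by
        simp only [← key, TensorProduct.tmul_sum]
        rw [Finset.sum_comm' (t' := Finset.univ) (s' := fun _ => Finset.univ) (by simp)]
        rw [Finset.sum_comm]
        simp only [Finset.sum_comm (s := (Finset.univ : Finset (Fin m))) (t := (Finset.univ : Finset (Fin n)))]
        rw [Finset.sum_comm]
    _ = _ := by rw [h]; simp [Finset.sum_mul, piLₗ_apply]

theorem lTensor_piR_comul (x : A) :
    piRₗ.lTensor A (comul (R := ℂ) x) = (x ⊗ₜ[ℂ] (1 : A)) * piRₗ.lTensor A (Δ1 A) := by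
  obtain ⟨n, r, l, hr, hl, h⟩ := exists_Δ1_rep (A := A)
  obtain ⟨m, a, b, h'⟩ := exists_tensor_rep (comul (R := ℂ) x)
  have hΔl : ∀ i, comul (R := ℂ) (l i) = ∑ k, (r k * l i) ⊗ₜ[ℂ] l k := by
    intro i
    rw [(hl i).2, h]; simp [Finset.sum_mul]
  have key : ∀ k, ∑ i, ∑ j, counit (R := ℂ) (b j * (r k * l i)) • (a j * r i) = x * r k := by
    intro k
    have e : comul (R := ℂ) (x * r k) = ∑ i, ∑ j, (a j * r i) ⊗ₜ[ℂ] (b j * (r k * l i)) := by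
      rw [comul_mul, (hr k).1, h, h']; simp [Finset.sum_mul, Finset.mul_sum]
    have := congrArg (TensorProduct.rid ℂ A) (lTensor_counit_comul (R := ℂ) (x * r k))
    rw [e] at this
    simpa using this
  calc piRₗ.lTensor A (comul (R := ℂ) x)
      = ∑ i, ∑ j, (a j * r i) ⊗ₜ[ℂ] piR (b j * l i) := by
        rw [comul_eq_mul_Δ1, h, h']
        simp only [Finset.sum_mul, Finset.mul_sum, Algebra.TensorProduct.tmul_mul_tmul, map_sum,
          LinearMap.lTensor_tmul, piRₗ_apply]
    _ = ∑ i, ∑ j, ∑ k, (counit (R := ℂ) (b j * (r k * l i)) • (a j * r i)) ⊗ₜ[ℂ] piR (l k) := by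
        refine Finset.sum_congr rfl fun i _ => Finset.sum_congr rfl fun j _ => ?_
        simp only [piR_eq_sum h, TensorProduct.tmul_sum]
        rw [Finset.sum_comm]
        refine Finset.sum_congr rfl fun p _ => ?_
        have := counit_mul_eq (b j) (l i) (l p) (hΔl i)
        rw [this, Finset.sum_smul, TensorProduct.tmul_sum]
        exact Finset.sum_congr rfl fun k _ => by rw [mul_smul, ← TensorProduct.smul_tmul]
    _ = ∑ k, (x * r k) ⊗ₜ[ℂ] piR (l k) := by
        simp only [← key, TensorProduct.sum_tmul]
        simp only [Finset.sum_comm (s := (Finset.univ : Finset (Fin m))) (t := (Finset.univ : Finset (Fin n)))]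
        rw [Finset.sum_comm]
    _ = _ := by rw [h]; simp [Finset.mul_sum, piRₗ_apply]

/-- `l S(1₍₁₎) ⊗ 1₍₂₎ = S(1₍₁₎) ⊗ 1₍₂₎ l` for `l` in `A^L`. -/
theorem left_separability {l : A} (hl : l ∈ leftSub A) :
    (l ⊗ₜ[ℂ] (1 : A)) * antipode.rTensor A (Δ1 A) =
      antipode.rTensor A (Δ1 A) * ((1 : A) ⊗ₜ[ℂ] l) := by
  obtain ⟨n, r, m, hr, hm, h⟩ := exists_Δ1_rep (A := A)
  have e : antipode.rTensor A (Δ1 A) = piLₗ.rTensor A (Δ1 A) := by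
    rw [h]; simp [antipode_of_mem_rightSub (hr _), piLₗ_apply]
  rw [e, ← rTensor_piL_comul, hl.1, h]
  simp [Finset.mul_sum, piLₗ_apply, piL_left_mul hl]

/-- `r 1₍₁₎ ⊗ S(1₍₂₎) = 1₍₁₎ ⊗ S(1₍₂₎) r` for `r` in `A^R`. -/
theorem right_separability {r : A} (hr : r ∈ rightSub A) :
    (r ⊗ₜ[ℂ] (1 : A)) * antipode.lTensor A (Δ1 A) =
      antipode.lTensor A (Δ1 A) * ((1 : A) ⊗ₜ[ℂ] r) := by
  obtain ⟨n, s, l, hs, hl, h⟩ := exists_Δ1_rep (A := A)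
  have e : antipode.lTensor A (Δ1 A) = piRₗ.lTensor A (Δ1 A) := by
    rw [h]; simp [antipode_of_mem_leftSub (hl _), piRₗ_apply]
  rw [e, ← lTensor_piR_comul, hr.2, h]
  simp [Finset.sum_mul, piRₗ_apply, piR_mul_right hr]

theorem lTensor_piR_comul' (x : A) :
    piRₗ.lTensor A (comul (R := ℂ) x) = (x ⊗ₜ[ℂ] (1 : A)) * antipode.lTensor A (Δ1 A) := by
  obtain ⟨n, s, l, hs, hl, h⟩ := exists_Δ1_rep (A := A)
  rw [lTensor_piR_comul, h]
  simp [antipode_of_mem_leftSub (hl _), piRₗ_apply]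

/-- The inverse antipode `x ↦ S(x*)*`. -/
noncomputable def antipodeInv : A →ₗ[ℂ] A where
  toFun x := star (antipode (star x))
  map_add' x y := by simp
  map_smul' c x := by simp

theorem antipodeInv_apply (x : A) : antipodeInv x = star (antipode (star x)) := rfl

theorem star_antipode (x : A) : star (antipode x : A) = antipodeInv (star x) := by
  rw [antipodeInv_apply, star_star]

theorem antipodeInv_mul_rev (x y : A) : antipodeInv (x * y) = antipodeInv y * antipodeInv x := by
  simp only [antipodeInv_apply, star_mul, antipode_mul_rev]

/-- `x₍₂₎ S⁻¹(x₍₁₎) ⊗ x₍₃₎ = Δ(1) (1 ⊗ x)`. -/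
theorem sum_comul_antipodeInv {x : A} {n : ℕ} {a b : Fin n → A}
    (h : comul (R := ℂ) x = ∑ i, a i ⊗ₜ[ℂ] b i) :
    ∑ i, comul (R := ℂ) (b i) * (antipodeInv (a i) ⊗ₜ[ℂ] (1 : A)) = Δ1 A * ((1 : A) ⊗ₜ[ℂ] x) := by
  have := congrArg star (sum_antipode_comul (comul_star_eq h))
  simpa [tensor_star_mul, star_Δ1, TensorProduct.star_tmul, comul_star, antipodeInv_apply]
    using this

/-- `x₍₁₎ ⊗ S⁻¹(x₍₃₎) x₍₂₎ = (x ⊗ 1) Δ(1)`. -/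
theorem sum_antipodeInv_comul {x : A} {n : ℕ} {a b : Fin n → A}
    (h : comul (R := ℂ) x = ∑ i, a i ⊗ₜ[ℂ] b i) :
    ∑ i, ((1 : A) ⊗ₜ[ℂ] antipodeInv (b i)) * comul (R := ℂ) (a i) = (x ⊗ₜ[ℂ] (1 : A)) * Δ1 A := by
  have := congrArg star (sum_comul_antipode (comul_star_eq h))
  simpa [tensor_star_mul, star_Δ1, TensorProduct.star_tmul, comul_star, antipodeInv_apply]
    using this

theorem mul'_lTensor_antipode_mul (x : A) (t : A ⊗[ℂ] A) :
    LinearMap.mul' ℂ A (antipode.lTensor A (((1 : A) ⊗ₜ[ℂ] x) * t)) =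
      LinearMap.mul' ℂ A (antipode.lTensor A t) * antipode x := by
  induction t with
  | zero => simp
  | tmul a b => simp [antipode_mul_rev, mul_assoc]
  | add a b ha hb => simp only [map_add, mul_add, add_mul, ha, hb]

/-- Invertibility of S comes from the star. The adjoint Galois identity gives ⊓ᴸ(x₍₁₎)S(S⁻¹(x₍₂₎)) =
x. Replacing ⊓ᴸ(x₍₁₎) ⊗ x₍₂₎ by ⊓ᴸ(1₍₁₎) ⊗ 1₍₂₎x and using that S ∘ S⁻¹ is multiplicative, the same
sum is S(S⁻¹(x)). -/
theorem antipode_antipodeInv (x : A) : antipode (antipodeInv x) = x := by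
  have key : ∀ {x : A} {n : ℕ} {a b : Fin n → A}, comul (R := ℂ) x = ∑ i, a i ⊗ₜ[ℂ] b i →
      ∑ i, piL (a i) * antipode (antipodeInv (b i)) = x := by
    intro x n a b h
    have := congrArg (fun t => LinearMap.mul' ℂ A (antipode.lTensor A t)) (sum_antipodeInv_comul h)
    simp only [map_sum, mul'_lTensor_antipode_mul, mul_antipode_eq] at this
    rw [this, lTensor_mul_left, mul'_left]
    have := mul_antipode_eq (1 : A)
    rw [Δ1_eq, piL_one] at this
    rw [this, mul_one]
  obtain ⟨n, a, b, h⟩ := exists_tensor_rep (comul (R := ℂ) x)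
  obtain ⟨m, c, d, h1⟩ := exists_tensor_rep (comul (R := ℂ) (1 : A))
  have e := congrArg (LinearMap.mul' ℂ A ∘ₗ (antipode ∘ₗ antipodeInv).lTensor A)
    (rTensor_piL_comul x)
  rw [← Δ1_eq, h, h1] at e
  simp only [map_sum, LinearMap.rTensor_tmul, LinearMap.comp_apply, LinearMap.lTensor_tmul,
    LinearMap.mul'_apply, Finset.sum_mul, Algebra.TensorProduct.tmul_mul_tmul, mul_one,
    piLₗ_apply, antipodeInv_mul_rev, antipode_mul_rev, ← mul_assoc] at e
  rw [key h, ← Finset.sum_mul, key h1, one_mul] at e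
  exact e.symm

theorem antipodeInv_antipode (x : A) : antipodeInv (antipode x : A) = x := by
  have := congrArg star (antipode_antipodeInv (star x))
  rw [star_star] at this
  conv_rhs => rw [← this]
  rw [antipodeInv_apply, antipodeInv_apply, star_star]

theorem antipode_injective : Function.Injective (antipode : A → A) :=
  Function.LeftInverse.injective antipodeInv_antipode

theorem antipode_mem_center {x : A} (h : x ∈ Subalgebra.center ℂ A) :
    antipode x ∈ Subalgebra.center ℂ A := by
  rw [Subalgebra.mem_center_iff] at h ⊢
  intro b
  rw [← antipode_antipodeInv b, ← antipode_mul_rev, ← antipode_mul_rev, h]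

/-- `1₍₁₎ S⁻¹(l) ⊗ 1₍₂₎ = 1₍₁₎ ⊗ 1₍₂₎ l` for `l` in `A^L`. -/
theorem Δ1_mul_antipodeInv {l : A} (hl : l ∈ leftSub A) :
    Δ1 A * (antipodeInv l ⊗ₜ[ℂ] (1 : A)) = Δ1 A * ((1 : A) ⊗ₜ[ℂ] l) := by
  obtain ⟨n, a, b, h⟩ := exists_tensor_rep (Δ1 A)
  have e := congrArg (antipodeInv.rTensor A) (left_separability hl)
  rw [h] at e ⊢
  simpa [Finset.sum_mul, Finset.mul_sum, antipodeInv_mul_rev, antipodeInv_antipode] using e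

theorem sum_Δ1_mul_antipode {n : ℕ} {a b : Fin n → A} (h : Δ1 A = ∑ i, a i ⊗ₜ[ℂ] b i) :
    ∑ i, a i * antipode (b i) = 1 := by
  rw [sum_mul_antipode (x := (1 : A)) h, piL_one]

theorem sum_Δ1_antipode_mul {n : ℕ} {a b : Fin n → A} (h : Δ1 A = ∑ i, a i ⊗ₜ[ℂ] b i) :
    ∑ i, antipode (a i) * b i = 1 := by
  rw [sum_antipode_mul (x := (1 : A)) h, piR_one]

theorem antipodeInv_mem_center {x : A} (h : x ∈ Subalgebra.center ℂ A) :
    antipodeInv x ∈ Subalgebra.center ℂ A := by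
  rw [Subalgebra.mem_center_iff] at h ⊢
  intro b
  rw [← antipodeInv_antipode b, ← antipodeInv_mul_rev, ← antipodeInv_mul_rev, h]

/-- `S²` is the identity on central elements of `A^L`. -/
theorem antipodeInv_eq_antipode {z : A} (hz : z ∈ leftSub A)
    (hc : z ∈ Subalgebra.center ℂ A) : antipodeInv z = antipode z := by
  obtain ⟨n, a, b, h⟩ := exists_tensor_rep (Δ1 A)
  have e := congrArg (fun t => LinearMap.mul' ℂ A (antipode.lTensor A t)) (Δ1_mul_antipodeInv hz)
  have c1 := Subalgebra.mem_center_iff.1 (antipodeInv_mem_center hc)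
  have c2 := Subalgebra.mem_center_iff.1 (antipode_mem_center hc)
  simp only [h, Finset.sum_mul, Algebra.TensorProduct.tmul_mul_tmul, mul_one, map_sum,
    LinearMap.lTensor_tmul, LinearMap.mul'_apply, antipode_mul_rev, c1, ← c2] at e
  simp only [mul_assoc, ← Finset.mul_sum, sum_Δ1_mul_antipode h, mul_one] at e
  rw [e]
  simp only [← mul_assoc, ← Finset.sum_mul, sum_Δ1_mul_antipode h, one_mul]

theorem antipode_antipode_of_central {z : A} (hz : z ∈ leftSub A)
    (hc : z ∈ Subalgebra.center ℂ A) : antipode (antipode z : A) = z := by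
  rw [← antipodeInv_eq_antipode hz hc, antipode_antipodeInv]

/-- `S(z) 1₍₁₎ ⊗ 1₍₂₎ = 1₍₁₎ ⊗ z 1₍₂₎` for central `z` in `A^L`. -/
theorem antipode_tmul_Δ1 {z : A} (hz : z ∈ leftSub A) (hc : z ∈ Subalgebra.center ℂ A) :
    (antipode z ⊗ₜ[ℂ] (1 : A)) * Δ1 A = ((1 : A) ⊗ₜ[ℂ] z) * Δ1 A := by
  have comm : ∀ u v : A, u ∈ Subalgebra.center ℂ A → v ∈ Subalgebra.center ℂ A →
      ∀ t : A ⊗[ℂ] A, (u ⊗ₜ[ℂ] v) * t = t * (u ⊗ₜ[ℂ] v) := by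
    intro u v hu hv t
    induction t with
    | zero => simp
    | tmul a b => simp [Subalgebra.mem_center_iff.1 hu, Subalgebra.mem_center_iff.1 hv]
    | add a b ha hb => simp only [mul_add, add_mul, ha, hb]
  rw [comm _ _ (antipode_mem_center hc) (Subalgebra.one_mem _), comm _ _ (Subalgebra.one_mem _) hc,
    ← antipodeInv_eq_antipode hz hc, Δ1_mul_antipodeInv hz]

end Star

/-! ### Semisimple algebras: minimal central idempotents, characters and traces -/

section Semisimple

variable {B : Type*} [Ring B] [Algebra ℂ B]

/-- A left ideal of a semisimple ring is generated by an idempotent. -/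
theorem exists_right_identity [IsSemisimpleRing B] (I : Submodule B B) :
    ∃ f ∈ I, ∀ x ∈ I, x * f = x := by
  obtain ⟨K, hK⟩ := exists_isCompl I
  obtain ⟨f, hf, k, hk, h1⟩ := Submodule.mem_sup.1
    (show (1 : B) ∈ I ⊔ K by rw [hK.sup_eq_top]; trivial)
  refine ⟨f, hf, fun x hx => ?_⟩
  have h2 : x - x * f = x * k := by rw [sub_eq_iff_eq_add', ← mul_add, h1, mul_one]
  have h3 : x - x * f ∈ I ⊓ K :=
    ⟨I.sub_mem hx (I.smul_mem x hf), by rw [h2]; exact K.smul_mem x hk⟩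
  rw [hK.inf_eq_bot, Submodule.mem_bot, sub_eq_zero] at h3
  exact h3.symm

/-- Semisimple rings are von Neumann regular. -/
theorem exists_mul_mul_eq_self [IsSemisimpleRing B] (k : B) : ∃ c, k * c * k = k := by
  obtain ⟨f, hf, h⟩ := exists_right_identity (Submodule.span B {k})
  obtain ⟨c, rfl⟩ := Submodule.mem_span_singleton.1 hf
  exact ⟨c, by simpa [mul_assoc] using h k (Submodule.mem_span_singleton_self k)⟩

theorem MinCentralIdem.idem {C : Subalgebra ℂ B} (e : MinCentralIdem C) : e.elt * e.elt = e.elt :=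
  e.2.idem

theorem MinCentralIdem.comm {C : Subalgebra ℂ B} (e : MinCentralIdem C) (x : B) :
    x * e.elt = e.elt * x := Subalgebra.mem_center_iff.1 e.2.central x

/-- The character of the module `V`. -/
noncomputable def modTr (V : Type*) [AddCommGroup V] [Module ℂ V] [Module B V]
    [IsScalarTower ℂ B V] : B →ₗ[ℂ] ℂ :=
  LinearMap.trace ℂ V ∘ₗ (Algebra.lsmul ℂ ℂ V).toLinearMap

theorem modTr_mul_comm (V : Type*) [AddCommGroup V] [Module ℂ V] [Module B V]
    [IsScalarTower ℂ B V] (x y : B) : modTr V (x * y) = modTr V (y * x) := by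
  simp only [modTr, LinearMap.comp_apply, AlgHom.toLinearMap_apply, map_mul]
  exact LinearMap.trace_mul_comm ℂ _ _

variable [FiniteDimensional ℂ B] [IsSemisimpleRing B]

/-- C ∩ Center B is commutative and Artinian, and it is reduced because B is von Neumann regular: y
= ycy = cy² for central y. Hence it is a finite product of copies of ℂ, and the coordinate vectors
are the minimal idempotents. Semisimplicity of C itself is not needed. -/
theorem mem_span_minCentralIdem {C : Subalgebra ℂ B} {x : B} (hx : x ∈ C)
    (hc : x ∈ Subalgebra.center ℂ B) :
    x ∈ Submodule.span ℂ (Set.range fun e : MinCentralIdem C => e.elt) := by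
  classical
  let Z : Subalgebra ℂ B := C ⊓ Subalgebra.center ℂ B
  let _ : CommRing Z := { (inferInstance : Ring Z) with
    mul_comm := fun a b => Subtype.ext (Subalgebra.mem_center_iff.1 b.2.2 a) }
  have : IsArtinianRing Z := isArtinian_of_tower ℂ inferInstance
  have hred : IsReduced Z := by
    refine (isReduced_iff_pow_one_lt 2 one_lt_two).2 fun y hy => ?_
    obtain ⟨c, h⟩ := exists_mul_mul_eq_self (y : B)
    have h0 : (y : B) * y = 0 := by rw [← pow_two]; exact congrArg Subtype.val hy
    apply Subtype.ext
    rw [← h, ← Subalgebra.mem_center_iff.1 y.2.2 c, mul_assoc, h0, mul_zero]; rfl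
  let ψ := (IsArtinianRing.equivPi Z).toRingEquiv
  have : Finite (MaximalSpectrum Z) := inferInstance
  let _ : Fintype (MaximalSpectrum Z) := Fintype.ofFinite _
  let δ : MaximalSpectrum Z → Z := fun I => ψ.symm (Pi.single I 1)
  have hscal : ∀ (I : MaximalSpectrum Z) (t : Z ⧸ I.asIdeal), ∃ c : ℂ, algebraMap ℂ _ c = t := by
    intro I t
    have := I.isMaximal
    let _ : Field (Z ⧸ I.asIdeal) := Ideal.Quotient.field _
    exact (IsAlgClosed.algebraMap_bijective_of_isIntegral (k := ℂ) (K := Z ⧸ I.asIdeal)).2 t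
  have hψc : ∀ (c : ℂ) (I : MaximalSpectrum Z), ψ (algebraMap ℂ Z c) I = algebraMap ℂ _ c :=
    fun c I => rfl
  have hδ : ∀ I, IsMinCentralIdem C (δ I : B) := by
    intro I
    have := I.isMaximal
    refine ⟨(δ I).2.1, (δ I).2.2, ?_, ?_, ?_⟩
    · refine congrArg Subtype.val (show δ I * δ I = δ I from ?_)
      apply ψ.injective
      rw [map_mul]
      simp only [δ, RingEquiv.apply_symm_apply]
      rw [← Pi.single_mul, one_mul]
    · intro h
      have : δ I = 0 := Subtype.ext h
      have h2 := congrFun (congrArg ψ this) I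
      simp [δ] at h2
    · intro f hfC hfZ hff hfδ
      let f' : Z := ⟨f, hfC, hfZ⟩
      have h1 : f' * f' = f' := Subtype.ext hff
      have h2 : f' * δ I = f' := Subtype.ext hfδ
      have h3 := congrArg ψ h2
      rw [map_mul] at h3
      simp only [δ, RingEquiv.apply_symm_apply] at h3
      have h4 := congrFun (congrArg ψ h1) I
      rw [map_mul, Pi.mul_apply] at h4
      let _ : Field (Z ⧸ I.asIdeal) := Ideal.Quotient.field _
      have h5 : ψ f' I = 0 ∨ ψ f' I = 1 := by
        rcases eq_or_ne (ψ f' I) 0 with h | h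
        · exact Or.inl h
        · exact Or.inr (mul_left_cancel₀ h (h4.trans (mul_one _).symm))
      have h6 : ∀ J, J ≠ I → ψ f' J = 0 := by
        intro J hJ
        rw [← h3, Pi.mul_apply, Pi.single_eq_of_ne hJ, mul_zero]
      rcases h5 with h5 | h5
      · left
        have : f' = 0 := by
          apply ψ.injective
          rw [map_zero]
          funext J
          rcases eq_or_ne J I with rfl | hJ
          · exact h5
          · exact h6 J hJ
        exact congrArg Subtype.val this
      · right
        have : f' = δ I := by
          apply ψ.injective
          simp only [δ, RingEquiv.apply_symm_apply]
          funext J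
          rcases eq_or_ne J I with rfl | hJ
          · rw [h5, Pi.single_eq_same]
          · rw [h6 J hJ, Pi.single_eq_of_ne hJ]
        exact congrArg Subtype.val this
  choose c hcI using fun I => hscal I (ψ ⟨x, hx, hc⟩ I)
  have hsum : (⟨x, hx, hc⟩ : Z) = ∑ I, c I • δ I := by
    apply ψ.injective
    rw [map_sum]
    funext J
    rw [Finset.sum_apply, Finset.sum_eq_single J]
    · rw [Algebra.smul_def, map_mul, Pi.mul_apply, hψc, hcI]
      simp [δ]
    · intro I _ hI
      rw [Algebra.smul_def, map_mul, Pi.mul_apply]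
      simp only [δ, RingEquiv.apply_symm_apply]
      rw [Pi.single_eq_of_ne hI.symm, mul_zero]
    · simp
  have hx' : x = ∑ I, c I • (δ I : B) := by
    have := congrArg (Subtype.val) hsum
    refine this.trans ?_
    exact (map_sum Z.val _ _).trans (Finset.sum_congr rfl fun I _ => rfl)
  rw [hx']
  exact Submodule.sum_mem _ fun I _ => Submodule.smul_mem _ _
    (Submodule.subset_span ⟨(⟨δ I, hδ I⟩ : MinCentralIdem C), rfl⟩)

/-- Elements of `C ∩ Center B` are linear combinations of the minimal idempotents. -/
theorem exists_eq_sum_elt {C : Subalgebra ℂ B} {x : B} (hx : x ∈ C)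
    (hc : x ∈ Subalgebra.center ℂ B) : ∃ c : MinCentralIdem C → ℂ, x = ∑ e, c e • e.elt := by
  obtain ⟨c, h⟩ := (Submodule.mem_span_range_iff_exists_fun ℂ).1 (mem_span_minCentralIdem hx hc)
  exact ⟨c, h.symm⟩

omit [IsSemisimpleRing B] in
theorem sum_smul_elt_mul_elt {C : Subalgebra ℂ B} (c : MinCentralIdem C → ℂ) (e : MinCentralIdem C) :
    (∑ e, c e • e.elt) * e.elt = c e • e.elt := by
  classical
  rw [Finset.sum_mul, Finset.sum_eq_single e]
  · rw [smul_mul_assoc, e.idem]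
  · intro f _ hf
    rw [smul_mul_assoc, MinCentralIdem.mul_eq_zero f e hf, smul_zero]
  · simp

theorem sum_elt (C : Subalgebra ℂ B) : ∑ e : MinCentralIdem C, e.elt = 1 := by
  obtain ⟨c, h⟩ := exists_eq_sum_elt C.one_mem (Subalgebra.one_mem _)
  rw [h]
  refine Finset.sum_congr rfl fun e _ => ?_
  rw [← sum_smul_elt_mul_elt c e, ← h, one_mul]

/-- A central element of `C` acts on each minimal idempotent by a scalar. -/
theorem exists_mul_elt_eq_smul {C : Subalgebra ℂ B} {x : B} (hx : x ∈ C)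
    (hc : x ∈ Subalgebra.center ℂ B) (e : MinCentralIdem C) : ∃ c : ℂ, x * e.elt = c • e.elt := by
  obtain ⟨c, h⟩ := exists_eq_sum_elt hx hc
  exact ⟨c e, by rw [h, sum_smul_elt_mul_elt]⟩

theorem exists_prim (q : Sector B) : ∃ f ∈ irrep q, ∀ x ∈ irrep q, x * f = x :=
  exists_right_identity _

/-- An idempotent which generates the left ideal `irrep q`. -/
noncomputable def prim (q : Sector B) : B := (exists_prim q).choose

instance (q : Sector B) : IsSimpleModule B (irrep q) := (exists_irrep q).choose_spec.1

theorem elt_mul_of_mem_irrep (q : Sector B) {x : B} (hx : x ∈ irrep q) : q.elt * x = x :=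
  (exists_irrep q).choose_spec.2 x hx

theorem prim_mem (q : Sector B) : prim q ∈ irrep q := (exists_prim q).choose_spec.1

theorem mul_prim (q : Sector B) {x : B} (hx : x ∈ irrep q) : x * prim q = x :=
  (exists_prim q).choose_spec.2 x hx

theorem mul_prim_mem (q : Sector B) (x : B) : x * prim q ∈ irrep q :=
  (irrep q).smul_mem x (prim_mem q)

theorem prim_idem (q : Sector B) : prim q * prim q = prim q := mul_prim q (prim_mem q)

theorem elt_mul_prim (q : Sector B) : q.elt * prim q = prim q := elt_mul_of_mem_irrep q (prim_mem q)

theorem prim_ne_zero (q : Sector B) : prim q ≠ 0 := by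
  intro h
  have : Nontrivial (irrep q) := IsSimpleModule.nontrivial B _
  obtain ⟨x, hx⟩ := exists_ne (0 : irrep q)
  apply hx
  apply Subtype.ext
  rw [← mul_prim q x.2, h, mul_zero]; rfl

/-- Schur's lemma: right multiplication by x · `prim q` is an endomorphism of the simple module
`irrep q`. -/
theorem exists_prim_mul_mul_prim (q : Sector B) (x : B) :
    ∃ c : ℂ, prim q * x * prim q = c • prim q := by
  let T : Module.End B (irrep q) :=
    { toFun := fun y => ⟨y * (x * prim q), by rw [← mul_assoc]; exact mul_prim_mem q _⟩
      map_add' := fun y z => Subtype.ext (add_mul _ _ _)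
      map_smul' := fun c y => Subtype.ext (mul_assoc _ _ _) }
  obtain ⟨c, hc⟩ := (IsSimpleModule.algebraMap_end_bijective_of_isAlgClosed (A := B)
    (V := irrep q) ℂ).2 T
  have := congrArg (fun S : Module.End B (irrep q) => ((S ⟨prim q, prim_mem q⟩ : irrep q) : B)) hc
  refine ⟨c, ?_⟩
  rw [mul_assoc]
  exact this.symm

/-- A homomorphism Bp → V is determined by the image of p, which is an arbitrary vector of pV; the
dimension of pV is the trace of the projection p. -/
theorem mult_eq_modTr (q : Sector B) (V : Type*) [AddCommGroup V] [Module ℂ V] [Module B V]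
    [IsScalarTower ℂ B V] [FiniteDimensional ℂ V] : (mult q V : ℂ) = modTr V (prim q) := by
  let P : V →ₗ[ℂ] V := Algebra.lsmul ℂ ℂ V (prim q)
  have hP : ∀ v, P v = prim q • v := fun v => rfl
  have hPP : ∀ v, P (P v) = P v := fun v => by rw [hP, hP, smul_smul, prim_idem]
  have hproj : LinearMap.IsProj (LinearMap.range P) P :=
    ⟨fun v => ⟨v, rfl⟩, by rintro _ ⟨v, rfl⟩; exact hPP v⟩
  have e : (irrep q →ₗ[B] V) ≃ₗ[ℂ] LinearMap.range P :=
    { toFun := fun φ => ⟨φ ⟨prim q, prim_mem q⟩, φ ⟨prim q, prim_mem q⟩, by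
        rw [hP, ← map_smul]; congr 1; exact Subtype.ext (prim_idem q)⟩
      map_add' := fun φ ψ => rfl
      map_smul' := fun c φ => rfl
      invFun := fun v =>
        { toFun := fun y => (y : B) • (v : V)
          map_add' := fun y z => add_smul _ _ _
          map_smul' := fun c y => mul_smul c (y : B) (v : V) }
      left_inv := fun φ => by
        ext y
        change (y : B) • φ ⟨prim q, prim_mem q⟩ = φ y
        rw [← map_smul]; congr 1; exact Subtype.ext (mul_prim q y.2)
      right_inv := fun v => by
        obtain ⟨_, w, rfl⟩ := v
        exact Subtype.ext (hPP w) }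
  rw [mult, e.finrank_eq]
  exact (hproj.trace).symm

theorem modTr_irrep_prim_self (q : Sector B) : modTr (irrep q) (prim q) = 1 := by
  rw [← mult_eq_modTr]
  norm_cast
  rw [mult]
  have h := IsSimpleModule.algebraMap_end_bijective_of_isAlgClosed (A := B) (V := irrep q) ℂ
  let e : ℂ ≃ₗ[ℂ] (irrep q →ₗ[B] irrep q) :=
    LinearEquiv.ofBijective (Algebra.linearMap ℂ (Module.End B (irrep q))) h
  rw [← e.finrank_eq, Module.finrank_self]

theorem modTr_irrep_mul_elt (q : Sector B) (x : B) :
    modTr (irrep q) (x * q.elt) = modTr (irrep q) x := by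
  simp only [modTr, LinearMap.comp_apply, AlgHom.toLinearMap_apply, map_mul]
  congr 1
  ext y
  have : q.elt • y = y := Subtype.ext (elt_mul_of_mem_irrep q y.2)
  exact congrArg (fun z : irrep q => ((x • z : irrep q) : B)) this

theorem modTr_irrep_mul_elt_ne {p q : Sector B} (h : p ≠ q) (x : B) :
    modTr (irrep p) (x * q.elt) = 0 := by
  rw [← modTr_irrep_mul_elt, mul_assoc, MinCentralIdem.mul_eq_zero q p h.symm, mul_zero, map_zero]

/-- The two-sided ideal BpB has a central idempotent as its identity. It lies below `q.elt` and is
nonzero, so by minimality it is `q.elt`. -/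
theorem elt_mem_span_mul_prim_mul (q : Sector B) :
    q.elt ∈ Submodule.span ℂ (Set.range fun p : B × B => p.1 * prim q * p.2) := by
  set S := Submodule.span ℂ (Set.range fun p : B × B => p.1 * prim q * p.2) with hS
  have hl : ∀ c, ∀ x ∈ S, c * x ∈ S := by
    intro c x hx
    induction hx using Submodule.span_induction with
    | mem x h =>
      obtain ⟨p, rfl⟩ := h
      exact Submodule.subset_span ⟨(c * p.1, p.2), by simp [mul_assoc]⟩
    | zero => simp
    | add x y _ _ hx hy => rw [mul_add]; exact S.add_mem hx hy
    | smul a x _ hx => rw [mul_smul_comm]; exact S.smul_mem _ hx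
  have hr : ∀ c, ∀ x ∈ S, x * c ∈ S := by
    intro c x hx
    induction hx using Submodule.span_induction with
    | mem x h =>
      obtain ⟨p, rfl⟩ := h
      exact Submodule.subset_span ⟨(p.1, p.2 * c), by simp [mul_assoc]⟩
    | zero => simp
    | add x y _ _ hx hy => rw [add_mul]; exact S.add_mem hx hy
    | smul a x _ hx => rw [smul_mul_assoc]; exact S.smul_mem _ hx
  have hq : ∀ x ∈ S, x * q.elt = x := by
    intro x hx
    induction hx using Submodule.span_induction with
    | mem x h =>
      obtain ⟨p, rfl⟩ := h
      change p.1 * prim q * p.2 * q.elt = p.1 * prim q * p.2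
      rw [mul_assoc, q.comm, ← mul_assoc, mul_assoc p.1, q.comm, elt_mul_prim]
    | zero => simp
    | add x y _ _ hx hy => rw [add_mul, hx, hy]
    | smul a x _ hx => rw [smul_mul_assoc, hx]
  let J : Submodule B B := { S with smul_mem' := fun c x hx => hl c x hx }
  obtain ⟨e, he, hje⟩ := exists_right_identity J
  -- The right identity e is also a left identity: (x − ex)c(x − ex) = 0 for every c, and regularity
  -- then forces x = ex.
  have hej : ∀ x ∈ S, e * x = x := by
    intro x hx
    obtain ⟨c, hc⟩ := exists_mul_mul_eq_self (x - e * x)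
    have hx' : x - e * x ∈ S := S.sub_mem hx (hl e x hx)
    have h2 : (x - e * x) * c * (x - e * x) = 0 := by
      rw [mul_sub, ← mul_assoc, hje _ (hr c _ hx'), sub_self]
    rw [h2] at hc
    exact (sub_eq_zero.1 hc.symm).symm
  have hcen : e ∈ Subalgebra.center ℂ B := by
    rw [Subalgebra.mem_center_iff]
    intro b
    rw [← hej _ (hl b e he), ← mul_assoc, hje _ (hr b e he)]
  have hf : prim q ∈ S := Submodule.subset_span ⟨(1, 1), by simp⟩
  rcases q.2.minimal e trivial hcen (hje e he) (hq e he) with h | h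
  · exact absurd (by rw [← hej _ hf, h, zero_mul]) (prim_ne_zero q)
  · rw [show q.elt = e from h.symm]; exact he

/-- Every trace is a combination of characters. -/
theorem trace_eq_sum {σ : B →ₗ[ℂ] ℂ} (hσ : ∀ a b, σ (a * b) = σ (b * a)) (x : B) :
    σ x = ∑ q : Sector B, σ (prim q) * modTr (irrep q) x := by
  have key : ∀ (q : Sector B), σ (x * q.elt) = σ (prim q) * modTr (irrep q) x := by
    intro q
    rw [← modTr_irrep_mul_elt]
    -- On a spanning element w = apb, cyclicity reduces both sides to p(bxa)p, a scalar multiple of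
    -- p.
    have : ∀ w ∈ Submodule.span ℂ (Set.range fun p : B × B => p.1 * prim q * p.2),
        σ (x * w) = σ (prim q) * modTr (irrep q) (x * w) := by
      intro w hw
      induction hw using Submodule.span_induction with
      | mem w h =>
        obtain ⟨p, rfl⟩ := h
        have : ∀ ρ : B →ₗ[ℂ] ℂ, (∀ a b, ρ (a * b) = ρ (b * a)) →
            ρ (x * (p.1 * prim q * p.2)) = ρ (prim q * (p.2 * x * p.1) * prim q) := by
          intro ρ hρ
          rw [show x * (p.1 * prim q * p.2) = (x * p.1 * prim q) * (prim q * p.2) by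
            simp only [mul_assoc]; rw [← mul_assoc (prim q), prim_idem], hρ]
          simp only [mul_assoc]
        obtain ⟨c, hc⟩ := exists_prim_mul_mul_prim q (p.2 * x * p.1)
        rw [this σ hσ, this _ (modTr_mul_comm _), hc, map_smul, map_smul, modTr_irrep_prim_self]
        simp [mul_comm]
      | zero => simp
      | add a b _ _ ha hb => rw [mul_add, map_add, map_add, ha, hb, mul_add]
      | smul a b _ hb => rw [mul_smul_comm, map_smul, map_smul, hb]; simp; ring
    exact this _ (elt_mem_span_mul_prim_mul q)
  conv_lhs => rw [← mul_one x, ← sum_elt (⊤ : Subalgebra ℂ B), Finset.mul_sum, map_sum]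
  exact Finset.sum_congr rfl fun q _ => key q

/-- The character of `irrep q` in terms of the regular representation. -/
theorem modTr_irrep_eq_trace (q : Sector B) (x : B) :
    modTr (irrep q) x = LinearMap.trace ℂ B (LinearMap.mulLeft ℂ x ∘ₗ LinearMap.mulRight ℂ (prim q)) := by
  let i : irrep q →ₗ[ℂ] B := (irrep q).subtype.restrictScalars ℂ
  let p : B →ₗ[ℂ] irrep q :=
    { toFun := fun y => ⟨y * prim q, mul_prim_mem q y⟩
      map_add' := fun a b => Subtype.ext (add_mul _ _ _)
      map_smul' := fun c a => Subtype.ext (smul_mul_assoc _ _ _) }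
  have h1 : LinearMap.mulLeft ℂ x ∘ₗ LinearMap.mulRight ℂ (prim q) = (LinearMap.mulLeft ℂ x ∘ₗ i) ∘ₗ p :=
    rfl
  rw [h1, LinearMap.trace_comp_comm']
  simp only [modTr, LinearMap.comp_apply, AlgHom.toLinearMap_apply]
  congr 1
  ext y
  exact (mul_prim q ((irrep q).smul_mem x y.2)).symm

end Semisimple

/-! ### Consequences of the C*-identity -/

section CStar

variable {A : Type*} [CStarAlgebra A]

/-- For h = x*x the C*-identity gives ‖h^(2ⁿ)‖ = ‖h‖^(2ⁿ), so a nilpotent h vanishes. -/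
theorem eq_zero_of_isNilpotent_star_mul_self {x : A} (h : IsNilpotent (star x * x)) : x = 0 := by
  obtain ⟨n, hn⟩ := h
  have h2 : (star x * x) ^ 2 ^ n = 0 :=
    pow_eq_zero_of_le (Nat.lt_two_pow_self).le hn
  have h3 := (IsSelfAdjoint.star_mul_self x).nnnorm_pow_two_pow n
  rw [h2, nnnorm_zero] at h3
  have h4 := eq_zero_of_pow_eq_zero h3.symm
  rw [nnnorm_eq_zero] at h4
  exact CStarRing.star_mul_self_eq_zero_iff x |>.1 h4

theorem star_elt [FiniteDimensional ℂ A] {C : Subalgebra ℂ A} (e : MinCentralIdem C) :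
    star e.elt = e.elt := by
  have hc : star e.elt * e.elt = e.elt * star e.elt := e.comm _
  have hs : star e.elt * star e.elt = star e.elt := by rw [← star_mul, e.idem]
  have h : e.elt - star e.elt * e.elt = 0 := by
    rw [← CStarRing.star_mul_self_eq_zero_iff]
    simp only [star_sub, star_mul, star_star, mul_sub, sub_mul]
    have h1 : star e.elt * e.elt * (star e.elt * e.elt) = star e.elt * e.elt := by
      rw [mul_assoc, ← mul_assoc e.elt, ← hc, mul_assoc (star e.elt), e.idem, ← mul_assoc, hs]
    rw [← mul_assoc] at h1
    rw [← mul_assoc, hs, mul_assoc, e.idem, ← mul_assoc, h1]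
    simp
  have h2 := sub_eq_zero.1 h
  rw [h2, star_mul, star_star]

variable [FiniteDimensional ℂ A]

/-- The Jacobson radical is a nilpotent ideal. For x in it, x*x is in it too, hence nilpotent, hence
x = 0. -/
theorem isSemisimpleRing_of_star_mem {N : Subalgebra ℂ A} (hN : ∀ x ∈ N, star x ∈ N) :
    IsSemisimpleRing N := by
  have : IsArtinianRing N := isArtinian_of_tower ℂ inferInstance
  rw [IsArtinianRing.isSemisimpleRing_iff_jacobson, eq_bot_iff]
  intro x hx
  have hy : (⟨star (x : A), hN _ x.2⟩ : N) * x ∈ Ring.jacobson N := Ideal.mul_mem_left _ _ hx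
  obtain ⟨n, hn⟩ := IsArtinianRing.isNilpotent_jacobson_bot (R := N)
  rw [Ideal.jacobson_bot] at hn
  have h2 := Ideal.pow_mem_pow hy n
  rw [hn] at h2
  have h3 : IsNilpotent (star (x : A) * x) := ⟨n, congrArg Subtype.val ((Submodule.mem_bot N).1 h2)⟩
  exact (Submodule.mem_bot N).2 (Subtype.ext (eq_zero_of_isNilpotent_star_mul_self h3))

instance isSemisimpleRing_cstar : IsSemisimpleRing A := by
  have := isSemisimpleRing_of_star_mem (N := (⊤ : Subalgebra ℂ A)) fun _ _ => trivial
  exact (Subalgebra.topEquiv (R := ℂ) (A := A)).toRingEquiv.isSemisimpleRing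

/-- The trace of the regular representation is faithful. -/
theorem modTr_self_faithful : IsFaithfulTrace (modTr (B := A) A) := by
  refine ⟨modTr_mul_comm A, fun a ha => ?_⟩
  let T : Module.End ℂ A := Algebra.lsmul ℂ ℂ A (star a * a)
  have hT : modTr (B := A) A (star a * a) = LinearMap.trace ℂ A T := rfl
  -- The eigenvalues of left multiplication by a*a lie in the spectrum of a*a and are nonnegative.
  -- If their sum vanishes, all are zero and the operator is nilpotent.
  have hroot : ∀ μ ∈ T.charpoly.roots, 0 ≤ μ := by
    intro μ hμ
    let _ := CStarAlgebra.spectralOrder A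
    have := CStarAlgebra.spectralOrderedRing A
    refine spectrum_nonneg_of_nonneg (star_mul_self_nonneg a) ?_
    have h1 : T.HasEigenvalue μ :=
      (Module.End.hasEigenvalue_iff_isRoot_charpoly _ _).2 (Polynomial.isRoot_of_mem_roots hμ)
    have h2 := h1.mem_spectrum
    exact AlgHom.spectrum_apply_subset (Algebra.lsmul ℂ ℂ A) _ h2
  rw [hT, Module.End.trace_eq_sum_roots_charpoly_of_splits (IsAlgClosed.splits _)]
  refine lt_of_le_of_ne (Multiset.sum_nonneg hroot) fun h0 => ha ?_
  have hz : ∀ μ ∈ T.charpoly.roots, μ = 0 :=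
    fun μ hμ => Multiset.all_zero_of_le_zero_le_of_sum_eq_zero hroot h0.symm μ hμ
  have hnil : IsNilpotent T := by
    rw [LinearMap.isNilpotent_iff_charpoly]
    have hs := (IsAlgClosed.splits T.charpoly).eq_prod_roots_of_monic (LinearMap.charpoly_monic T)
    rw [Multiset.eq_replicate_of_mem hz] at hs
    simp only [Multiset.map_replicate, map_zero, sub_zero, Multiset.prod_replicate] at hs
    have hd := congrArg Polynomial.natDegree hs
    rw [LinearMap.charpoly_natDegree, Polynomial.natDegree_X_pow] at hd
    rw [hs, hd]
  obtain ⟨n, hn⟩ := hnil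
  refine eq_zero_of_isNilpotent_star_mul_self ⟨n, ?_⟩
  have h5 : (T ^ n) 1 = 0 := by rw [hn]; rfl
  have h6 : T ^ n = Algebra.lsmul ℂ ℂ A ((star a * a) ^ n) := (map_pow _ _ _).symm
  rw [h6] at h5
  exact (mul_one _).symm.trans h5

end CStar

/-! ### Orthonormal frames of a faithful trace and traces of two-sided multiplications -/

section Frames

variable {A : Type*} [CStarAlgebra A] {τ : A →ₗ[ℂ] ℂ}

theorem IsFaithfulTrace.nonneg (hτ : IsFaithfulTrace τ) (a : A) : 0 ≤ τ (star a * a) := by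
  rcases eq_or_ne a 0 with rfl | h
  · simp
  · exact (hτ.pos a h).le

theorem IsFaithfulTrace.eq_zero (hτ : IsFaithfulTrace τ) {a : A} (h : τ (star a * a) = 0) : a = 0 := by
  by_contra h0
  exact (hτ.pos a h0).ne' h

theorem IsFaithfulTrace.star (hτ : IsFaithfulTrace τ) (a : A) : τ (star a) = star (τ a) := by
  have hr : ∀ b : A, (τ (Star.star b * b)).im = 0 := fun b =>
    ((Complex.le_def.1 (hτ.nonneg b)).2).symm
  have h1 := hr (1 + a)
  have h2 := hr (1 + Complex.I • a)
  have h3 := hr a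
  have h4 := hr 1
  simp only [star_add, star_one, add_mul, mul_add, one_mul, mul_one, map_add, star_smul, map_smul,
    smul_mul_assoc, mul_smul_comm, Complex.add_im, smul_eq_mul, Complex.star_def,
    Complex.conj_I] at h1 h2 h4
  simp at h1 h2 h3 h4
  apply Complex.ext
  · simp; linarith
  · simp; linarith

theorem IsFaithfulTrace.ext_mem (hτ : IsFaithfulTrace τ) {N : Subalgebra ℂ A}
    (hN : ∀ x ∈ N, Star.star x ∈ N) {x y : A} (hx : x ∈ N) (hy : y ∈ N)
    (h : ∀ n ∈ N, τ (x * n) = τ (y * n)) : x = y := by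
  rw [← sub_eq_zero]
  apply hτ.eq_zero
  rw [hτ.trace, sub_mul, map_sub, h _ (hN _ (N.sub_mem hx hy)), sub_self]

variable [FiniteDimensional ℂ A]

theorem exists_frame_of_core {V : Type*} [AddCommGroup V] [Module ℂ V] [FiniteDimensional ℂ V]
    (c : InnerProductSpace.Core ℂ V) :
    ∃ (n : ℕ) (u : Fin n → V), ∀ x, ∑ i, c.inner (u i) x • u i = x := by
  let _ : NormedAddCommGroup V := c.toNormedAddCommGroup
  let _ : InnerProductSpace ℂ V := InnerProductSpace.ofCore c.toCore
  exact ⟨_, stdOrthonormalBasis ℂ V, (stdOrthonormalBasis ℂ V).sum_repr'⟩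

/-- An orthonormal basis for the inner product τ(x*y), recorded only through its reproducing
formula; sums over such frames take the place of matrix units. -/
theorem IsFaithfulTrace.exists_frame (hτ : IsFaithfulTrace τ) (V : Submodule ℂ A) :
    ∃ (n : ℕ) (u : Fin n → A), (∀ i, u i ∈ V) ∧ ∀ x ∈ V, ∑ i, τ (Star.star (u i) * x) • u i = x := by
  let c : InnerProductSpace.Core ℂ V :=
    { inner := fun x y => τ (Star.star (x : A) * y)
      conj_inner_symm := fun x y => by
        change Star.star (τ _) = _
        rw [← hτ.star, star_mul, star_star]
      re_inner_nonneg := fun x => (Complex.le_def.1 (hτ.nonneg _)).1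
      add_left := fun x y z => by simp [add_mul]
      smul_left := fun x y r => by simp
      definite := fun x h => Subtype.ext (hτ.eq_zero h) }
  obtain ⟨n, u, h⟩ := exists_frame_of_core c
  refine ⟨n, fun i => u i, fun i => (u i).2, fun x hx => ?_⟩
  have := congrArg V.subtype (h ⟨x, hx⟩)
  rw [map_sum] at this
  exact this

theorem trace_eq_sum_of_frame {V : Type*} [AddCommGroup V] [Module ℂ V] [FiniteDimensional ℂ V]
    {n : ℕ} {u : Fin n → V} {φ : Fin n → Module.Dual ℂ V} (h : ∀ x, ∑ i, φ i x • u i = x)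
    (T : V →ₗ[ℂ] V) : LinearMap.trace ℂ V T = ∑ i, φ i (T (u i)) := by
  have hT : T = dualTensorHom ℂ V V (∑ i, φ i ⊗ₜ[ℂ] T (u i)) := by
    ext x
    conv_lhs => rw [← h x]
    simp [dualTensorHom_apply]
  conv_lhs => rw [hT, LinearMap.trace_eq_contract_apply]
  simp [contractLeft_apply]

/-- The functional `x ↦ τ(a x)`. -/
noncomputable def mulLeftFunctional (τ : A →ₗ[ℂ] ℂ) (a : A) : Module.Dual ℂ A := τ ∘ₗ LinearMap.mulLeft ℂ a

/-- The trace of `a ↦ x a y`. -/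
noncomputable def biTr (x y : A) : ℂ :=
  LinearMap.trace ℂ A (LinearMap.mulLeft ℂ x ∘ₗ LinearMap.mulRight ℂ y)

theorem biTr_eq_sum {n : ℕ} {u : Fin n → A}
    (h : ∀ x, ∑ i, τ (Star.star (u i) * x) • u i = x) (x y : A) :
    biTr x y = ∑ i, τ (Star.star (u i) * (x * (u i * y))) :=
  trace_eq_sum_of_frame (φ := fun i => mulLeftFunctional τ (Star.star (u i))) h _

theorem IsFaithfulTrace.frame_star (hτ : IsFaithfulTrace τ) {n : ℕ} {u : Fin n → A} {x : A}
    (h : ∑ i, τ (Star.star (u i) * Star.star x) • u i = Star.star x) :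
    ∑ i, τ (x * u i) • Star.star (u i) = x := by
  have := congrArg Star.star h
  rw [star_star] at this
  conv_rhs => rw [← this]
  rw [star_sum]
  refine Finset.sum_congr rfl fun i _ => ?_
  rw [star_smul, ← hτ.star, star_mul, star_star, star_star]

/-- For the bilinear form tr(ab), the transpose of a ↦ xay is a ↦ yax, and a frame and its adjoints
are dual bases. -/
theorem biTr_comm (x y : A) : biTr x y = biTr y x := by
  have hτ := modTr_self_faithful (A := A)
  obtain ⟨n, u, -, h⟩ := hτ.exists_frame ⊤
  have h' : ∀ x, ∑ i, modTr (B := A) A (Star.star (u i) * x) • u i = x := fun x => h x trivial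
  rw [biTr_eq_sum h']
  have h2 : ∀ x, ∑ i, modTr (B := A) A (u i * x) • Star.star (u i) = x := fun x => by
    have := hτ.frame_star (h (Star.star x) trivial)
    simpa only [hτ.trace x] using this
  have h3 : biTr y x = ∑ i, modTr (B := A) A (u i * (y * (Star.star (u i) * x))) :=
    trace_eq_sum_of_frame (φ := fun i => mulLeftFunctional (modTr (B := A) A) (u i)) h2 _
  rw [h3]
  refine Finset.sum_congr rfl fun i _ => ?_
  rw [← mul_assoc, hτ.trace]
  simp only [mul_assoc]

theorem biTr_one_right (x : A) : biTr x 1 = modTr (B := A) A x := by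
  rw [biTr, LinearMap.mulRight_one]; rfl

theorem biTr_mul_right (z x y : A) : biTr z (x * y) = biTr z (y * x) := by
  have h1 : ∀ x y : A, LinearMap.mulLeft ℂ z ∘ₗ LinearMap.mulRight ℂ (x * y) =
      LinearMap.mulRight ℂ y ∘ₗ (LinearMap.mulLeft ℂ z ∘ₗ LinearMap.mulRight ℂ x) := by
    intro x y; ext a; simp [mul_assoc]
  have h2 : ∀ x y : A, LinearMap.mulLeft ℂ z ∘ₗ LinearMap.mulRight ℂ (y * x) =
      (LinearMap.mulLeft ℂ z ∘ₗ LinearMap.mulRight ℂ x) ∘ₗ LinearMap.mulRight ℂ y := by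
    intro x y; ext a; simp [mul_assoc]
  rw [biTr, h1, LinearMap.trace_comp_comm', ← h2, biTr]

/-- `biTr z` as a linear functional. -/
noncomputable def biTrₗ (z : A) : A →ₗ[ℂ] ℂ where
  toFun := biTr z
  map_add' x y := by
    rw [biTr, biTr, biTr, ← map_add]; congr 1; ext a; simp [mul_add]
  map_smul' c x := by
    rw [biTr, biTr, RingHom.id_apply, ← map_smul]; congr 1; ext a; simp

end Frames

/-! ### Trace-preserving conditional expectations and their index -/

section CondExp

variable {A : Type*} [CStarAlgebra A] [FiniteDimensional ℂ A] {τ : A →ₗ[ℂ] ℂ}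
  {N : Subalgebra ℂ A}

/-- Decompose y = y⁺ − y⁻ inside the C*-algebra N and test with n = y⁻. If y⁻ = c*c, the value is
−τ((cy⁻)*(cy⁻)), so faithfulness forces y⁻ = 0. -/
theorem exists_star_mul_self_of_forall_mem (hτ : IsFaithfulTrace τ)
    (hN : ∀ x ∈ N, star x ∈ N) {y : A} (hy : y ∈ N) (hs : star y = y)
    (h : ∀ n ∈ N, 0 ≤ τ (star n * y * n)) : ∃ b, y = star b * b := by
  let S : StarSubalgebra ℂ A := { N with star_mem' := fun {x} hx => hN x hx }
  have hcl : IsClosed (S : Set A) := (Subalgebra.toSubmodule N).closed_of_finiteDimensional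
  let y' : S := ⟨y, hy⟩
  have hy' : IsSelfAdjoint y' := Subtype.ext hs
  let _ := CStarAlgebra.spectralOrder S
  have := CStarAlgebra.spectralOrderedRing S
  have e1 : y'⁺ - y'⁻ = y' := CFC.posPart_sub_negPart y' hy'
  have e2 : y'⁻ * y'⁺ = 0 := CFC.negPart_mul_posPart y'
  obtain ⟨c, hc⟩ := CStarAlgebra.nonneg_iff_eq_star_mul_self.1 (CFC.negPart_nonneg y')
  obtain ⟨b, hb⟩ := CStarAlgebra.nonneg_iff_eq_star_mul_self.1 (CFC.posPart_nonneg y')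
  have hn : star (y'⁻) = y'⁻ := (CFC.negPart_nonneg y').isSelfAdjoint
  have h1 := h (y'⁻ : S) (y'⁻ : S).2
  have aux : ∀ p n : S, n * p = 0 → n = star c * c → star n = n →
      star n * (p - n) * n = -(star (c * n) * (c * n)) := by
    intro p n h0 hc hn
    rw [hn, mul_sub, h0, zero_sub, neg_mul, star_mul, hn, mul_assoc n (star c), ← mul_assoc (star c),
      ← hc, mul_assoc]
  have e3 : star (y'⁻) * y' * y'⁻ = -(star (c * y'⁻) * (c * y'⁻)) := by
    have := aux _ _ e2 hc hn
    rwa [e1] at this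
  have e4 : star ((y'⁻ : S) : A) * y * ((y'⁻ : S) : A) =
      -(star ((c * y'⁻ : S) : A) * ((c * y'⁻ : S) : A)) := congrArg Subtype.val e3
  rw [e4, map_neg] at h1
  have h2 : ((c * y'⁻ : S) : A) = 0 :=
    hτ.eq_zero (le_antisymm (neg_nonneg.1 h1) (hτ.nonneg _))
  have h3 : y'⁻ = 0 := by
    have : c * y'⁻ = 0 := Subtype.ext h2
    have h4 : star (y'⁻) * y'⁻ = 0 := by
      have aux2 : ∀ n : S, n = star c * c → c * n = 0 → n * n = 0 := fun n hc h0 => by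
        conv_lhs => enter [1]; rw [hc]
        rw [mul_assoc, h0, mul_zero]
      rw [hn, aux2 _ hc this]
    exact (CStarRing.star_mul_self_eq_zero_iff _).1 h4
  rw [h3, sub_zero] at e1
  exact ⟨b, congrArg Subtype.val (e1.symm.trans hb)⟩

theorem IsCondExp.unique (hτ : IsFaithfulTrace τ) (hN : ∀ x ∈ N, star x ∈ N) {E E' : A →ₗ[ℂ] A}
    (h : IsCondExp τ N E) (h' : IsCondExp τ N E') : E = E' := by
  ext a
  refine hτ.ext_mem hN (h.mem a) (h'.mem a) fun n hn => ?_
  rw [← h.mul_right n hn, ← h'.mul_right n hn, h.preserves, h'.preserves]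

theorem HasIndex.unique {E : A →ₗ[ℂ] A} {c c' : A} (h : HasIndex E c)
    (h' : HasIndex E c') : c = c' := by
  obtain ⟨n, a, b, h1, -, rfl⟩ := h
  obtain ⟨m, a', b', -, h2, rfl⟩ := h'
  calc ∑ i, a i * b i = ∑ i, ∑ j, a i * (E (b i * a' j) * b' j) := by
        refine Finset.sum_congr rfl fun i _ => ?_
        rw [← Finset.mul_sum, h2]
    _ = ∑ j, (∑ i, a i * E (b i * a' j)) * b' j := by
        rw [Finset.sum_comm]
        refine Finset.sum_congr rfl fun j _ => ?_
        rw [Finset.sum_mul]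
        exact Finset.sum_congr rfl fun i _ => (mul_assoc _ _ _).symm
    _ = ∑ j, a' j * b' j := Finset.sum_congr rfl fun j _ => by rw [h1]

/-- The orthogonal projection onto the span of a frame. -/
noncomputable def frameProj (τ : A →ₗ[ℂ] ℂ) {n : ℕ} (u : Fin n → A) : A →ₗ[ℂ] A :=
  ∑ i, (mulLeftFunctional τ (star (u i))).smulRight (u i)

theorem frameProj_apply {n : ℕ} (u : Fin n → A) (x : A) :
    frameProj τ u x = ∑ i, τ (star (u i) * x) • u i := by
  simp [frameProj, mulLeftFunctional]

theorem trace_frameProj_mul (hτ : IsFaithfulTrace τ) (hN : ∀ x ∈ N, star x ∈ N) {n : ℕ}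
    {u : Fin n → A} (hf : ∀ x ∈ N, ∑ i, τ (star (u i) * x) • u i = x) (y : A) {m : A} (hm : m ∈ N) :
    τ (frameProj τ u y * m) = τ (y * m) := by
  have h2 := hτ.frame_star (hf _ (hN m hm))
  conv_rhs => rw [← h2]
  rw [frameProj_apply, Finset.sum_mul, Finset.mul_sum, map_sum, map_sum]
  refine Finset.sum_congr rfl fun i _ => ?_
  rw [smul_mul_assoc, mul_smul_comm, map_smul, map_smul, hτ.trace y, hτ.trace m, smul_eq_mul,
    smul_eq_mul, mul_comm]

/-- The orthogonal projection is characterized by τ(E(y)m) = τ(ym) for m ∈ N. The bimodule property,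
compatibility with the star and positivity are all tested against N by this relation. -/
theorem isCondExp_frameProj (hτ : IsFaithfulTrace τ) (hN : ∀ x ∈ N, star x ∈ N) {n : ℕ}
    {u : Fin n → A} (hu : ∀ i, u i ∈ N) (hf : ∀ x ∈ N, ∑ i, τ (star (u i) * x) • u i = x) :
    IsCondExp τ N (frameProj τ u) := by
  have hmem : ∀ a, frameProj τ u a ∈ N := fun a => by
    rw [frameProj_apply]; exact N.sum_mem fun i _ => N.smul_mem (hu i) _
  have key := fun y m hm => trace_frameProj_mul hτ hN hf y (m := m) hm
  have hpres : ∀ a, τ (frameProj τ u a) = τ a := fun a => by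
    have := key a 1 N.one_mem
    rwa [mul_one, mul_one] at this
  have hr : ∀ n ∈ N, ∀ a, frameProj τ u (a * n) = frameProj τ u a * n := by
    intro n hn a
    refine hτ.ext_mem hN (hmem _) (N.mul_mem (hmem _) hn) fun m hm => ?_
    rw [key _ _ hm, mul_assoc, mul_assoc, key _ _ (N.mul_mem hn hm)]
  have hl : ∀ n ∈ N, ∀ a, frameProj τ u (n * a) = n * frameProj τ u a := by
    intro n hn a
    refine hτ.ext_mem hN (hmem _) (N.mul_mem hn (hmem _)) fun m hm => ?_
    rw [key _ _ hm, mul_assoc, mul_assoc, hτ.trace, hτ.trace n, mul_assoc, mul_assoc,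
      key _ _ (N.mul_mem hm hn)]
  have hstar : ∀ a, frameProj τ u (star a) = star (frameProj τ u a) := by
    intro a
    refine hτ.ext_mem hN (hmem _) (hN _ (hmem _)) fun m hm => ?_
    rw [key _ _ hm, hτ.trace, ← star_star m, ← star_mul, hτ.star, ← key _ _ (hN m hm), ← hτ.star,
      star_mul, hτ.trace]
  refine ⟨hmem, fun n hn => by rw [frameProj_apply, hf n hn], hl, hr, fun a => ?_, hpres⟩
  refine exists_star_mul_self_of_forall_mem hτ hN (hmem _) ?_ fun n hn => ?_
  · rw [← hstar, star_mul, star_star]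
  · rw [← hl _ (hN n hn), ← hr n hn, hpres, show star n * (star a * a) * n = star (a * n) * (a * n) by
      simp only [star_mul, mul_assoc]]
    exact hτ.nonneg _

/-- The Casimir sum of a frame is central in `N` and invertible. -/
theorem exists_frame_inverse (hτ : IsFaithfulTrace τ) (hN : ∀ x ∈ N, star x ∈ N) {n : ℕ}
    {u : Fin n → A} (hu : ∀ i, u i ∈ N) (hf : ∀ x ∈ N, ∑ i, τ (star (u i) * x) • u i = x) :
    (∑ i, star (u i) * u i = ∑ i, u i * star (u i)) ∧
    ∃ w ∈ N, (∀ x ∈ N, x * w = w * x) ∧ w * ∑ i, u i * star (u i) = 1 := by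
  have hf' : ∀ x ∈ N, ∑ i, τ (x * u i) • star (u i) = x := fun x hx => hτ.frame_star (hf _ (hN x hx))
  have hsym : ∑ i, star (u i) * u i = ∑ i, u i * star (u i) := by
    calc ∑ i, star (u i) * u i = ∑ i, ∑ j, τ (star (u j) * star (u i)) • (u j * u i) := by
          refine Finset.sum_congr rfl fun i _ => ?_
          conv_lhs => enter [1]; rw [← hf _ (hN _ (hu i))]
          rw [Finset.sum_mul]
          exact Finset.sum_congr rfl fun j _ => smul_mul_assoc _ _ _
      _ = ∑ j, ∑ i, τ (star (u i) * star (u j)) • (u j * u i) := by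
          rw [Finset.sum_comm]
          refine Finset.sum_congr rfl fun j _ => Finset.sum_congr rfl fun i _ => ?_
          rw [hτ.trace]
      _ = ∑ i, u i * star (u i) := by
          refine Finset.sum_congr rfl fun j _ => ?_
          conv_rhs => enter [2]; rw [← hf _ (hN _ (hu j))]
          rw [Finset.mul_sum]
          exact Finset.sum_congr rfl fun j _ => (mul_smul_comm _ _ _).symm
  set w := ∑ i, u i * star (u i) with hw
  have hwN : w ∈ N := N.sum_mem fun i _ => N.mul_mem (hu i) (hN _ (hu i))
  have hcomm : ∀ x ∈ N, x * w = w * x := by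
    intro x hx
    calc x * w = ∑ k, x * (star (u k) * u k) := by rw [← hsym, Finset.mul_sum]
      _ = ∑ k, ∑ j, τ (x * star (u k) * u j) • (star (u j) * u k) := by
          refine Finset.sum_congr rfl fun k _ => ?_
          rw [← mul_assoc, ← hf' _ (N.mul_mem hx (hN _ (hu k))), Finset.sum_mul, hf' _ (N.mul_mem hx (hN _ (hu k)))]
          exact Finset.sum_congr rfl fun j _ => smul_mul_assoc _ _ _
      _ = ∑ j, ∑ k, τ (star (u k) * (u j * x)) • (star (u j) * u k) := by
          rw [Finset.sum_comm]
          refine Finset.sum_congr rfl fun j _ => Finset.sum_congr rfl fun k _ => ?_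
          rw [mul_assoc, hτ.trace, mul_assoc]
      _ = ∑ j, star (u j) * (u j * x) := by
          refine Finset.sum_congr rfl fun j _ => ?_
          conv_rhs => rw [← hf _ (N.mul_mem (hu j) hx)]
          rw [Finset.mul_sum]
          exact Finset.sum_congr rfl fun j _ => (mul_smul_comm _ _ _).symm
      _ = w * x := by
          rw [← hsym, Finset.sum_mul]
          exact Finset.sum_congr rfl fun j _ => (mul_assoc _ _ _).symm
  refine ⟨hsym, ?_⟩
  -- Here x*wx is the sum of |uᵢ*x|². If it vanishes then all uᵢ*x do, and the frame expansion of x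
  -- is zero.
  have hinj : ∀ x ∈ N, w * x = 0 → x = 0 := by
    intro x hx h0
    have h1 : ∑ i, τ (star (star (u i) * x) * (star (u i) * x)) = 0 := by
      have : star x * (w * x) = ∑ i, star (star (u i) * x) * (star (u i) * x) := by
        rw [hw, Finset.sum_mul, Finset.mul_sum]
        refine Finset.sum_congr rfl fun i _ => ?_
        simp only [star_mul, star_star, mul_assoc]
      rw [← map_sum, ← this, h0, mul_zero, map_zero]
    have h2 : ∀ i, star (u i) * x = 0 := fun i =>
      hτ.eq_zero ((Finset.sum_eq_zero_iff_of_nonneg fun i _ => hτ.nonneg _).1 h1 i (Finset.mem_univ i))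
    rw [← hf x hx]
    exact Finset.sum_eq_zero fun i _ => by rw [h2 i, map_zero, zero_smul]
  let T : N →ₗ[ℂ] N := LinearMap.mulLeft ℂ ⟨w, hwN⟩
  have hT : Function.Injective T := by
    rw [← LinearMap.ker_eq_bot, LinearMap.ker_eq_bot']
    intro x hx
    exact Subtype.ext (hinj x x.2 (congrArg Subtype.val hx))
  obtain ⟨v, hv⟩ := LinearMap.surjective_of_injective hT 1
  have hv' : w * (v : A) = 1 := congrArg Subtype.val hv
  have hv2 : (v : A) * w = 1 := by rw [hcomm _ v.2, hv']
  refine ⟨v, v.2, fun x hx => ?_, hv2⟩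
  calc x * (v : A) = v * w * x * v := by rw [hv2, one_mul]
    _ = v * x * (w * v) := by rw [mul_assoc (v : A), ← hcomm x hx]; simp only [mul_assoc]
    _ = v * x := by rw [hv', mul_one]

/-- Let u be a frame of N, v a frame of A, and w the inverse of the Casimir sum of u. Then ∑ vᵢw ⊗
vᵢ* is a quasi-basis, so c = ∑ vᵢwvᵢ* and τ(cz) is the trace of a ↦ zaw. For z = p_q this is the
character of V_q at w, decomposed over the irreducibles of N; it yields the matrix ΛᵀΛ. The second
formula replaces w by any separability element of N and is used with the legs of Δ(1). -/
theorem exists_condExp_index [IsSemisimpleRing N] (hτ : IsFaithfulTrace τ)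
    (hN : ∀ x ∈ N, star x ∈ N) :
    ∃ (E : A →ₗ[ℂ] A) (c : A), IsCondExp τ N E ∧ HasIndex E c ∧
      (∀ q : Sector A, τ (c * prim q) =
        ∑ a : Sector N, (mult (B := N) a (irrep q) : ℂ) * τ (prim a : N)) ∧
      (∀ {k : ℕ} (s t : Fin k → A), (∀ i, s i ∈ N) → (∀ i, t i ∈ N) →
        (∀ x ∈ N, ∑ i, (x * s i) ⊗ₜ[ℂ] t i = ∑ i, s i ⊗ₜ[ℂ] (t i * x)) → ∑ i, s i * t i = 1 →
        ∀ z, τ (c * z) = ∑ i, biTr z (s i) * τ (t i)) := by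
  obtain ⟨n, u, hu, hf⟩ := hτ.exists_frame (Subalgebra.toSubmodule N)
  replace hf : ∀ x ∈ N, ∑ i, τ (star (u i) * x) • u i = x := hf
  replace hu : ∀ i, u i ∈ N := hu
  obtain ⟨m, v, -, hv⟩ := hτ.exists_frame (⊤ : Submodule ℂ A)
  replace hv : ∀ x, ∑ i, τ (star (v i) * x) • v i = x := fun x => hv x trivial
  have hv' : ∀ x, ∑ i, τ (x * v i) • star (v i) = x := fun x => hτ.frame_star (hv _)
  obtain ⟨hsym, w, hwN, hwc, hw⟩ := exists_frame_inverse hτ hN hu hf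
  set W := ∑ i, u i * star (u i) with hW
  have hcz : ∀ z, τ ((∑ i, v i * w * star (v i)) * z) = biTr z w := by
    intro z
    rw [biTr_eq_sum hv, Finset.sum_mul, map_sum]
    refine Finset.sum_congr rfl fun i _ => ?_
    rw [mul_assoc, hτ.trace]
    simp only [mul_assoc]
  refine ⟨frameProj τ u, ∑ i, v i * w * star (v i), isCondExp_frameProj hτ hN hu hf,
    ⟨m, fun i => v i * w, fun i => star (v i), fun x => ?_, fun x => ?_, rfl⟩, fun q => ?_, ?_⟩
  · calc ∑ i, v i * w * frameProj τ u (star (v i) * x)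
        = ∑ j, (∑ i, τ (star (v i) * (x * star (u j))) • v i) * (w * u j) := by
          simp only [frameProj_apply, Finset.mul_sum, Finset.sum_mul]
          rw [Finset.sum_comm]
          refine Finset.sum_congr rfl fun j _ => Finset.sum_congr rfl fun i _ => ?_
          rw [mul_smul_comm, smul_mul_assoc, hτ.trace, mul_assoc, mul_assoc]
      _ = x * (w * W) := by
          simp only [hv]
          rw [← hsym, Finset.mul_sum, Finset.mul_sum]
          refine Finset.sum_congr rfl fun j _ => ?_
          rw [mul_assoc, ← mul_assoc (star (u j)), hwc _ (hN _ (hu j))]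
          simp only [mul_assoc]
      _ = x := by rw [hw, mul_one]
  · calc ∑ i, frameProj τ u (x * (v i * w)) * star (v i)
        = ∑ j, u j * ∑ i, τ (w * star (u j) * x * v i) • star (v i) := by
          simp only [frameProj_apply, Finset.mul_sum, Finset.sum_mul]
          rw [Finset.sum_comm]
          refine Finset.sum_congr rfl fun j _ => Finset.sum_congr rfl fun i _ => ?_
          rw [mul_smul_comm, smul_mul_assoc, ← mul_assoc, ← mul_assoc, hτ.trace, ← mul_assoc,
            ← mul_assoc]
      _ = w * W * x := by
          simp only [hv']
          rw [Finset.mul_sum, Finset.sum_mul]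
          refine Finset.sum_congr rfl fun j _ => ?_
          rw [← mul_assoc, ← mul_assoc, hwc _ (hu j)]
          simp only [mul_assoc]
      _ = x := by rw [hw, one_mul]
  · rw [hcz, biTr_comm]
    have h1 : biTr w (prim q) = modTr (B := N) (irrep q) ⟨w, hwN⟩ := (modTr_irrep_eq_trace q w).symm
    rw [h1, trace_eq_sum (modTr_mul_comm (irrep q))]
    refine Finset.sum_congr rfl fun a _ => ?_
    rw [mult_eq_modTr]
    congr 1
    -- The character of the irreducible a of N at w, computed in the frame u, is τ(wW p_a) with W
    -- the Casimir sum, i.e. τ(p_a).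
    rw [modTr_irrep_eq_trace, trace_eq_sum_of_frame (u := fun i => (⟨u i, hu i⟩ : N))
      (φ := fun i => mulLeftFunctional τ (star (u i)) ∘ₗ N.val.toLinearMap)
      (fun x => by
        apply Subtype.ext
        have := hf x x.2
        conv_rhs => rw [← this]
        exact (map_sum N.val _ _))]
    have h2 : ∀ i, (mulLeftFunctional τ (star (u i)) ∘ₗ N.val.toLinearMap)
        ((LinearMap.mulLeft ℂ (⟨w, hwN⟩ : N) ∘ₗ LinearMap.mulRight ℂ (prim a)) ⟨u i, hu i⟩) =
        τ (w * (star (u i) * u i) * (prim a : N)) := by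
      intro i
      change τ (star (u i) * (w * (u i * (prim a : N)))) = _
      rw [← mul_assoc, hwc _ (hN _ (hu i))]
      simp only [mul_assoc]
    simp only [h2]
    rw [← map_sum, ← Finset.sum_mul, ← Finset.mul_sum, hsym, hw, one_mul]
  · intro k s t hs ht hst h1 z
    rw [hcz]
    have ρ : ∀ x y, biTrₗ z (x * y) = biTrₗ z (y * x) := biTr_mul_right z
    change biTrₗ z w = ∑ i, biTrₗ z (s i) * τ (t i)
    have hg : ∀ x ∈ N, ∀ f g : A →ₗ[ℂ] ℂ, ∑ i, f (x * s i) * g (t i) = ∑ i, f (s i) * g (t i * x) := by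
      intro x hx f g
      have := congrArg (LinearMap.mul' ℂ ℂ ∘ₗ TensorProduct.map f g) (hst x hx)
      simpa using this
    -- Expand tᵢ in the frame u, use that y ↦ `biTr z y` is a trace, and move uⱼ* from tᵢ to sᵢ by
    -- the separability relation. What is left is ∑ uⱼwuⱼ* = wW = 1.
    calc biTrₗ z w = ∑ i, biTrₗ z (w * s i * t i) := by
          rw [← map_sum]
          simp only [mul_assoc]
          rw [← Finset.mul_sum, h1, mul_one]
      _ = ∑ j, ∑ i, biTrₗ z (u j * w * s i) * τ (t i * star (u j)) := by
          rw [Finset.sum_comm]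
          refine Finset.sum_congr rfl fun i _ => ?_
          conv_lhs => rw [← hf _ (ht i), Finset.mul_sum, map_sum]
          refine Finset.sum_congr rfl fun j _ => ?_
          rw [mul_smul_comm, map_smul, smul_eq_mul, mul_comm, hτ.trace, ρ, mul_assoc]
      _ = ∑ j, ∑ i, biTrₗ z (u j * w * (star (u j) * s i)) * τ (t i) := by
          refine Finset.sum_congr rfl fun j _ => ?_
          exact (hg _ (hN _ (hu j)) (biTrₗ z ∘ₗ LinearMap.mulLeft ℂ (u j * w)) τ).symm
      _ = ∑ i, biTrₗ z (s i) * τ (t i) := by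
          rw [Finset.sum_comm]
          refine Finset.sum_congr rfl fun i _ => ?_
          rw [← Finset.sum_mul, ← map_sum]
          congr 2
          have : ∀ j, u j * w * (star (u j) * s i) = w * (u j * star (u j)) * s i := by
            intro j
            rw [hwc _ (hu j)]; simp only [mul_assoc]
          simp only [this]
          rw [← Finset.sum_mul, ← Finset.mul_sum, hw, one_mul]

end CondExp

/-! ### Slice maps and positivity of tr ⊗ tr -/

section Slices

variable {A : Type*} [CStarAlgebra A]

/-- `(f ⊗ id)(t)`. -/
noncomputable def sliceL (f : A →ₗ[ℂ] ℂ) : A ⊗[ℂ] A →ₗ[ℂ] A :=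
  (TensorProduct.lid ℂ A).toLinearMap ∘ₗ f.rTensor A

/-- `(id ⊗ f)(t)`. -/
noncomputable def sliceR (f : A →ₗ[ℂ] ℂ) : A ⊗[ℂ] A →ₗ[ℂ] A :=
  (TensorProduct.rid ℂ A).toLinearMap ∘ₗ f.lTensor A

/-- `(f ⊗ g)(t)`. -/
noncomputable def pairing (f g : A →ₗ[ℂ] ℂ) : A ⊗[ℂ] A →ₗ[ℂ] ℂ :=
  LinearMap.mul' ℂ ℂ ∘ₗ TensorProduct.map f g

@[simp] theorem sliceL_tmul (f : A →ₗ[ℂ] ℂ) (a b : A) : sliceL f (a ⊗ₜ[ℂ] b) = f a • b := by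
  simp [sliceL]

@[simp] theorem sliceR_tmul (f : A →ₗ[ℂ] ℂ) (a b : A) : sliceR f (a ⊗ₜ[ℂ] b) = f b • a := by
  simp [sliceR]

@[simp] theorem pairing_tmul (f g : A →ₗ[ℂ] ℂ) (a b : A) :
    pairing f g (a ⊗ₜ[ℂ] b) = f a * g b := by
  simp [pairing]

theorem apply_sliceL (f g : A →ₗ[ℂ] ℂ) (t : A ⊗[ℂ] A) : g (sliceL f t) = pairing f g t := by
  induction t with
  | zero => simp
  | tmul a b => simp
  | add a b ha hb => simp only [map_add, ha, hb]

theorem apply_sliceR (f g : A →ₗ[ℂ] ℂ) (t : A ⊗[ℂ] A) : f (sliceR g t) = pairing f g t := by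
  induction t with
  | zero => simp
  | tmul a b => simp [mul_comm]
  | add a b ha hb => simp only [map_add, ha, hb]

theorem sliceL_mul_left (f : A →ₗ[ℂ] ℂ) (x : A) (t : A ⊗[ℂ] A) :
    sliceL f (((1 : A) ⊗ₜ[ℂ] x) * t) = x * sliceL f t := by
  induction t with
  | zero => simp
  | tmul a b => simp
  | add a b ha hb => simp only [map_add, mul_add, ha, hb]

theorem sliceL_mul_right (f : A →ₗ[ℂ] ℂ) (x : A) (t : A ⊗[ℂ] A) :
    sliceL f (t * ((1 : A) ⊗ₜ[ℂ] x)) = sliceL f t * x := by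
  induction t with
  | zero => simp
  | tmul a b => simp
  | add a b ha hb => simp only [map_add, add_mul, ha, hb]

theorem sliceR_mul_left (f : A →ₗ[ℂ] ℂ) (x : A) (t : A ⊗[ℂ] A) :
    sliceR f ((x ⊗ₜ[ℂ] (1 : A)) * t) = x * sliceR f t := by
  induction t with
  | zero => simp
  | tmul a b => simp
  | add a b ha hb => simp only [map_add, mul_add, ha, hb]

theorem sliceR_mul_right (f : A →ₗ[ℂ] ℂ) (x : A) (t : A ⊗[ℂ] A) :
    sliceR f (t * (x ⊗ₜ[ℂ] (1 : A))) = sliceR f t * x := by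
  induction t with
  | zero => simp
  | tmul a b => simp
  | add a b ha hb => simp only [map_add, add_mul, ha, hb]

theorem sliceL_trace {f : A →ₗ[ℂ] ℂ} (hf : ∀ a b, f (a * b) = f (b * a)) (x : A) (t : A ⊗[ℂ] A) :
    sliceL f ((x ⊗ₜ[ℂ] (1 : A)) * t) = sliceL f (t * (x ⊗ₜ[ℂ] (1 : A))) := by
  induction t with
  | zero => simp
  | tmul a b => simp [hf x]
  | add a b ha hb => simp only [map_add, add_mul, mul_add, ha, hb]

theorem sliceR_trace {f : A →ₗ[ℂ] ℂ} (hf : ∀ a b, f (a * b) = f (b * a)) (x : A) (t : A ⊗[ℂ] A) :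
    sliceR f (((1 : A) ⊗ₜ[ℂ] x) * t) = sliceR f (t * ((1 : A) ⊗ₜ[ℂ] x)) := by
  induction t with
  | zero => simp
  | tmul a b => simp [hf x]
  | add a b ha hb => simp only [map_add, add_mul, mul_add, ha, hb]

theorem pairing_trace {f g : A →ₗ[ℂ] ℂ} (hf : ∀ a b, f (a * b) = f (b * a))
    (hg : ∀ a b, g (a * b) = g (b * a)) (s t : A ⊗[ℂ] A) :
    pairing f g (s * t) = pairing f g (t * s) := by
  induction t with
  | zero => simp
  | tmul a b =>
    induction s with
    | zero => simp
    | tmul c d => simp [hf c, hg d]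
    | add a b ha hb => simp only [map_add, add_mul, mul_add, ha, hb]
  | add a b ha hb => simp only [map_add, add_mul, mul_add, ha, hb]

theorem tmul_mul_tmul_one (x y : A) :
    (x ⊗ₜ[ℂ] (1 : A)) * (y ⊗ₜ[ℂ] (1 : A)) = (x * y) ⊗ₜ[ℂ] (1 : A) := by simp

theorem one_tmul_mul_one_tmul (x y : A) :
    ((1 : A) ⊗ₜ[ℂ] x) * ((1 : A) ⊗ₜ[ℂ] y) = (1 : A) ⊗ₜ[ℂ] (x * y) := by simp

theorem tmul_one_mul_one_tmul (x y : A) :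
    (x ⊗ₜ[ℂ] (1 : A)) * ((1 : A) ⊗ₜ[ℂ] y) = x ⊗ₜ[ℂ] y := by simp

theorem one_tmul_mul_tmul_one (x y : A) :
    ((1 : A) ⊗ₜ[ℂ] y) * (x ⊗ₜ[ℂ] (1 : A)) = x ⊗ₜ[ℂ] y := by simp

theorem central_tmul_comm {x y : A} (hx : x ∈ Subalgebra.center ℂ A)
    (hy : y ∈ Subalgebra.center ℂ A) (t : A ⊗[ℂ] A) : (x ⊗ₜ[ℂ] y) * t = t * (x ⊗ₜ[ℂ] y) := by
  rw [Subalgebra.mem_center_iff] at hx hy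
  induction t with
  | zero => simp
  | tmul a b => simp [hx a, hy b]
  | add a b ha hb => simp only [add_mul, mul_add, ha, hb]

variable (A) [FiniteDimensional ℂ A]

/-- The trace of the left regular representation. -/
noncomputable def tr : A →ₗ[ℂ] ℂ := modTr (B := A) A

variable {A}

theorem tr_faithful : IsFaithfulTrace (tr A) := modTr_self_faithful

theorem tr_mul_comm (x y : A) : tr A (x * y) = tr A (y * x) := tr_faithful.trace x y

theorem biTr_one (x : A) : biTr x 1 = tr A x := biTr_one_right x

/-- A positive tensor is sent to a positive element by the right slice with the trace. -/
theorem exists_sliceR_star_mul_self (Z : A ⊗[ℂ] A) :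
    ∃ (n : ℕ) (y u : Fin n → A), Z = ∑ i, y i ⊗ₜ[ℂ] u i ∧
      sliceR (tr A) (star Z * Z) = ∑ i, star (y i) * y i ∧
      pairing (tr A) (tr A) (star Z * Z) = ∑ i, tr A (star (y i) * y i) := by
  obtain ⟨n, u, -, hu⟩ := (tr_faithful (A := A)).exists_frame ⊤
  replace hu : ∀ x, ∑ i, tr A (star (u i) * x) • u i = x := fun x => hu x trivial
  let y : Fin n → A := fun i => sliceR (tr A) (((1 : A) ⊗ₜ[ℂ] star (u i)) * Z)
  have hZ : Z = ∑ i, y i ⊗ₜ[ℂ] u i := by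
    change Z = ∑ i, sliceR (tr A) (((1 : A) ⊗ₜ[ℂ] star (u i)) * Z) ⊗ₜ[ℂ] u i
    induction Z with
    | zero => simp
    | tmul a b =>
      simp only [Algebra.TensorProduct.tmul_mul_tmul, one_mul, sliceR_tmul, TensorProduct.smul_tmul,
        ← TensorProduct.tmul_sum, hu]
    | add a b ha hb =>
      simp only [mul_add, map_add, TensorProduct.add_tmul, Finset.sum_add_distrib, ← ha, ← hb]
  have hy : ∀ i, ∑ j, tr A (star (u i) * u j) • y j = y i := by
    intro i
    change _ = sliceR (tr A) (((1 : A) ⊗ₜ[ℂ] star (u i)) * Z)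
    rw [hZ]
    simp [Finset.mul_sum]
  have hs : sliceR (tr A) (star Z * Z) = ∑ i, star (y i) * y i := by
    conv_lhs => rw [hZ]
    simp only [star_sum, TensorProduct.star_tmul, Finset.sum_mul, Finset.mul_sum, map_sum,
      Algebra.TensorProduct.tmul_mul_tmul, sliceR_tmul]
    rw [Finset.sum_comm]
    refine Finset.sum_congr rfl fun i _ => ?_
    conv_rhs => enter [2]; rw [← hy i]
    rw [Finset.mul_sum]
    exact Finset.sum_congr rfl fun j _ => (mul_smul_comm _ _ _).symm
  refine ⟨n, y, u, hZ, hs, ?_⟩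
  rw [← apply_sliceR, hs, map_sum]

theorem pairing_star_mul_self_nonneg (Z : A ⊗[ℂ] A) :
    0 ≤ pairing (tr A) (tr A) (star Z * Z) := by
  obtain ⟨n, y, u, -, -, h⟩ := exists_sliceR_star_mul_self Z
  rw [h]
  exact Finset.sum_nonneg fun i _ => tr_faithful.nonneg _

theorem eq_zero_of_pairing_star_mul_self {Z : A ⊗[ℂ] A}
    (h0 : pairing (tr A) (tr A) (star Z * Z) = 0) : Z = 0 := by
  obtain ⟨n, y, u, hZ, -, h⟩ := exists_sliceR_star_mul_self Z
  rw [h] at h0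
  rw [hZ]
  refine Finset.sum_eq_zero fun i hi => ?_
  have := (Finset.sum_eq_zero_iff_of_nonneg fun i _ => tr_faithful.nonneg (y i)).1 h0 i hi
  rw [tr_faithful.eq_zero this, TensorProduct.zero_tmul]

end Slices

/-! ### Left integrals and a positive element implementing S² -/

section Integral

open Coalgebra CStarWeakHopfAlgebra

variable {A : Type*} [CStarAlgebra A] [CStarWeakHopfAlgebra A] [FiniteDimensional ℂ A]

/-- The kernel of ⊓ᴸ is a left ideal, so by semisimplicity it has a right identity f. As x − ⊓ᴸ(x)
lies in the kernel, 1 − f is a left integral. -/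
theorem exists_left_integral : ∃ l : A, (∀ x, x * l = piL x * l) ∧ piL l = 1 := by
  let K : Submodule A A :=
    { carrier := {x | piL x = 0}
      add_mem' := fun {a b} ha hb => by
        change piL (a + b) = 0
        rw [← piLₗ_apply, map_add, piLₗ_apply, piLₗ_apply, ha, hb, add_zero]
      zero_mem' := by
        change piL 0 = 0
        rw [← piLₗ_apply, map_zero]
      smul_mem' := fun c x hx => by
        change piL (c * x) = 0
        rw [← piL_mul_piL, hx, mul_zero, ← piLₗ_apply, map_zero] }
  obtain ⟨f, hf, hK⟩ := exists_right_identity K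
  have hsub : ∀ x y : A, piL (x - y) = piL x - piL y := fun x y => by
    simp only [← piLₗ_apply, map_sub]
  refine ⟨1 - f, fun x => ?_, ?_⟩
  · have hx : x - piL x ∈ K := by
      change piL _ = 0
      rw [hsub, piL_of_mem (piL_mem x), sub_self]
    rw [← sub_eq_zero, ← sub_mul, mul_sub, mul_one, hK _ hx, sub_self]
  · rw [hsub, piL_one, show piL f = 0 from hf, sub_zero]

/-- Expand (1 ⊗ x)Δ(1) as S(x₍₁₎)x₍₂₎ ⊗ x₍₃₎. The integral property turns Δ(x₍₂₎p) into (⊓ᴸ(x₍₂₎) ⊗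
1)Δ(p), and S(x₍₁₎)⊓ᴸ(x₍₂₎) = S(x). -/
theorem tmul_comul_of_integral {p : A} (hp : ∀ x, x * p = piL x * p) (x : A) :
    ((1 : A) ⊗ₜ[ℂ] x) * comul (R := ℂ) p = (antipode x ⊗ₜ[ℂ] (1 : A)) * comul (R := ℂ) p := by
  obtain ⟨n, a, b, h⟩ := exists_tensor_rep (comul (R := ℂ) x)
  rw [comul_eq_Δ1_mul p, ← mul_assoc, ← sum_antipode_comul h, Finset.sum_mul,
    ← comul_eq_Δ1_mul, ← antipode_eq_sum_piL h, TensorProduct.sum_tmul, Finset.sum_mul]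
  refine Finset.sum_congr rfl fun i _ => ?_
  rw [mul_assoc, ← comul_mul, hp, comul_mul_left (piL_mem _), ← mul_assoc, tmul_mul_tmul_one]

theorem comul_tmul_of_integral {p : A} (hp : ∀ x, x * p = piL x * p) (hs : star p = p) (x : A) :
    comul (R := ℂ) p * (x ⊗ₜ[ℂ] (1 : A)) = comul (R := ℂ) p * ((1 : A) ⊗ₜ[ℂ] antipode x) := by
  have := congrArg star (tmul_comul_of_integral hp (star (antipode x : A)))
  simp only [tensor_star_mul, TensorProduct.star_tmul, star_one, star_star, ← comul_star, hs] at this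
  rw [this, star_antipode, star_star, antipodeInv_antipode]

/-- The square of the antipode is implemented by a positive invertible element. -/
theorem exists_implements : ∃ k : Aˣ, (∃ b : A, (k : A) = star b * b) ∧
    ∀ x : A, antipode (antipode x : A) = k * x * (↑k⁻¹ : A) := by
  obtain ⟨l, hl, hl1⟩ := exists_left_integral (A := A)
  have hp : ∀ x, x * (l * star l) = piL x * (l * star l) := fun x => by
    rw [← mul_assoc, hl, mul_assoc]
  have hps : star (l * star l) = l * star l := by rw [star_mul, star_star]
  obtain ⟨n, y, u, hZ, hk, -⟩ := exists_sliceR_star_mul_self (star (comul (R := ℂ) l))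
  -- With p = ll*, a self-adjoint left integral, x can be carried around Δ(p): from the first leg to
  -- the second as S(x), around the trace, and back as S²(x), so kx = S²(x)k. Positivity comes from
  -- Δ(p) = Δ(l)Δ(l)*. If kx = 0 then (x* ⊗ 1)Δ(l) = 0, and applying a ⊗ b ↦ aS(b) gives x*⊓ᴸ(l) =
  -- x* = 0, so k is invertible.
  set k : A := sliceR (tr A) (comul (R := ℂ) (l * star l)) with hkdef
  have hk' : k = ∑ i, star (y i) * y i := by
    rw [← hk, star_star, ← comul_star, ← comul_mul]
  have hkx : ∀ x : A, k * x = antipode (antipode x : A) * k := by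
    intro x
    rw [hkdef, ← sliceR_mul_right, comul_tmul_of_integral hp hps, ← sliceR_trace tr_mul_comm,
      tmul_comul_of_integral hp, sliceR_mul_left]
  have hinj : ∀ x, k * x = 0 → x = 0 := by
    intro x hx
    have h1 : ∑ i, tr A (star (y i * x) * (y i * x)) = 0 := by
      have : star x * (k * x) = ∑ i, star (y i * x) * (y i * x) := by
        rw [hk', Finset.sum_mul, Finset.mul_sum]
        exact Finset.sum_congr rfl fun i _ => by simp only [star_mul, mul_assoc]
      rw [← map_sum, ← this, hx, mul_zero, map_zero]
    have h2 : ∀ i, y i * x = 0 := fun i => tr_faithful.eq_zero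
      ((Finset.sum_eq_zero_iff_of_nonneg fun i _ => tr_faithful.nonneg (y i * x)).1 h1 i
        (Finset.mem_univ i))
    have h3 : (star x ⊗ₜ[ℂ] (1 : A)) * comul (R := ℂ) l = 0 := by
      rw [← star_star (comul (R := ℂ) l), hZ, star_sum, Finset.mul_sum]
      refine Finset.sum_eq_zero fun i _ => ?_
      rw [TensorProduct.star_tmul, Algebra.TensorProduct.tmul_mul_tmul, ← star_mul, h2, star_zero,
        TensorProduct.zero_tmul]
    have h4 := congrArg (fun t => LinearMap.mul' ℂ A (antipode.lTensor A t)) h3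
    simp only [lTensor_mul_left, mul'_left, mul_antipode_eq, hl1, mul_one, map_zero] at h4
    exact star_eq_zero.1 h4
  obtain ⟨v, hv⟩ := LinearMap.surjective_of_injective (f := LinearMap.mulLeft ℂ k)
    ((injective_iff_map_eq_zero _).2 hinj) 1
  have hv1 : k * v = 1 := hv
  have hv2 : v * k = 1 := by
    rw [← sub_eq_zero]
    apply hinj
    rw [mul_sub, ← mul_assoc, hv1, one_mul, mul_one, sub_self]
  refine ⟨⟨k, v, hv1, hv2⟩, ?_, fun x => ?_⟩
  · refine exists_star_mul_self_of_forall_mem (N := ⊤) tr_faithful (fun x _ => trivial) trivial ?_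
      fun m _ => ?_
    · change star k = k
      rw [hk', star_sum]
      exact Finset.sum_congr rfl fun i _ => by rw [star_mul, star_star]
    · change 0 ≤ tr A (star m * k * m)
      rw [hk', Finset.mul_sum, Finset.sum_mul, map_sum]
      refine Finset.sum_nonneg fun i _ => ?_
      rw [show star m * (star (y i) * y i) * m = star (y i * m) * (y i * m) by
        simp only [star_mul, mul_assoc]]
      exact tr_faithful.nonneg _
  · change _ = k * x * v
    rw [hkx, mul_assoc, hv1, mul_one]

end Integral

/-! ### Slices that produce central elements -/

section Central

open Coalgebra CStarWeakHopfAlgebra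

variable {A : Type*} [CStarAlgebra A] [CStarWeakHopfAlgebra A] [FiniteDimensional ℂ A]
  {g : Aˣ}

theorem inv_mul_antipode (hg : ∀ x : A, antipode (antipode x : A) = g * x * (↑g⁻¹ : A)) (x : A) :
    (↑g⁻¹ : A) * antipode x = antipodeInv x * (↑g⁻¹ : A) := by
  have := hg (antipodeInv x)
  rw [antipode_antipodeInv] at this
  rw [this, ← mul_assoc, ← mul_assoc, Units.inv_mul, one_mul]

theorem antipode_mul_metric (hg : ∀ x : A, antipode (antipode x : A) = g * x * (↑g⁻¹ : A)) (x : A) :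
    antipode x * (g : A) = g * antipodeInv x := by
  have := hg (antipodeInv x)
  rw [antipode_antipodeInv] at this
  rw [this, mul_assoc, Units.inv_mul, mul_one]

/-- The left slice by the trace, twisted by `g⁻¹`, of a tensor which commutes with `Δ(A)`. -/
theorem sliceL_mem_center (hg : ∀ x : A, antipode (antipode x : A) = g * x * (↑g⁻¹ : A))
    {T : A ⊗[ℂ] A} (h1 : Δ1 A * T = T) (h2 : T * Δ1 A = T)
    (hT : ∀ x : A, T * comul (R := ℂ) x = comul (R := ℂ) x * T) :
    sliceL (tr A) (((↑g⁻¹ : A) ⊗ₜ[ℂ] (1 : A)) * T) ∈ Subalgebra.center ℂ A := by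
  rw [Subalgebra.mem_center_iff]
  intro x
  obtain ⟨n, a, b, h⟩ := exists_tensor_rep (comul (R := ℂ) x)
  -- A factor x on the second leg is spread out as S(x₍₁₎) and Δ(x₍₂₎) on the left of T, or as
  -- S⁻¹(x₍₁₎) and Δ(x₍₂₎) on its right. The two agree under the trace of the first leg because T
  -- commutes with Δ(A) and g⁻¹S(y) = S⁻¹(y)g⁻¹.
  have e1 : ((1 : A) ⊗ₜ[ℂ] x) * T =
      ∑ i, (antipode (a i) ⊗ₜ[ℂ] (1 : A)) * (T * comul (R := ℂ) (b i)) := by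
    rw [← h1, ← mul_assoc, ← sum_antipode_comul h, Finset.sum_mul, h1]
    exact Finset.sum_congr rfl fun i _ => by rw [mul_assoc, hT]
  have e2 : T * ((1 : A) ⊗ₜ[ℂ] x) =
      ∑ i, T * (comul (R := ℂ) (b i) * (antipodeInv (a i) ⊗ₜ[ℂ] (1 : A))) := by
    conv_lhs => rw [← h2]
    rw [mul_assoc, ← sum_comul_antipodeInv h, Finset.mul_sum]
  have hc : ∀ y z : A, (y ⊗ₜ[ℂ] (1 : A)) * ((1 : A) ⊗ₜ[ℂ] z) =
      ((1 : A) ⊗ₜ[ℂ] z) * (y ⊗ₜ[ℂ] (1 : A)) := fun y z => by simp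
  rw [← sliceL_mul_left, ← sliceL_mul_right, ← mul_assoc, ← hc, mul_assoc, e1, mul_assoc, e2,
    Finset.mul_sum, Finset.mul_sum, map_sum, map_sum]
  refine Finset.sum_congr rfl fun i _ => ?_
  rw [← mul_assoc, tmul_mul_tmul_one, sliceL_trace tr_mul_comm, inv_mul_antipode hg,
    sliceL_trace tr_mul_comm, ← tmul_mul_tmul_one]
  simp only [mul_assoc]

/-- The right slice by the trace, twisted by `g`, of a tensor which commutes with `Δ(A)`. -/
theorem sliceR_mem_center (hg : ∀ x : A, antipode (antipode x : A) = g * x * (↑g⁻¹ : A))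
    {T : A ⊗[ℂ] A} (h1 : Δ1 A * T = T) (h2 : T * Δ1 A = T)
    (hT : ∀ x : A, T * comul (R := ℂ) x = comul (R := ℂ) x * T) :
    sliceR (tr A) (((1 : A) ⊗ₜ[ℂ] (g : A)) * T) ∈ Subalgebra.center ℂ A := by
  rw [Subalgebra.mem_center_iff]
  intro x
  obtain ⟨n, a, b, h⟩ := exists_tensor_rep (comul (R := ℂ) x)
  have e1 : (x ⊗ₜ[ℂ] (1 : A)) * T =
      ∑ i, ((1 : A) ⊗ₜ[ℂ] antipodeInv (b i)) * (comul (R := ℂ) (a i) * T) := by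
    rw [← h1, ← mul_assoc, ← sum_antipodeInv_comul h, Finset.sum_mul, h1]
    exact Finset.sum_congr rfl fun i _ => by rw [mul_assoc]
  have e2 : T * (x ⊗ₜ[ℂ] (1 : A)) =
      ∑ i, (comul (R := ℂ) (a i) * T) * ((1 : A) ⊗ₜ[ℂ] antipode (b i)) := by
    conv_lhs => rw [← h2]
    rw [mul_assoc, ← sum_comul_antipode h, Finset.mul_sum]
    exact Finset.sum_congr rfl fun i _ => by rw [← mul_assoc, hT]
  have hc : ∀ y z : A, (y ⊗ₜ[ℂ] (1 : A)) * ((1 : A) ⊗ₜ[ℂ] z) =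
      ((1 : A) ⊗ₜ[ℂ] z) * (y ⊗ₜ[ℂ] (1 : A)) := fun y z => by simp
  rw [← sliceR_mul_left, ← sliceR_mul_right, ← mul_assoc, hc, mul_assoc, e1, mul_assoc, e2,
    Finset.mul_sum, Finset.mul_sum, map_sum, map_sum]
  refine Finset.sum_congr rfl fun i _ => ?_
  rw [← mul_assoc, one_tmul_mul_one_tmul, ← antipode_mul_metric hg, ← one_tmul_mul_one_tmul,
    mul_assoc, sliceR_trace tr_mul_comm, mul_assoc]

end Central

/-! ### The regular trace on sectors -/

section Characters

variable {A : Type*} [CStarAlgebra A] [FiniteDimensional ℂ A]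

theorem elt_mem_center {C : Subalgebra ℂ A} (e : MinCentralIdem C) :
    e.elt ∈ Subalgebra.center ℂ A := e.2.central

theorem nonneg_of_mul_nonneg_of_pos {c r : ℂ} (h : 0 ≤ c * r) (hr : 0 < r) : 0 ≤ c := by
  obtain ⟨h1, h2⟩ := Complex.lt_def.1 hr
  obtain ⟨h3, h4⟩ := Complex.le_def.1 h
  simp only [Complex.zero_re, Complex.zero_im, Complex.mul_re, Complex.mul_im] at h1 h2 h3 h4
  simp only [← h2, mul_zero, sub_zero, zero_add] at h3 h4
  refine Complex.le_def.2 ⟨nonneg_of_mul_nonneg_left h3 h1, ?_⟩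
  exact ((mul_eq_zero.1 h4.symm).resolve_right h1.ne').symm

theorem pos_of_mul_pos_of_pos {c r : ℂ} (h : 0 < c * r) (hr : 0 < r) : 0 < c := by
  refine lt_of_le_of_ne (nonneg_of_mul_nonneg_of_pos h.le hr) ?_
  rintro rfl
  exact absurd h (by simp)

theorem exists_unit_of_star_mul_self {g : Aˣ} (hg : ∃ b : A, (g : A) = star b * b) :
    ∃ b : Aˣ, (g : A) = star (b : A) * b := by
  obtain ⟨b, hb⟩ := hg
  have h1 : ((↑g⁻¹ : A) * star b) * b = 1 := by rw [mul_assoc, ← hb, Units.inv_mul]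
  have hinj : Function.Injective (LinearMap.mulLeft ℂ b) := by
    rw [injective_iff_map_eq_zero]
    intro x (hx : b * x = 0)
    rw [← one_mul x, ← h1, mul_assoc, hx, mul_zero]
  obtain ⟨v, hv⟩ := LinearMap.surjective_of_injective hinj 1
  have hv1 : b * v = 1 := hv
  have hv2 : v = (↑g⁻¹ : A) * star b := by
    rw [← one_mul v, ← h1, mul_assoc, hv1, mul_one]
  exact ⟨⟨b, v, hv1, hv2 ▸ h1⟩, hb⟩

theorem mul_elt_eq_zero_or {z : A} (hc : z ∈ Subalgebra.center ℂ A) (hi : z * z = z)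
    (q : Sector A) : z * q.elt = 0 ∨ z * q.elt = q.elt := by
  have hcomm := Subalgebra.mem_center_iff.1 hc
  refine q.2.minimal _ trivial (Subalgebra.mul_mem _ hc q.2.central) ?_ ?_
  · rw [mul_assoc, ← mul_assoc q.elt, hcomm, mul_assoc z, q.idem, ← mul_assoc, hi]
  · change z * q.elt * q.elt = z * q.elt
    rw [mul_assoc, q.idem]

theorem eq_of_mul_elt_eq {x y : A} (h : ∀ q : Sector A, x * q.elt = y * q.elt) : x = y := by
  have := sum_elt (⊤ : Subalgebra ℂ A)
  rw [← mul_one x, ← mul_one y, ← this, Finset.mul_sum, Finset.mul_sum]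
  exact Finset.sum_congr rfl fun q _ => h q

theorem exists_mul_elt_ne_zero {x : A} (h : x ≠ 0) : ∃ q : Sector A, x * q.elt ≠ 0 := by
  by_contra! hq
  exact h (eq_of_mul_elt_eq fun q => by rw [hq, zero_mul])

theorem trace_mul_elt {σ : A →ₗ[ℂ] ℂ} (hσ : ∀ a b, σ (a * b) = σ (b * a)) (q : Sector A) (x : A) :
    σ (x * q.elt) = σ (prim q) * modTr (irrep q) x := by
  rw [trace_eq_sum hσ, Finset.sum_eq_single q]
  · rw [modTr_irrep_mul_elt]
  · intro p _ hp
    rw [modTr_irrep_mul_elt_ne hp, mul_zero]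
  · exact fun h => absurd (Finset.mem_univ q) h

theorem tr_mul_elt (q : Sector A) (x : A) :
    tr A (x * q.elt) = (mult q A : ℂ) * modTr (irrep q) x := by
  rw [trace_mul_elt tr_mul_comm, mult_eq_modTr q A]; rfl

theorem tr_pos_of_mul_star {x : A} (hx : x ≠ 0) : 0 < tr A (x * star x) := by
  rw [tr_mul_comm]; exact tr_faithful.pos x hx

theorem elt_ne_zero {C : Subalgebra ℂ A} (e : MinCentralIdem C) : e.elt ≠ 0 := e.2.ne_zero

theorem tr_elt_pos {C : Subalgebra ℂ A} (e : MinCentralIdem C) : 0 < tr A e.elt := by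
  have := tr_faithful.pos e.elt e.2.ne_zero
  rwa [star_elt, e.idem] at this

theorem mult_self_pos (q : Sector A) : 0 < mult q A := by
  rw [Nat.pos_iff_ne_zero]
  intro h
  have := tr_elt_pos q
  rw [← one_mul q.elt, tr_mul_elt, h, Nat.cast_zero, zero_mul] at this
  exact this.false

theorem tr_mul_star_elt_pos (b : Aˣ) (q : Sector A) :
    0 < tr A ((b : A) * star (b : A) * q.elt) ∧
      (b : A) * star (b : A) * q.elt = (b * q.elt) * star (b * q.elt) := by
  have h : (b : A) * star (b : A) * q.elt = (b * q.elt) * star (b * q.elt) := by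
    rw [star_mul, star_elt, mul_assoc, mul_assoc, ← mul_assoc q.elt, q.idem, q.comm]
  refine ⟨?_, h⟩
  rw [h]
  refine tr_pos_of_mul_star fun h0 => q.2.ne_zero ?_
  change q.elt = 0
  rw [← one_mul q.elt, ← Units.inv_mul b, mul_assoc, h0, mul_zero]

end Characters

/-! ### Vacua, and the left and right dimensions attached to a metric -/

section Vacua

open Coalgebra CStarWeakHopfAlgebra

variable {A : Type*} [CStarAlgebra A] [CStarWeakHopfAlgebra A] [FiniteDimensional ℂ A]

theorem biTr_antipode (x y : A) : biTr (antipode x : A) (antipode y) = biTr y x := by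
  let e : A ≃ₗ[ℂ] A := LinearEquiv.ofLinearMap antipode antipodeInv
    (LinearMap.ext antipode_antipodeInv) (LinearMap.ext antipodeInv_antipode)
  rw [biTr, biTr, ← LinearMap.trace_conj' (LinearMap.mulLeft ℂ y ∘ₗ _) e]
  congr 1
  refine LinearMap.ext fun a => Eq.symm ?_
  obtain ⟨b, rfl⟩ := e.surjective a
  rw [LinearEquiv.conj_apply_apply, e.symm_apply_apply]
  change antipode (y * (b * x)) = (antipode x : A) * (antipode b * antipode y)
  rw [antipode_mul_rev, antipode_mul_rev, mul_assoc]

/-- Conjugation by S turns left into right multiplication, and both have the same trace by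
`biTr_comm`. -/
theorem tr_antipode (x : A) : tr A (antipode x) = tr A x := by
  rw [← biTr_one, ← antipode_one, biTr_antipode, biTr_comm, biTr_one]

namespace Vac

theorem zL_mem (μ : Vac A) : μ.zL ∈ leftSub A := μ.2.mem
theorem zL_mem_center (μ : Vac A) : μ.zL ∈ Subalgebra.center ℂ A := μ.2.central
theorem zL_idem (μ : Vac A) : μ.zL * μ.zL = μ.zL := μ.2.idem
theorem zL_comm (μ : Vac A) (x : A) : x * μ.zL = μ.zL * x :=
  Subalgebra.mem_center_iff.1 μ.zL_mem_center x
theorem zR_mem (μ : Vac A) : μ.zR ∈ rightSub A := antipode_mem_rightSub μ.zL_mem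
theorem zR_mem_center (μ : Vac A) : μ.zR ∈ Subalgebra.center ℂ A := antipode_mem_center μ.zL_mem_center
theorem zR_comm (μ : Vac A) (x : A) : x * μ.zR = μ.zR * x :=
  Subalgebra.mem_center_iff.1 μ.zR_mem_center x
theorem zR_idem (μ : Vac A) : μ.zR * μ.zR = μ.zR := by
  rw [zR, ← antipode_mul_rev, zL_idem]
theorem antipode_zR (μ : Vac A) : antipode μ.zR = μ.zL :=
  antipode_antipode_of_central μ.zL_mem μ.zL_mem_center
theorem zR_ne_zero (μ : Vac A) : μ.zR ≠ 0 := fun h => μ.2.ne_zero (by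
  change μ.zL = 0
  rw [← μ.antipode_zR, h, map_zero])
theorem zL_mul_of_ne {μ ν : Vac A} (h : μ ≠ ν) : μ.zL * ν.zL = 0 := MinCentralIdem.mul_eq_zero μ ν h
theorem zR_mul_of_ne {μ ν : Vac A} (h : μ ≠ ν) : μ.zR * ν.zR = 0 := by
  rw [zR, zR, ← antipode_mul_rev, zL_mul_of_ne h.symm, map_zero]
theorem sum_zL : ∑ μ : Vac A, μ.zL = 1 := sum_elt (leftSub A)
theorem sum_zR : ∑ μ : Vac A, μ.zR = 1 := by
  simp only [zR]
  rw [← map_sum, sum_zL, antipode_one]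

end Vac

theorem exists_isLeftVac (q : Sector A) : ∃ μ, IsLeftVac q μ := by
  by_contra! h
  refine q.2.ne_zero ?_
  change q.elt = 0
  rw [← one_mul q.elt, ← Vac.sum_zL, Finset.sum_mul]
  exact Finset.sum_eq_zero fun μ _ =>
    (mul_elt_eq_zero_or μ.zL_mem_center μ.zL_idem q).resolve_right (h μ)

theorem exists_isRightVac (q : Sector A) : ∃ μ, IsRightVac q μ := by
  by_contra! h
  refine q.2.ne_zero ?_
  change q.elt = 0
  rw [← one_mul q.elt, ← Vac.sum_zR, Finset.sum_mul]
  refine Finset.sum_eq_zero fun μ _ =>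
    (mul_elt_eq_zero_or μ.zR_mem_center μ.zR_idem q).resolve_right fun h' => h μ ?_
  rw [IsRightVac, μ.zR_comm, h']

/-- The left vacuum of a sector. -/
noncomputable def leftVac (q : Sector A) : Vac A := (exists_isLeftVac q).choose

/-- The right vacuum of a sector. -/
noncomputable def rightVac (q : Sector A) : Vac A := (exists_isRightVac q).choose

theorem zL_leftVac_mul (q : Sector A) : (leftVac q).zL * q.elt = q.elt :=
  (exists_isLeftVac q).choose_spec

theorem zR_rightVac_mul (q : Sector A) : (rightVac q).zR * q.elt = q.elt := by
  rw [← Vac.zR_comm]; exact (exists_isRightVac q).choose_spec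

theorem zL_mul_elt_of_ne {q : Sector A} {μ : Vac A} (h : μ ≠ leftVac q) : μ.zL * q.elt = 0 := by
  rw [← zL_leftVac_mul, ← mul_assoc, Vac.zL_mul_of_ne h, zero_mul]

theorem zR_mul_elt_of_ne {q : Sector A} {μ : Vac A} (h : μ ≠ rightVac q) : μ.zR * q.elt = 0 := by
  rw [← zR_rightVac_mul, ← mul_assoc, Vac.zR_mul_of_ne h, zero_mul]

theorem isLeftVac_iff {q : Sector A} {μ : Vac A} : IsLeftVac q μ ↔ leftVac q = μ := by
  refine ⟨fun h => ?_, fun h => h ▸ zL_leftVac_mul q⟩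
  by_contra hne
  exact q.2.ne_zero (h.symm.trans (zL_mul_elt_of_ne (Ne.symm hne)))

theorem isRightVac_iff {q : Sector A} {μ : Vac A} : IsRightVac q μ ↔ rightVac q = μ := by
  refine ⟨fun h => ?_, fun h => ?_⟩
  · by_contra hne
    exact q.2.ne_zero (h.symm.trans (by rw [Vac.zR_comm]; exact zR_mul_elt_of_ne (Ne.symm hne)))
  · rw [IsRightVac, Vac.zR_comm, ← h, zR_rightVac_mul]

theorem exists_rightVac_eq (μ : Vac A) : ∃ q : Sector A, rightVac q = μ := by
  obtain ⟨q, hq⟩ := exists_mul_elt_ne_zero μ.zR_ne_zero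
  refine ⟨q, ?_⟩
  by_contra h
  exact hq (zR_mul_elt_of_ne (Ne.symm h))

theorem sliceL_Δ1_mem (f : A →ₗ[ℂ] ℂ) (x : A) :
    sliceL f ((x ⊗ₜ[ℂ] (1 : A)) * Δ1 A) ∈ leftSub A := by
  obtain ⟨n, r, l, -, hl, h⟩ := exists_Δ1_rep (A := A)
  rw [h, Finset.mul_sum, map_sum]
  refine Subalgebra.sum_mem _ fun i _ => ?_
  simpa using Subalgebra.smul_mem _ (hl i) _

theorem sliceR_Δ1_mem (f : A →ₗ[ℂ] ℂ) (x : A) :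
    sliceR f (((1 : A) ⊗ₜ[ℂ] x) * Δ1 A) ∈ rightSub A := by
  obtain ⟨n, r, l, hr, -, h⟩ := exists_Δ1_rep (A := A)
  rw [h, Finset.mul_sum, map_sum]
  refine Subalgebra.sum_mem _ fun i _ => ?_
  simpa using Subalgebra.smul_mem _ (hr i) _

theorem counit_sliceL (f : A →ₗ[ℂ] ℂ) (x : A) :
    counit (R := ℂ) (sliceL f ((x ⊗ₜ[ℂ] (1 : A)) * Δ1 A)) = f x := by
  obtain ⟨n, a, b, h⟩ := exists_tensor_rep (Δ1 A)
  have := sum_counit_right h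
  conv_rhs => rw [← mul_one x, ← this]
  rw [h]
  simp [Finset.mul_sum, mul_comm]

theorem counit_sliceR (f : A →ₗ[ℂ] ℂ) (x : A) :
    counit (R := ℂ) (sliceR f (((1 : A) ⊗ₜ[ℂ] x) * Δ1 A)) = f x := by
  obtain ⟨n, a, b, h⟩ := exists_tensor_rep (Δ1 A)
  have := sum_counit_left h
  conv_rhs => rw [← mul_one x, ← this]
  rw [h]
  simp [Finset.mul_sum, mul_comm]

theorem tmul_Δ1_comm {e : A} (he : e ∈ Subalgebra.center ℂ A) (x : A) :
    ((e ⊗ₜ[ℂ] (1 : A)) * Δ1 A) * comul (R := ℂ) x =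
      comul (R := ℂ) x * ((e ⊗ₜ[ℂ] (1 : A)) * Δ1 A) := by
  rw [mul_assoc, ← comul_eq_Δ1_mul, central_tmul_comm he (Subalgebra.one_mem _),
    central_tmul_comm he (Subalgebra.one_mem _), ← mul_assoc, ← comul_eq_mul_Δ1]

theorem one_tmul_Δ1_comm {e : A} (he : e ∈ Subalgebra.center ℂ A) (x : A) :
    (((1 : A) ⊗ₜ[ℂ] e) * Δ1 A) * comul (R := ℂ) x =
      comul (R := ℂ) x * (((1 : A) ⊗ₜ[ℂ] e) * Δ1 A) := by
  rw [mul_assoc, ← comul_eq_Δ1_mul, central_tmul_comm (Subalgebra.one_mem _) he,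
    central_tmul_comm (Subalgebra.one_mem _) he, ← mul_assoc, ← comul_eq_mul_Δ1]

variable {g : Aˣ}

/-- The slice X is central, lies in A^L and is supported by z^L of the right vacuum, so minimality
makes it a multiple of that projection. The multiple is nonnegative because tr(X) is tr ⊗ tr of a
positive tensor, and nonzero because ε(X) = tr(g⁻¹e_q) > 0. -/
theorem exists_dimL (hp : ∃ b : A, (g : A) = star b * b)
    (hg : ∀ x : A, antipode (antipode x : A) = g * x * (↑g⁻¹ : A)) (q : Sector A) :
    ∃ D : ℝ, 0 < D ∧ sliceL (tr A) (((↑g⁻¹ * q.elt : A) ⊗ₜ[ℂ] (1 : A)) * Δ1 A) =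
      (D : ℂ) • (rightVac q).zL ∧
      tr A (↑g⁻¹ * q.elt) = D * counit (R := ℂ) (rightVac q).zL ∧ 0 < tr A (↑g⁻¹ * q.elt) := by
  obtain ⟨b, hb⟩ := exists_unit_of_star_mul_self hp
  have hginv : (↑g⁻¹ : A) = (↑b⁻¹ : A) * star (↑b⁻¹ : A) := by
    rw [← Units.mul_right_inj g, Units.mul_inv, hb, mul_assoc, ← mul_assoc (b : A), Units.mul_inv,
      one_mul, ← star_mul, Units.inv_mul, star_one]
  obtain ⟨hpos, hsq⟩ := tr_mul_star_elt_pos b⁻¹ q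
  rw [← hginv] at hpos hsq
  set X := sliceL (tr A) (((↑g⁻¹ * q.elt : A) ⊗ₜ[ℂ] (1 : A)) * Δ1 A) with hX
  have hXc : X ∈ Subalgebra.center ℂ A := by
    have := sliceL_mem_center (T := (q.elt ⊗ₜ[ℂ] (1 : A)) * Δ1 A) hg ?_ ?_
      (tmul_Δ1_comm (elt_mem_center q))
    · rwa [← mul_assoc, tmul_mul_tmul_one] at this
    · rw [← mul_assoc, ← central_tmul_comm (elt_mem_center q) (Subalgebra.one_mem _), mul_assoc,
        Δ1_mul_Δ1]
    · rw [mul_assoc, Δ1_mul_Δ1]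
  have hz : ((rightVac q).zR ⊗ₜ[ℂ] (1 : A)) * Δ1 A = ((1 : A) ⊗ₜ[ℂ] (rightVac q).zL) * Δ1 A :=
    antipode_tmul_Δ1 (Vac.zL_mem _) (Vac.zL_mem_center _)
  have hXz : X * (rightVac q).zL = X := by
    rw [Vac.zL_comm, hX, ← sliceL_mul_left, ← mul_assoc, one_tmul_mul_tmul_one,
      ← tmul_one_mul_one_tmul, mul_assoc, ← hz, ← mul_assoc, tmul_mul_tmul_one, mul_assoc,
      Vac.zR_comm, zR_rightVac_mul]
  have hXm : X ∈ leftSub A := by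
    rw [hX]
    exact sliceL_Δ1_mem _ _
  clear_value X
  obtain ⟨c, hc⟩ : ∃ c : ℂ, X = c • (rightVac q).zL := by
    obtain ⟨c, hc⟩ := exists_mul_elt_eq_smul hXm hXc (rightVac q)
    exact ⟨c, hXz.symm.trans hc⟩
  have h1 : 0 ≤ tr A X := by
    rw [hX, apply_sliceL]
    have := pairing_star_mul_self_nonneg (Δ1 A * ((↑b⁻¹ * q.elt : A) ⊗ₜ[ℂ] (1 : A)))
    rw [tensor_star_mul, star_Δ1, TensorProduct.star_tmul, star_one, mul_assoc, ← mul_assoc (Δ1 A),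
      Δ1_mul_Δ1, pairing_trace tr_mul_comm tr_mul_comm, mul_assoc, tmul_mul_tmul_one,
      pairing_trace tr_mul_comm tr_mul_comm, ← hsq] at this
    exact this
  have h2 : tr A (↑g⁻¹ * q.elt) = c * counit (R := ℂ) (rightVac q).zL := by
    rw [← counit_sliceL (tr A), ← hX, hc, map_smul, smul_eq_mul]
  have h3 : 0 < tr A (rightVac q).zL := tr_elt_pos (rightVac q)
  rw [hc, map_smul, smul_eq_mul] at h1
  have h4 : 0 ≤ c := nonneg_of_mul_nonneg_of_pos h1 h3
  have h5 : c ≠ 0 := by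
    rintro rfl
    rw [h2, zero_mul] at hpos
    exact hpos.false
  have h6 : c = (c.re : ℂ) := Complex.eq_re_of_ofReal_le h4
  refine ⟨c.re, ?_, by rw [← h6, ← hc], by rw [← h6, ← h2], hpos⟩
  have := lt_of_le_of_ne h4 (Ne.symm h5)
  exact (Complex.lt_def.1 this).1

theorem exists_dimR (hp : ∃ b : A, (g : A) = star b * b)
    (hg : ∀ x : A, antipode (antipode x : A) = g * x * (↑g⁻¹ : A)) (q : Sector A) :
    ∃ D : ℝ, 0 < D ∧ sliceR (tr A) (((1 : A) ⊗ₜ[ℂ] (g * q.elt : A)) * Δ1 A) =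
      (D : ℂ) • (leftVac q).zR ∧
      tr A (g * q.elt) = D * counit (R := ℂ) (leftVac q).zL ∧ 0 < tr A (g * q.elt) := by
  obtain ⟨b, hb⟩ := exists_unit_of_star_mul_self hp
  obtain ⟨hpos, hsq⟩ := tr_mul_star_elt_pos (star b) q
  rw [Units.coe_star, star_star, ← hb] at hpos hsq
  set X := sliceR (tr A) (((1 : A) ⊗ₜ[ℂ] (g * q.elt : A)) * Δ1 A) with hX
  have hXc : X ∈ Subalgebra.center ℂ A := by
    have := sliceR_mem_center (T := ((1 : A) ⊗ₜ[ℂ] q.elt) * Δ1 A) hg ?_ ?_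
      (one_tmul_Δ1_comm (elt_mem_center q))
    · rwa [← mul_assoc, one_tmul_mul_one_tmul] at this
    · rw [← mul_assoc, ← central_tmul_comm (Subalgebra.one_mem _) (elt_mem_center q), mul_assoc,
        Δ1_mul_Δ1]
    · rw [mul_assoc, Δ1_mul_Δ1]
  have hXz : X * (leftVac q).zR = X := by
    rw [Vac.zR_comm, hX, ← sliceR_mul_left, ← mul_assoc, tmul_one_mul_one_tmul,
      ← one_tmul_mul_tmul_one, mul_assoc, Vac.zR, antipode_tmul_Δ1 (Vac.zL_mem _) (Vac.zL_mem_center _),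
      ← mul_assoc, one_tmul_mul_one_tmul, mul_assoc, Vac.zL_comm, zL_leftVac_mul]
  -- X lies in A^R; applying S brings it to A^L, where the minimality of z^L can be used.
  have hSX : antipode X ∈ leftSub A := antipode_mem_leftSub (sliceR_Δ1_mem (tr A) (g * q.elt))
  obtain ⟨c, hc⟩ := exists_mul_elt_eq_smul hSX (antipode_mem_center hXc) (leftVac q)
  replace hc : X = c • (leftVac q).zR := by
    apply antipode_injective
    rw [map_smul, Vac.antipode_zR, ← hXz, antipode_mul_rev, Vac.antipode_zR, ← Vac.zL_comm]
    exact hc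
  have h1 : 0 ≤ tr A X := by
    rw [apply_sliceR]
    have := pairing_star_mul_self_nonneg (Δ1 A * ((1 : A) ⊗ₜ[ℂ] (star b * q.elt : A)))
    rw [tensor_star_mul, star_Δ1, TensorProduct.star_tmul, star_one, mul_assoc, ← mul_assoc (Δ1 A),
      Δ1_mul_Δ1, pairing_trace tr_mul_comm tr_mul_comm, mul_assoc, one_tmul_mul_one_tmul,
      pairing_trace tr_mul_comm tr_mul_comm, Units.coe_star, ← hsq] at this
    exact this
  have h2 : tr A (g * q.elt) = c * counit (R := ℂ) (leftVac q).zL := by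
    rw [← counit_sliceR (tr A), ← hX, hc, map_smul, smul_eq_mul, Vac.zR, counit_antipode]
  have h3 : 0 < tr A (leftVac q).zR := by
    rw [Vac.zR, tr_antipode]; exact tr_elt_pos (leftVac q)
  rw [hc, map_smul, smul_eq_mul] at h1
  have h4 : 0 ≤ c := nonneg_of_mul_nonneg_of_pos h1 h3
  have h5 : c ≠ 0 := by
    rintro rfl
    rw [h2, zero_mul] at hpos
    exact hpos.false
  have h6 : c = (c.re : ℂ) := Complex.eq_re_of_ofReal_le h4
  refine ⟨c.re, ?_, by rw [← h6]; exact hc, by rw [← h6]; exact h2, hpos⟩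
  have := lt_of_le_of_ne h4 (Ne.symm h5)
  exact (Complex.lt_def.1 this).1

/-- Every vacuum is the right vacuum of some sector q, and there D ε(z^L) = tr(g⁻¹e_q) > 0 with D >
0. -/
theorem counit_zL_pos (μ : Vac A) : 0 < counit (R := ℂ) μ.zL := by
  obtain ⟨k, hp, hk⟩ := exists_implements (A := A)
  obtain ⟨q, rfl⟩ := exists_rightVac_eq μ
  obtain ⟨D, hD, -, h1, h2⟩ := exists_dimL hp hk q
  rw [h1] at h2
  rw [mul_comm] at h2
  exact pos_of_mul_pos_of_pos h2 (by exact_mod_cast hD)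

end Vacua

/-! ### Combinations of minimal central idempotents -/

section Diag

variable {A : Type*} [CStarAlgebra A] [FiniteDimensional ℂ A] {C : Subalgebra ℂ A}

/-- The combination of minimal central idempotents with given coefficients. -/
noncomputable def diag (c : MinCentralIdem C → ℂ) : A := ∑ e, c e • e.elt

theorem diag_mul_elt (c : MinCentralIdem C → ℂ) (e : MinCentralIdem C) :
    diag c * e.elt = c e • e.elt := sum_smul_elt_mul_elt c e

theorem diag_mem (c : MinCentralIdem C → ℂ) : diag c ∈ C :=
  Subalgebra.sum_mem _ fun e _ => Subalgebra.smul_mem _ e.2.mem _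

theorem diag_mem_center (c : MinCentralIdem C → ℂ) : diag c ∈ Subalgebra.center ℂ A :=
  Subalgebra.sum_mem _ fun e _ => Subalgebra.smul_mem _ e.2.central _

theorem diag_comm (c : MinCentralIdem C → ℂ) (x : A) : x * diag c = diag c * x :=
  Subalgebra.mem_center_iff.1 (diag_mem_center c) x

theorem diag_mul_diag (c d : MinCentralIdem C → ℂ) : diag c * diag d = diag (fun e => c e * d e) := by
  conv_lhs => enter [2]; rw [diag]
  rw [Finset.mul_sum]
  refine Finset.sum_congr rfl fun e _ => ?_
  rw [mul_smul_comm, diag_mul_elt, smul_smul, mul_comm]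

theorem diag_one : diag (fun _ : MinCentralIdem C => 1) = 1 := by
  rw [diag]; simp only [one_smul]; exact sum_elt C

theorem star_diag (c : MinCentralIdem C → ℂ) : star (diag c) = diag (fun e => star (c e)) := by
  rw [diag, star_sum]
  exact Finset.sum_congr rfl fun e _ => by rw [star_smul, star_elt]

theorem diag_mul_inv {c : MinCentralIdem C → ℂ} (h : ∀ e, c e ≠ 0) :
    diag c * diag (fun e => (c e)⁻¹) = 1 := by
  rw [diag_mul_diag]
  simp only [mul_inv_cancel₀ (h _)]
  exact diag_one

/-- Traces do not distinguish elements with the same central component. -/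
theorem trace_eq_of_tr_elt {σ : A →ₗ[ℂ] ℂ} (hσ : ∀ a b, σ (a * b) = σ (b * a)) {x y : A}
    (h : ∀ q : Sector A, tr A (x * q.elt) = tr A (y * q.elt)) : σ x = σ y := by
  rw [trace_eq_sum hσ, trace_eq_sum hσ y]
  refine Finset.sum_congr rfl fun q _ => ?_
  have := h q
  rw [tr_mul_elt, tr_mul_elt] at this
  rw [mul_left_cancel₀ (Nat.cast_ne_zero.2 (mult_self_pos q).ne') this]

end Diag

/-! ### Balanced implementations of S² -/

section Balanced

open Coalgebra CStarWeakHopfAlgebra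

variable {A : Type*} [CStarAlgebra A] [CStarWeakHopfAlgebra A] [FiniteDimensional ℂ A]

/-- `g` implements `S²`, and its left and right dimensions agree. -/
structure IsBalanced (g : Aˣ) (D : Sector A → ℝ) : Prop where
  pos : ∃ b : A, (g : A) = star b * b
  implements : ∀ x : A, antipode (antipode x : A) = g * x * (↑g⁻¹ : A)
  dim_pos : ∀ q, 0 < D q
  left : ∀ q, sliceL (tr A) (((↑g⁻¹ * q.elt : A) ⊗ₜ[ℂ] (1 : A)) * Δ1 A) =
    (D q : ℂ) • (rightVac q).zL
  right : ∀ q, sliceR (tr A) (((1 : A) ⊗ₜ[ℂ] (g * q.elt : A)) * Δ1 A) =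
    (D q : ℂ) • (leftVac q).zR

/-- Multiplying k by r_q > 0 on the sector q divides the left dimension by r_q and multiplies the
right one by r_q. They become equal for r_q² = DL_q / DR_q. -/
theorem exists_isBalanced : ∃ (g : Aˣ) (D : Sector A → ℝ), IsBalanced g D := by
  obtain ⟨k, ⟨b, hb⟩, hk⟩ := exists_implements (A := A)
  choose DL hDL hL _ _ using exists_dimL ⟨b, hb⟩ hk
  choose DR hDR hR _ _ using exists_dimR ⟨b, hb⟩ hk
  let r : Sector A → ℝ := fun q => Real.sqrt (DL q / DR q)
  have hr : ∀ q, 0 < r q := fun q => Real.sqrt_pos.2 (div_pos (hDL q) (hDR q))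
  have hr0 : ∀ q, (r q : ℂ) ≠ 0 := fun q => by exact_mod_cast (hr q).ne'
  have hr2 : ∀ q, r q * r q = DL q / DR q := fun q =>
    Real.mul_self_sqrt (div_pos (hDL q) (hDR q)).le
  let c : Sector A → ℂ := fun q => (r q : ℂ)
  have hinv : diag c * diag (fun q => (c q)⁻¹) = 1 := diag_mul_inv hr0
  let g : Aˣ := ⟨k * diag c, diag (fun q => (c q)⁻¹) * ↑k⁻¹,
    by rw [mul_assoc, ← mul_assoc (diag c), hinv, one_mul, Units.mul_inv],
    by rw [mul_assoc, ← mul_assoc (↑k⁻¹ : A), Units.inv_mul, one_mul, ← diag_comm, hinv]⟩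
  have hg : (g : A) = k * diag c := rfl
  have hgi : (↑g⁻¹ : A) = diag (fun q => (c q)⁻¹) * ↑k⁻¹ := rfl
  have hgq : ∀ q : Sector A, (g : A) * q.elt = (r q : ℂ) • (k * q.elt) := fun q => by
    rw [hg, mul_assoc, diag_mul_elt, mul_smul_comm]
  have hgiq : ∀ q : Sector A, (↑g⁻¹ : A) * q.elt = (r q : ℂ)⁻¹ • (↑k⁻¹ * q.elt) := fun q => by
    rw [hgi, ← diag_comm, mul_assoc, diag_mul_elt, mul_smul_comm]
  refine ⟨g, fun q => r q * DR q, ⟨b * diag (fun q => (Real.sqrt (r q) : ℂ)), ?_⟩, fun x => ?_,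
    fun q => mul_pos (hr q) (hDR q), fun q => ?_, fun q => ?_⟩
  · rw [star_mul, star_diag, mul_assoc, ← mul_assoc (star b), ← hb, hg, ← diag_comm, mul_assoc,
      diag_mul_diag]
    congr 2
    ext q
    simp only [Complex.star_def, Complex.conj_ofReal]
    rw [← Complex.ofReal_mul, Real.mul_self_sqrt (hr q).le]
  · rw [hk, hg, hgi, mul_assoc _ (diag c) x, ← diag_comm, mul_assoc, mul_assoc, mul_assoc,
      ← mul_assoc (diag c), hinv, one_mul]
  · rw [hgiq, ← TensorProduct.smul_tmul', smul_mul_assoc, map_smul, hL, smul_smul]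
    congr 1
    have := hr2 q
    rw [eq_div_iff (hDR q).ne', mul_assoc] at this
    rw [← this]
    push_cast
    field_simp [hr0 q]
  · rw [hgq, TensorProduct.tmul_smul, smul_mul_assoc, map_smul, hR, smul_smul]
    push_cast
    rfl

namespace IsBalanced

variable {g : Aˣ} {D : Sector A → ℝ}

theorem tr_inv_mul_elt (h : IsBalanced g D) (q : Sector A) :
    tr A (↑g⁻¹ * q.elt) = D q * counit (R := ℂ) (rightVac q).zL := by
  rw [← counit_sliceL (tr A), h.left, map_smul, smul_eq_mul]

theorem tr_mul_elt (h : IsBalanced g D) (q : Sector A) :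
    tr A (g * q.elt) = D q * counit (R := ℂ) (leftVac q).zL := by
  rw [← counit_sliceR (tr A), h.right, map_smul, smul_eq_mul, Vac.zR, counit_antipode]

/-- Two implementations of S² differ by a central factor, with value c on the sector q. Comparing
traces gives D' = cD from the right dimensions and D = cD' from the left ones, so D² = D'². -/
theorem unique {g' : Aˣ} {D' : Sector A → ℝ} (h : IsBalanced g D) (h' : IsBalanced g' D') :
    D = D' := by
  have hc : (↑g⁻¹ * g' : A) ∈ Subalgebra.center ℂ A := by
    rw [Subalgebra.mem_center_iff]
    intro x
    have := (h.implements x).symm.trans (h'.implements x)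
    have h2 : (g : A) * x = g' * x * ↑g'⁻¹ * g := by rw [← this, mul_assoc, Units.inv_mul, mul_one]
    have h3 : x * (↑g⁻¹ * g') = ↑g⁻¹ * (g * x) * (↑g⁻¹ * g') := by
      rw [← mul_assoc (↑g⁻¹ : A), Units.inv_mul, one_mul]
    rw [h3, h2]
    calc (↑g⁻¹ : A) * (g' * x * ↑g'⁻¹ * g) * (↑g⁻¹ * g')
        = ↑g⁻¹ * g' * x * (↑g'⁻¹ * ((g * ↑g⁻¹) * g')) := by simp only [mul_assoc]
      _ = ↑g⁻¹ * g' * x := by rw [Units.mul_inv, one_mul, Units.inv_mul, mul_one]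
  ext q
  obtain ⟨c, hcq⟩ := exists_mul_elt_eq_smul (C := ⊤) (x := (↑g⁻¹ * g' : A)) trivial hc q
  have e1 : (g' : A) * q.elt = c • (g * q.elt) := by
    rw [← mul_smul_comm, ← hcq, ← mul_assoc, ← mul_assoc, Units.mul_inv, one_mul]
  have e2 : (↑g⁻¹ : A) * q.elt = c • (↑g'⁻¹ * q.elt) := by
    have : (↑g⁻¹ : A) = ↑g'⁻¹ * (↑g⁻¹ * g') := by
      rw [Subalgebra.mem_center_iff.1 hc, mul_assoc, Units.mul_inv, mul_one]
    conv_lhs => rw [this]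
    rw [mul_assoc, hcq, mul_smul_comm]
  have e3 := congrArg (tr A) e1
  have e4 := congrArg (tr A) e2
  rw [map_smul, smul_eq_mul, h'.tr_mul_elt, h.tr_mul_elt] at e3
  rw [map_smul, smul_eq_mul, h.tr_inv_mul_elt, h'.tr_inv_mul_elt] at e4
  have n1 := (counit_zL_pos (leftVac q)).ne'
  have n2 := (counit_zL_pos (rightVac q)).ne'
  have e5 : (D' q : ℂ) = c * D q := mul_right_cancel₀ n1 (by rw [e3, mul_assoc])
  have e6 : (D q : ℂ) = c * D' q := mul_right_cancel₀ n2 (by rw [e4, mul_assoc])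
  have e7 : (D q : ℂ) * D q = D' q * D' q := by
    rw [e5]
    calc (D q : ℂ) * D q = D q * (c * D' q) := by rw [← e6]
      _ = c * D q * (c * D q) := by rw [e5]; ring
  have e8 : D q * D q = D' q * D' q := by exact_mod_cast e7
  exact (mul_self_inj (h.dim_pos q).le (h'.dim_pos q).le).1 e8

theorem comul_conj (h : IsBalanced g D) (x : A) :
    comul (R := ℂ) (g * x * ↑g⁻¹ : A) =
      ((g : A) ⊗ₜ[ℂ] (g : A)) * comul (R := ℂ) x * ((↑g⁻¹ : A) ⊗ₜ[ℂ] (↑g⁻¹ : A)) := by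
  obtain ⟨n, a, b, hx⟩ := exists_tensor_rep (comul (R := ℂ) x)
  rw [← h.implements, comul_antipode_eq (comul_antipode_eq hx), hx, Finset.mul_sum, Finset.sum_mul]
  refine Finset.sum_congr rfl fun i _ => ?_
  rw [h.implements, h.implements, Algebra.TensorProduct.tmul_mul_tmul,
    Algebra.TensorProduct.tmul_mul_tmul]

theorem tmul_mul_inv (g : Aˣ) :
    ((g : A) ⊗ₜ[ℂ] (g : A)) * ((↑g⁻¹ : A) ⊗ₜ[ℂ] (↑g⁻¹ : A)) = 1 := by
  rw [Algebra.TensorProduct.tmul_mul_tmul, Units.mul_inv, Algebra.TensorProduct.one_def]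

theorem tmul_inv_mul (g : Aˣ) :
    ((↑g⁻¹ : A) ⊗ₜ[ℂ] (↑g⁻¹ : A)) * ((g : A) ⊗ₜ[ℂ] (g : A)) = 1 := by
  rw [Algebra.TensorProduct.tmul_mul_tmul, Units.inv_mul, Algebra.TensorProduct.one_def]

theorem comul_mul_tmul (h : IsBalanced g D) (x : A) :
    comul (R := ℂ) (g * x : A) * ((g : A) ⊗ₜ[ℂ] (g : A)) =
      ((g : A) ⊗ₜ[ℂ] (g : A)) * comul (R := ℂ) (x * g : A) := by
  have := h.comul_conj (x * g)
  rw [← mul_assoc, mul_assoc (g * x : A), Units.mul_inv, mul_one] at this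
  rw [this, mul_assoc, tmul_inv_mul, mul_one]

theorem weight_mul_elt (c : Vac A → ℂ) (q : Sector A) :
    diag c * q.elt = c (leftVac q) • q.elt ∧ antipode (diag c) * q.elt = c (rightVac q) • q.elt := by
  constructor
  · conv_lhs => rw [← zL_leftVac_mul q]
    rw [← mul_assoc, Vac.zL, diag_mul_elt, smul_mul_assoc]
    congr 1
    exact zL_leftVac_mul q
  · conv_lhs => rw [← zR_rightVac_mul q]
    rw [← mul_assoc, Vac.zR, ← antipode_mul_rev, Vac.zL, diag_comm, diag_mul_elt, map_smul,
      smul_mul_assoc]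
    congr 1
    exact zR_rightVac_mul q

theorem elt_tmul_elt_Δ1 {q p : Sector A} (hqp : rightVac q ≠ leftVac p) :
    (q.elt ⊗ₜ[ℂ] p.elt) * Δ1 A = 0 := by
  have hz : ((rightVac q).zR ⊗ₜ[ℂ] (1 : A)) * Δ1 A = ((1 : A) ⊗ₜ[ℂ] (rightVac q).zL) * Δ1 A :=
    antipode_tmul_Δ1 (Vac.zL_mem _) (Vac.zL_mem_center _)
  have e1 : q.elt ⊗ₜ[ℂ] p.elt = (q.elt ⊗ₜ[ℂ] p.elt) * ((rightVac q).zR ⊗ₜ[ℂ] (1 : A)) := by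
    rw [Algebra.TensorProduct.tmul_mul_tmul, mul_one, Vac.zR_comm, zR_rightVac_mul]
  rw [e1, mul_assoc, hz, ← mul_assoc, Algebra.TensorProduct.tmul_mul_tmul, mul_one, Vac.zL_comm,
    zL_mul_elt_of_ne hqp, TensorProduct.tmul_zero, zero_mul]

/-- Let T' be the component of T at e_q ⊗ e_p; it vanishes unless q^R = p^L. Its left slice is a
scalar x on p, its right slice a scalar y on q. Evaluating the pairing of g⁻¹ ⊗ g with T' through
either slice and cancelling the common vacuum weight gives xD_p = yD_q, from which both sides are
read off. -/
theorem pairing_elt (h : IsBalanced g D) {T : A ⊗[ℂ] A} (h1 : Δ1 A * T = T) (h2 : T * Δ1 A = T)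
    (hT : ∀ x : A, T * comul (R := ℂ) x = comul (R := ℂ) x * T) (q p : Sector A) :
    counit (R := ℂ) (leftVac q).zL * pairing (tr A) (tr A)
        (((↑g⁻¹ : A) ⊗ₜ[ℂ] (↑g⁻¹ : A)) * (T * (q.elt ⊗ₜ[ℂ] p.elt))) =
      counit (R := ℂ) (rightVac p).zL * pairing (tr A) (tr A)
        (((g : A) ⊗ₜ[ℂ] (g : A)) * (T * (q.elt ⊗ₜ[ℂ] p.elt))) := by
  have hcent := central_tmul_comm (elt_mem_center q) (elt_mem_center p)
  by_cases hqp : rightVac q = leftVac p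
  swap
  · have : T * (q.elt ⊗ₜ[ℂ] p.elt) = 0 := by
      rw [← h2, mul_assoc, ← hcent, elt_tmul_elt_Δ1 hqp, mul_zero]
    simp [this]
  set T' := T * (q.elt ⊗ₜ[ℂ] p.elt) with hT'
  have h1' : Δ1 A * T' = T' := by rw [hT', ← mul_assoc, h1]
  have h2' : T' * Δ1 A = T' := by rw [hT', mul_assoc, hcent, ← mul_assoc, h2]
  have hTc' : ∀ x : A, T' * comul (R := ℂ) x = comul (R := ℂ) x * T' := fun x => by
    rw [hT', mul_assoc, hcent, ← mul_assoc, hT, mul_assoc]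
  obtain ⟨x, hx⟩ := exists_mul_elt_eq_smul (C := ⊤) trivial
    (sliceL_mem_center h.implements h1' h2' hTc') p
  obtain ⟨y, hy⟩ := exists_mul_elt_eq_smul (C := ⊤) trivial
    (sliceR_mem_center h.implements h1' h2' hTc') q
  have hTp : T' * ((1 : A) ⊗ₜ[ℂ] p.elt) = T' := by
    rw [hT', mul_assoc, Algebra.TensorProduct.tmul_mul_tmul, mul_one, p.idem]
  have hTq : T' * (q.elt ⊗ₜ[ℂ] (1 : A)) = T' := by
    rw [hT', mul_assoc, Algebra.TensorProduct.tmul_mul_tmul, mul_one, q.idem]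
  rw [← sliceL_mul_right, mul_assoc, hTp] at hx
  rw [← sliceR_mul_right, mul_assoc, hTq] at hy
  have eL : ∀ z : A, pairing (tr A) (tr A) (((↑g⁻¹ : A) ⊗ₜ[ℂ] z) * T') = x * tr A (z * p.elt) := by
    intro z
    rw [← one_tmul_mul_tmul_one, mul_assoc, ← apply_sliceL, sliceL_mul_left, hx, mul_smul_comm,
      map_smul, smul_eq_mul]
  have eR : ∀ z : A, pairing (tr A) (tr A) ((z ⊗ₜ[ℂ] (g : A)) * T') = y * tr A (z * q.elt) := by
    intro z
    rw [← tmul_one_mul_one_tmul, mul_assoc, ← apply_sliceR, sliceR_mul_left, hy, mul_smul_comm,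
      map_smul, smul_eq_mul]
  have e3 := (eL g).symm.trans (eR ↑g⁻¹)
  rw [h.tr_mul_elt, h.tr_inv_mul_elt, hqp, ← mul_assoc, ← mul_assoc] at e3
  have e4 := mul_right_cancel₀ (counit_zL_pos (leftVac p)).ne' e3
  rw [eL, eR, h.tr_mul_elt, h.tr_inv_mul_elt]
  linear_combination counit (R := ℂ) (leftVac q).zL * counit (R := ℂ) (rightVac p).zL * e4

/-- The weight element `∑ ε(z_μ) z_μ^L`. -/
noncomputable def _root_.WHA.vacWeight (A : Type*) [CStarAlgebra A] [CStarWeakHopfAlgebra A]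
    [FiniteDimensional ℂ A] : A :=
  diag fun μ : Vac A => counit (R := ℂ) μ.zL

theorem pairing_weight (h : IsBalanced g D) {T : A ⊗[ℂ] A} (h1 : Δ1 A * T = T)
    (h2 : T * Δ1 A = T) (hT : ∀ x : A, T * comul (R := ℂ) x = comul (R := ℂ) x * T) :
    pairing (tr A) (tr A) (((↑g⁻¹ : A) ⊗ₜ[ℂ] (↑g⁻¹ : A)) * (T * (vacWeight A ⊗ₜ[ℂ] (1 : A)))) =
      pairing (tr A) (tr A)
        (((g : A) ⊗ₜ[ℂ] (g : A)) * (T * ((1 : A) ⊗ₜ[ℂ] antipode (vacWeight A)))) := by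
  have hs := sum_elt (⊤ : Subalgebra ℂ A)
  have e1 : vacWeight A ⊗ₜ[ℂ] (1 : A) = ∑ q : Sector A, ∑ p : Sector A,
      counit (R := ℂ) (leftVac q).zL • (q.elt ⊗ₜ[ℂ] p.elt) := by
    simp only [← TensorProduct.tmul_sum, hs, TensorProduct.smul_tmul']
    rw [← TensorProduct.sum_tmul]
    congr 1
    conv_lhs => rw [← mul_one (vacWeight A), ← hs, Finset.mul_sum]
    exact Finset.sum_congr rfl fun q _ => (weight_mul_elt _ q).1
  have e2 : (1 : A) ⊗ₜ[ℂ] antipode (vacWeight A) = ∑ q : Sector A, ∑ p : Sector A,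
      counit (R := ℂ) (rightVac p).zL • (q.elt ⊗ₜ[ℂ] p.elt) := by
    simp only [← TensorProduct.tmul_smul, ← TensorProduct.tmul_sum]
    rw [← TensorProduct.sum_tmul, hs]
    congr 1
    conv_lhs => rw [← mul_one (antipode (vacWeight A)), ← hs, Finset.mul_sum]
    exact Finset.sum_congr rfl fun q _ => (weight_mul_elt _ q).2
  rw [e1, e2]
  simp only [Finset.mul_sum, map_sum, mul_smul_comm, map_smul, smul_eq_mul]
  exact Finset.sum_congr rfl fun q _ => Finset.sum_congr rfl fun p _ => h.pairing_elt h1 h2 hT q p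

/-- Because T commutes with Δ(A), x ↦ (tr ⊗ tr)(Δ(x)T) is a trace. For n = `vacWeight A`, the
elements g⁻¹n and gS(n) have the same regular trace on each sector, namely D_q times the counits of
z^L at q^L and q^R, so traces do not distinguish them. -/
theorem pairing_comul_weight (h : IsBalanced g D) {T : A ⊗[ℂ] A}
    (hT : ∀ x : A, T * comul (R := ℂ) x = comul (R := ℂ) x * T) :
    pairing (tr A) (tr A) (comul (R := ℂ) (↑g⁻¹ * vacWeight A : A) * T) =
      pairing (tr A) (tr A) (comul (R := ℂ) (g * antipode (vacWeight A) : A) * T) := by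
  let σ : A →ₗ[ℂ] ℂ := pairing (tr A) (tr A) ∘ₗ LinearMap.mulRight ℂ T ∘ₗ comul (R := ℂ)
  have hσ : ∀ a b, σ (a * b) = σ (b * a) := by
    intro a b
    change pairing (tr A) (tr A) (comul (R := ℂ) (a * b) * T) =
      pairing (tr A) (tr A) (comul (R := ℂ) (b * a) * T)
    rw [comul_mul, comul_mul, mul_assoc, pairing_trace tr_mul_comm tr_mul_comm, mul_assoc, hT,
      mul_assoc]
  refine trace_eq_of_tr_elt hσ fun q => ?_
  rw [mul_assoc, mul_assoc, vacWeight, (weight_mul_elt _ q).1, (weight_mul_elt _ q).2, mul_smul_comm,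
    mul_smul_comm, map_smul, map_smul, h.tr_inv_mul_elt, h.tr_mul_elt, smul_eq_mul, smul_eq_mul]
  ring

end IsBalanced

end Balanced

/-! ### A balanced element is grouplike -/

section Grouplike

open Coalgebra CStarWeakHopfAlgebra

variable {A : Type*} [CStarAlgebra A] [CStarWeakHopfAlgebra A] [FiniteDimensional ℂ A]

theorem vacWeight_mem : vacWeight A ∈ leftSub A := diag_mem _

theorem vacWeight_mem_center : vacWeight A ∈ Subalgebra.center ℂ A := diag_mem_center _

/-- The square root of the weight element and its inverse. -/
theorem exists_sqrt_vacWeight : ∃ s t : A, s * s = vacWeight A ∧ star s = s ∧ s * t = 1 ∧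
    s ∈ leftSub A ∧ s ∈ Subalgebra.center ℂ A := by
  let r : Vac A → ℝ := fun μ => Real.sqrt (counit (R := ℂ) μ.zL).re
  have hre : ∀ μ : Vac A, ((counit (R := ℂ) μ.zL).re : ℂ) = counit (R := ℂ) μ.zL := fun μ =>
    (Complex.eq_re_of_ofReal_le (r := 0) (counit_zL_pos μ).le).symm
  have hpos : ∀ μ : Vac A, 0 < (counit (R := ℂ) μ.zL).re := fun μ =>
    (Complex.lt_def.1 (counit_zL_pos μ)).1
  have hr : ∀ μ : Vac A, ((r μ : ℝ) : ℂ) ≠ 0 := fun μ => by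
    exact_mod_cast (Real.sqrt_pos.2 (hpos μ)).ne'
  refine ⟨diag fun μ => (r μ : ℂ), diag fun μ => ((r μ : ℂ))⁻¹, ?_, ?_, diag_mul_inv hr,
    diag_mem _, diag_mem_center _⟩
  · rw [diag_mul_diag, vacWeight]
    congr 1
    ext μ
    rw [← Complex.ofReal_mul, Real.mul_self_sqrt (hpos μ).le, hre]
  · rw [star_diag]
    simp only [Complex.star_def, Complex.conj_ofReal]

variable {g : Aˣ} {D : Sector A → ℝ}

/-- G = (g ⊗ g)Δ(g⁻¹) and G' = Δ(g)(g⁻¹ ⊗ g⁻¹) commute with Δ(A) and are inverse to each other in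
the corner of Δ(1). With n the vacuum weight and F(T) = (tr ⊗ tr)(Δ(gS(n))T), the two pairing lemmas
give F(GT) = F(G'T) for T in the commutant. This forces the self-adjoint element G to be Δ(1). -/
theorem IsBalanced.comul_eq (h : IsBalanced g D) :
    comul (R := ℂ) (g : A) = ((g : A) ⊗ₜ[ℂ] (g : A)) * Δ1 A := by
  obtain ⟨b, hb⟩ := exists_unit_of_star_mul_self h.pos
  have hgs : star (g : A) = g := by rw [hb, star_mul, star_star]
  set gg : A ⊗[ℂ] A := (g : A) ⊗ₜ[ℂ] (g : A) with hgg
  set gi : A ⊗[ℂ] A := (↑g⁻¹ : A) ⊗ₜ[ℂ] (↑g⁻¹ : A) with hgi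
  have hgi1 : gg * gi = 1 := IsBalanced.tmul_mul_inv g
  have hgi2 : gi * gg = 1 := IsBalanced.tmul_inv_mul g
  let Δ : A → A ⊗[ℂ] A := fun x => comul (R := ℂ) x
  have hΔ : ∀ x y, Δ (x * y) = Δ x * Δ y := comul_mul
  have hcg : ∀ x : A, Δ (g * x) * gg = gg * Δ (x * g) := h.comul_mul_tmul
  have hmove : ∀ x : A, Δ x * gg = gg * Δ (↑g⁻¹ * x * g) := fun x => by
    rw [← hcg, Units.mul_inv_cancel_left]
  have hmove' : ∀ x : A, gi * Δ x = Δ (↑g⁻¹ * x * g) * gi := fun x => by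
    calc gi * Δ x = gi * (Δ x * gg) * gi := by rw [mul_assoc, mul_assoc, hgi1, mul_one]
      _ = _ := by rw [hmove, ← mul_assoc gi, hgi2, one_mul]
  set G := gg * Δ ↑g⁻¹ with hG
  set G' := Δ g * gi with hG'
  have hone : Δ 1 = Δ1 A := rfl
  have hΔinv : Δ g * Δ ↑g⁻¹ = Δ1 A := by rw [← hΔ, Units.mul_inv, hone]
  have hΔinv' : Δ ↑g⁻¹ * Δ g = Δ1 A := by rw [← hΔ, Units.inv_mul, hone]
  have hGΔ : ∀ x, G * Δ x = Δ x * G := fun x => by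
    rw [hG, ← mul_assoc, hmove, mul_assoc, mul_assoc, ← hΔ, ← hΔ, mul_assoc _ (g : A), Units.mul_inv,
      mul_one]
  have hG'Δ : ∀ x, G' * Δ x = Δ x * G' := fun x => by
    rw [hG', mul_assoc, hmove', ← mul_assoc, ← hΔ, ← mul_assoc (Δ x), ← hΔ, mul_assoc (↑g⁻¹ : A),
      Units.mul_inv_cancel_left]
  have hgg1 : Δ1 A * gg = gg * Δ1 A := by
    have := hmove 1
    rwa [mul_one, Units.inv_mul] at this
  have hgi1' : gi * Δ1 A = Δ1 A * gi := by
    have := hmove' 1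
    rwa [mul_one, Units.inv_mul] at this
  have hGG' : G * G' = Δ1 A := by
    rw [hG, hG', mul_assoc, ← mul_assoc (Δ _), hΔinv', ← mul_assoc, ← hgg1, mul_assoc, hgi1, mul_one]
  have hG'G : G' * G = Δ1 A := by
    rw [hG, hG', mul_assoc, ← mul_assoc gi, hgi2, one_mul, hΔinv]
  have h1G : Δ1 A * G = G := by
    rw [hG, ← mul_assoc, hgg1, mul_assoc, ← comul_eq_Δ1_mul]
  have hG1 : G * Δ1 A = G := by rw [hG, mul_assoc, ← comul_eq_mul_Δ1]
  have h1G' : Δ1 A * G' = G' := by rw [hG', ← mul_assoc, ← comul_eq_Δ1_mul]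
  have hG'1 : G' * Δ1 A = G' := by rw [hG', mul_assoc, hgi1', ← mul_assoc, ← comul_eq_mul_Δ1]
  have h11 := Δ1_mul_Δ1 (A := A)
  have hG'1Δ : ∀ x, Δ1 A * Δ x = Δ x * Δ1 A := fun x => by
    rw [← comul_eq_Δ1_mul, ← comul_eq_mul_Δ1]
  have hstarG : star G = G := by
    rw [hG, tensor_star_mul, hgg, TensorProduct.star_tmul, hgs, ← hgg]
    change star (comul (R := ℂ) (↑g⁻¹ : A)) * gg = _
    have hgis : star (↑g⁻¹ : A) = ↑g⁻¹ := by
      rw [← mul_one (star (↑g⁻¹ : A)), ← Units.mul_inv g, ← mul_assoc]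
      conv_lhs => enter [1, 2]; rw [← hgs]
      rw [← star_mul, Units.mul_inv, star_one, one_mul]
    rw [← comul_star, hgis]
    change Δ _ * gg = _
    rw [hmove, Units.inv_mul_cancel_right]
  obtain ⟨s, t, hs2, hss, hst, hsm, hsc⟩ := exists_sqrt_vacWeight (A := A)
  have hcommS : ∀ x : A, x * antipode s = antipode s * x :=
    Subalgebra.mem_center_iff.1 (antipode_mem_center hsc)
  have hcomms : ∀ x : A, x * s = s * x := Subalgebra.mem_center_iff.1 hsc
  have hSs : star (antipode s : A) = antipode s := by
    rw [star_antipode, hss, antipodeInv_eq_antipode hsm hsc]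
  have hSw : antipode (vacWeight A) = (antipode s * antipode s : A) := by
    rw [← hs2, antipode_mul_rev]
  have hSst : antipode s * antipode t = (1 : A) := by
    rw [← antipode_mul_rev, ← antipode_one, ← hst, hcomms]
  let F : A ⊗[ℂ] A → ℂ := fun T =>
    pairing (tr A) (tr A) (Δ (g * antipode (vacWeight A)) * T)
  have hFadd : ∀ S T, F (S + T) = F S + F T := fun S T => by
    simp only [F, mul_add, map_add]
  have hFsub : ∀ S T, F (S - T) = F S - F T := fun S T => by
    simp only [F, mul_sub, map_sub]
  have hF' : ∀ T, Δ1 A * T = T → T * Δ1 A = T → (∀ x, T * Δ x = Δ x * T) →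
      F (G' * T) = pairing (tr A) (tr A) (gi * (T * (vacWeight A ⊗ₜ[ℂ] (1 : A)))) := by
    intro T h1 h2 hT
    have hT' : ∀ x, G' * T * Δ x = Δ x * (G' * T) := fun x => by
      rw [mul_assoc, hT, ← mul_assoc, hG'Δ, mul_assoc]
    change pairing (tr A) (tr A) (comul (R := ℂ) (g * antipode (vacWeight A) : A) * (G' * T)) = _
    rw [← h.pairing_comul_weight hT']
    rw [comul_mul_left' vacWeight_mem, mul_assoc, central_tmul_comm vacWeight_mem_center (Subalgebra.one_mem _),
      ← mul_assoc, ← mul_assoc]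
    change pairing (tr A) (tr A) (Δ ↑g⁻¹ * G' * T * _) = _
    rw [hG', ← mul_assoc, hΔinv', ← hgi1', mul_assoc gi, h1, mul_assoc]
  have hF : ∀ T, Δ1 A * T = T → T * Δ1 A = T → (∀ x, T * Δ x = Δ x * T) →
      F (G * T) = F (G' * T) := by
    intro T h1 h2 hT
    rw [hF' T h1 h2 hT, h.pairing_weight h1 h2 hT]
    have hw : antipode (vacWeight A) ∈ rightSub A := antipode_mem_rightSub vacWeight_mem
    change pairing (tr A) (tr A) (comul (R := ℂ) (g * antipode (vacWeight A) : A) * (G * T)) = _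
    rw [comul_mul_right' hw, mul_assoc,
      central_tmul_comm (Subalgebra.one_mem _) (antipode_mem_center vacWeight_mem_center),
      ← mul_assoc, ← mul_assoc]
    change pairing (tr A) (tr A) (Δ g * G * T * _) = _
    rw [← hGΔ, hG, mul_assoc gg, hΔinv', mul_assoc gg, h1, mul_assoc]
  set Y := G - Δ1 A with hY
  have h1Y : Δ1 A * Y = Y := by rw [hY, mul_sub, h1G, h11]
  have hY1 : Y * Δ1 A = Y := by rw [hY, sub_mul, hG1, h11]
  have hYΔ : ∀ x, Y * Δ x = Δ x * Y := fun x => by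
    rw [hY, sub_mul, mul_sub, hGΔ, hG'1Δ]
  have hYs : star Y = Y := by rw [hY, star_sub, hstarG, star_Δ1]
  have hYY : Δ1 A * (Y * Y) = Y * Y := by rw [← mul_assoc, h1Y]
  have hYY1 : Y * Y * Δ1 A = Y * Y := by rw [mul_assoc, hY1]
  have hYYΔ : ∀ x, Y * Y * Δ x = Δ x * (Y * Y) := fun x => by
    rw [mul_assoc, hYΔ, ← mul_assoc, hYΔ, mul_assoc]
  -- Take T = Y = G − Δ(1) in F(GT) = F(G'T), with GY = Y² + Y and G'Y² = Y − G'Y. Both summands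
  -- turn out to be nonnegative, and F(Y²) = 0 implies Y = 0.
  have key : F (Y * Y) + F (G' * (Y * Y)) = 0 := by
    have e1 := hF Y h1Y hY1 hYΔ
    have e2 : G * Y = Y * Y + Y := by
      have hGY : G = Y + Δ1 A := by rw [hY]; abel
      conv_lhs => enter [1]; rw [hGY]
      rw [add_mul, h1Y]
    have e3 : G' * (Y * Y) = Y - G' * Y := by
      have : G' * Y = Δ1 A - G' := by rw [hY, mul_sub, hG'G, hG'1]
      rw [← mul_assoc, this, sub_mul, h1Y, this]
    rw [e2, hFadd] at e1
    rw [e3, hFsub, ← e1]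
    ring
  set b1 : A := b * antipode s with hb1
  have hb1s : star b1 * b1 = g * antipode (vacWeight A) := by
    rw [hb1, star_mul, hSs, hSw, hb, ← hcommS (star (b : A)), mul_assoc, ← mul_assoc (antipode s),
      ← hcommS (b : A)]
    simp only [mul_assoc]
  have posF : 0 ≤ F (Y * Y) ∧ (F (Y * Y) = 0 → Y = 0) := by
    have e : F (Y * Y) = pairing (tr A) (tr A) (star (star (Δ b1 * Y)) * star (Δ b1 * Y)) := by
      change pairing (tr A) (tr A) (Δ (g * antipode (vacWeight A)) * (Y * Y)) = _
      rw [star_star, tensor_star_mul, hYs, ← hb1s, hΔ, mul_assoc, pairing_trace tr_mul_comm tr_mul_comm]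
      change _ = pairing (tr A) (tr A) (Δ b1 * Y * (Y * star (comul (R := ℂ) b1)))
      rw [← comul_star]
      simp only [mul_assoc]
      rfl
    rw [e]
    refine ⟨pairing_star_mul_self_nonneg _, fun h0 => ?_⟩
    have h2 : Δ b1 * Y = 0 := star_eq_zero.1 (eq_zero_of_pairing_star_mul_self h0)
    have h3 : (antipode t * ↑b⁻¹ : A) * b1 = 1 := by
      rw [hb1, mul_assoc, ← mul_assoc (↑b⁻¹ : A), Units.inv_mul, one_mul, hcommS, hSst]
    rw [← h1Y, ← hone, ← h3, hΔ, mul_assoc, h2, mul_zero]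
  -- F(G'Y²) equals (tr ⊗ tr)((g⁻¹ ⊗ g⁻¹)Y²(n ⊗ 1)). The factor g⁻¹n ⊗ g⁻¹ is the square of (βs) ⊗
  -- β, where β*β = g⁻¹ and s is the central square root of n.
  have posF' : 0 ≤ F (G' * (Y * Y)) := by
    set β : A := star (↑b⁻¹ : A) with hβ
    have hgβ : (↑g⁻¹ : A) = star β * β := by
      rw [hβ, star_star, ← Units.mul_right_inj g, Units.mul_inv, hb, mul_assoc, ← mul_assoc (b : A),
        Units.mul_inv, one_mul, ← star_mul, Units.inv_mul, star_one]
    have e : gi * (Y * Y * (vacWeight A ⊗ₜ[ℂ] (1 : A))) =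
        star ((β * s) ⊗ₜ[ℂ] β) * (((β * s) ⊗ₜ[ℂ] β) * Y * Y) := by
      have e' : (↑g⁻¹ : A) * vacWeight A = star (β * s) * (β * s) := by
        rw [star_mul, hss, ← hs2, hgβ, ← hcomms (star β), mul_assoc, mul_assoc, ← mul_assoc s,
          ← hcomms β]
        simp only [mul_assoc]
      have e2 : gi * (vacWeight A ⊗ₜ[ℂ] (1 : A)) =
          star ((β * s) ⊗ₜ[ℂ] β) * ((β * s) ⊗ₜ[ℂ] β) := by
        rw [hgi, TensorProduct.star_tmul, Algebra.TensorProduct.tmul_mul_tmul,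
          Algebra.TensorProduct.tmul_mul_tmul, mul_one, ← hgβ, e']
      rw [← central_tmul_comm vacWeight_mem_center (Subalgebra.one_mem _), ← mul_assoc, e2]
      simp only [mul_assoc]
    rw [hF' _ hYY hYY1 hYYΔ, e, pairing_trace tr_mul_comm tr_mul_comm, mul_assoc]
    have := pairing_star_mul_self_nonneg (star (((β * s) ⊗ₜ[ℂ] β) * Y))
    rwa [star_star, tensor_star_mul, hYs] at this
  have hY0 : Y = 0 := posF.2 (le_antisymm (by
    rw [eq_neg_of_add_eq_zero_left key]
    exact neg_nonpos.2 posF') posF.1)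
  have hG1' : G = Δ1 A := sub_eq_zero.1 hY0
  have : Δ1 A * Δ g = gg * Δ1 A := by
    calc Δ1 A * Δ g = G * Δ g := by rw [hG1']
      _ = gg * Δ1 A := by rw [hG, mul_assoc, hΔinv']
  rwa [← comul_eq_Δ1_mul] at this

end Grouplike

/-! ### Left and right inverses: standard metrics are the balanced elements -/

section Inverses

open Coalgebra CStarWeakHopfAlgebra

variable {A : Type*} [CStarAlgebra A] [CStarWeakHopfAlgebra A]

section Module

variable (V : Type*) [AddCommGroup V] [Module ℂ V] [Module A V] [IsScalarTower ℂ A V]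
  [FiniteDimensional ℂ V]

theorem modTr_eq_sum_coord (x : A) :
    modTr V x = ∑ i, (Module.Basis.ofVectorSpace ℂ V).coord i (x • Module.Basis.ofVectorSpace ℂ V i) := by
  classical
  rw [modTr, LinearMap.comp_apply, LinearMap.trace_eq_matrix_trace ℂ (Module.Basis.ofVectorSpace ℂ V)]
  simp [Matrix.trace, LinearMap.toMatrix_apply]

/-- Contracting the basis with its dual basis produces the character of V, so the left inverse of
the identity is a slice of Δ(1) by that character. -/
theorem leftInverse_id (g : Aˣ) (φ : Module.Dual ℂ A) :
    leftInverse V g LinearMap.id φ =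
      hit (sliceL (modTr V) (((↑g⁻¹ : A) ⊗ₜ[ℂ] (1 : A)) * (Δ1 A * (hitOne φ ⊗ₜ[ℂ] (1 : A)))))
        counit := by
  obtain ⟨n, a, b, h⟩ := exists_tensor_rep (Δ1 A)
  ext y
  simp only [leftInverse, coevRight, coevaluation_apply_one, map_sum, TensorProduct.comm_tmul,
    LinearMap.lTensor_tmul, TensorProduct.map_tmul, evLeft, TensorProduct.lift.tmul,
    LinearMap.mk₂_apply, LinearMap.sum_apply, hit, LinearMap.comp_apply, LinearMap.mulRight_apply]
  generalize hitOne φ = r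
  rw [h]
  simp only [Finset.sum_mul, Finset.mul_sum, map_sum, Algebra.TensorProduct.tmul_mul_tmul, sliceL_tmul,
    LinearMap.rTensor_tmul, TensorProduct.lid_tmul, modTr_eq_sum_coord, one_mul, mul_one,
    Finset.sum_smul]
  rw [Finset.sum_comm]
  refine Finset.sum_congr rfl fun i _ => Finset.sum_congr rfl fun j _ => ?_
  simp [coeff, gam, act, mul_smul]

theorem rightInverse_id (g : Aˣ) (φ : Module.Dual ℂ A) :
    rightInverse V g LinearMap.id φ =
      hit (sliceR (modTr V) (((1 : A) ⊗ₜ[ℂ] (g : A)) * (Δ1 A * ((1 : A) ⊗ₜ[ℂ] oneHit φ))))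
        counit := by
  obtain ⟨n, a, b, h⟩ := exists_tensor_rep (Δ1 A)
  ext y
  simp only [rightInverse, coevLeft, coevaluation_apply_one, map_sum,
    LinearMap.rTensor_tmul, TensorProduct.map_tmul, evRight, TensorProduct.lift.tmul,
    LinearMap.mk₂_apply, LinearMap.sum_apply, hit, LinearMap.comp_apply, LinearMap.mulRight_apply]
  generalize oneHit φ = r
  rw [h]
  simp only [Finset.sum_mul, Finset.mul_sum, map_sum, Algebra.TensorProduct.tmul_mul_tmul, sliceR_tmul,
    LinearMap.lTensor_tmul, TensorProduct.rid_tmul, modTr_eq_sum_coord, one_mul, mul_one,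
    Finset.sum_smul]
  rw [Finset.sum_comm]
  refine Finset.sum_congr rfl fun i _ => Finset.sum_congr rfl fun j _ => ?_
  simp [coeff, gam, act, mul_smul]

end Module

theorem counit_mul_hitOne (y x : A) :
    counit (R := ℂ) (y * hitOne (hit x counit)) = counit (R := ℂ) (y * x) := by
  obtain ⟨n, a, b, h⟩ := exists_tensor_rep (Δ1 A)
  have := counit_mul_eq y 1 x h
  rw [mul_one] at this
  rw [this, hitOne, h]
  simp [hit, Finset.mul_sum, mul_comm]

theorem hitOne_mem (φ : Module.Dual ℂ A) : hitOne φ ∈ rightSub A := by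
  obtain ⟨n, r, l, hr, -, h⟩ := exists_Δ1_rep (A := A)
  rw [hitOne, h]
  simp only [map_sum, LinearMap.lTensor_tmul, TensorProduct.rid_tmul]
  exact Subalgebra.sum_mem _ fun i _ => Subalgebra.smul_mem _ (hr i) _

theorem oneHit_hit (x : A) : oneHit (hit x counit) = piL x := by
  obtain ⟨n, a, b, h⟩ := exists_tensor_rep (Δ1 A)
  rw [oneHit, piL_eq_sum h, h]
  simp [hit]

theorem counit_mul_antipode {r : A} (hr : r ∈ rightSub A) (y : A) :
    counit (R := ℂ) (y * antipode r) = counit (R := ℂ) (y * r) := by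
  rw [antipode_of_mem_rightSub hr, counit_mul_piL]

variable [FiniteDimensional ℂ A] {g : Aˣ}

theorem mult_smul_sliceL (q : Sector A) (y : A) (t : A ⊗[ℂ] A) :
    (mult q A : ℂ) • sliceL (modTr (irrep q)) ((y ⊗ₜ[ℂ] (1 : A)) * t) =
      sliceL (tr A) (((y * q.elt) ⊗ₜ[ℂ] (1 : A)) * t) := by
  induction t with
  | zero => simp
  | tmul a b =>
    simp only [Algebra.TensorProduct.tmul_mul_tmul, sliceL_tmul, smul_smul]
    rw [mul_assoc, ← q.comm, ← mul_assoc, tr_mul_elt]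
  | add a b ha hb => simp only [map_add, mul_add, smul_add, ha, hb]

theorem mult_smul_sliceR (q : Sector A) (y : A) (t : A ⊗[ℂ] A) :
    (mult q A : ℂ) • sliceR (modTr (irrep q)) (((1 : A) ⊗ₜ[ℂ] y) * t) =
      sliceR (tr A) (((1 : A) ⊗ₜ[ℂ] (y * q.elt)) * t) := by
  induction t with
  | zero => simp
  | tmul a b =>
    simp only [Algebra.TensorProduct.tmul_mul_tmul, sliceR_tmul, smul_smul]
    rw [mul_assoc, ← q.comm, ← mul_assoc, tr_mul_elt]
  | add a b ha hb => simp only [map_add, mul_add, smul_add, ha, hb]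

theorem mult_ne_zero (q : Sector A) : (mult q A : ℂ) ≠ 0 :=
  Nat.cast_ne_zero.2 (mult_self_pos q).ne'

/-- The element r = φ ⇀ 1 lies in A^R, so it crosses Δ(1) and becomes S(r) on the second leg,
leaving the slice of Δ(1) in front. Finally S(r) ⇀ ε = r ⇀ ε = φ. The division by `mult q A` passes
from the regular trace to the character of V_q. -/
theorem leftInverse_irrep {q : Sector A} {c : ℂ} {ν : Vac A}
    (hc : sliceL (tr A) (((↑g⁻¹ * q.elt : A) ⊗ₜ[ℂ] (1 : A)) * Δ1 A) = c • ν.zL)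
    {φ : Module.Dual ℂ A} (hφ : φ ∈ trivialRep A) :
    leftInverse (irrep q) g LinearMap.id φ = (c / mult q A) • hit ν.zL φ := by
  obtain ⟨x, rfl⟩ := hφ
  rw [leftInverse_id]
  have hr := hitOne_mem (hit x counit)
  have e1 : Δ1 A * (hitOne (hit x counit) ⊗ₜ[ℂ] (1 : A)) =
      Δ1 A * ((1 : A) ⊗ₜ[ℂ] antipode (hitOne (hit x counit))) := by
    rw [← Δ1_mul_antipodeInv (antipode_mem_leftSub hr), antipodeInv_antipode]
  have e2 : sliceL (modTr (irrep q)) (((↑g⁻¹ : A) ⊗ₜ[ℂ] (1 : A)) * Δ1 A) =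
      (c / mult q A) • ν.zL := by
    rw [← mult_smul_sliceL] at hc
    rw [div_eq_inv_mul, mul_smul, ← hc, inv_smul_smul₀ (mult_ne_zero q)]
  rw [e1, ← mul_assoc, sliceL_mul_right, e2]
  ext w
  simp only [hit, LinearMap.comp_apply, LinearMap.mulRight_apply, LinearMap.smul_apply, smul_mul_assoc,
    mul_smul_comm, map_smul]
  congr 1
  rw [← mul_assoc]
  exact (counit_mul_antipode hr _).trans (counit_mul_hitOne _ _)

theorem rightInverse_irrep {q : Sector A} {c : ℂ} {μ : Vac A}
    (hc : sliceR (tr A) (((1 : A) ⊗ₜ[ℂ] (g * q.elt : A)) * Δ1 A) = c • μ.zR)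
    {φ : Module.Dual ℂ A} (hφ : φ ∈ trivialRep A) :
    rightInverse (irrep q) g LinearMap.id φ = (c / mult q A) • hit μ.zL φ := by
  obtain ⟨x, rfl⟩ := hφ
  rw [rightInverse_id, oneHit_hit]
  have hr : antipodeInv (piL x) ∈ rightSub A := by
    rw [antipodeInv_apply]
    exact star_mem_rightSub (antipode_mem_rightSub (star_mem_leftSub (piL_mem x)))
  have e2 : sliceR (modTr (irrep q)) (((1 : A) ⊗ₜ[ℂ] (g : A)) * Δ1 A) =
      (c / mult q A) • μ.zR := by
    rw [← mult_smul_sliceR] at hc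
    rw [div_eq_inv_mul, mul_smul, ← hc, inv_smul_smul₀ (mult_ne_zero q)]
  rw [← Δ1_mul_antipodeInv (piL_mem x), ← mul_assoc, sliceR_mul_right, e2]
  ext w
  simp only [hit, LinearMap.comp_apply, LinearMap.mulRight_apply, LinearMap.smul_apply, smul_mul_assoc,
    mul_smul_comm, map_smul]
  congr 1
  rw [← mul_assoc, ← counit_mul_antipode hr, antipode_antipodeInv, counit_mul_piL, mul_assoc,
    ← Vac.zR_comm, ← mul_assoc, ← counit_mul_antipode μ.zR_mem, Vac.antipode_zR, mul_assoc,
    Vac.zL_comm, ← mul_assoc]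

theorem counit_mem_trivialRep : (counit : A →ₗ[ℂ] ℂ) ∈ trivialRep A :=
  ⟨1, by ext y; simp [hit]⟩

variable {D : Sector A → ℝ}

theorem IsBalanced.comul_eq' (h : IsBalanced g D) :
    comul (R := ℂ) (g : A) = Δ1 A * ((g : A) ⊗ₜ[ℂ] (g : A)) := by
  obtain ⟨b, hb⟩ := h.pos
  have hgs : star (g : A) = g := by rw [hb, star_mul, star_star]
  have := congrArg star h.comul_eq
  rwa [← comul_star, hgs, tensor_star_mul, star_Δ1, TensorProduct.star_tmul, hgs] at this

/-- Applying ε to the first leg of Δ(g) = Δ(1)(g ⊗ g) gives ⊓ᴸ(g)g = g, so ⊓ᴸ(g) = 1. On the other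
hand ⊓ᴸ(g) = g₍₁₎S(g₍₂₎) = g · 1₍₁₎S(1₍₂₎) · S(g) = gS(g). -/
theorem IsBalanced.antipode_eq (h : IsBalanced g D) : antipode (g : A) = (↑g⁻¹ : A) := by
  have h1 : piL (g : A) = 1 := by
    obtain ⟨n, a, b, hab⟩ := exists_tensor_rep (Δ1 A)
    have hΔ := h.comul_eq'
    rw [hab, Finset.sum_mul] at hΔ
    simp only [Algebra.TensorProduct.tmul_mul_tmul] at hΔ
    have h2 := sum_counit_left hΔ
    have h3 : piL (g : A) * g = g := by
      rw [piL_eq_sum hab, Finset.sum_mul]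
      simpa only [smul_mul_assoc] using h2
    calc piL (g : A) = piL (g : A) * g * ↑g⁻¹ := by rw [mul_assoc, Units.mul_inv, mul_one]
      _ = 1 := by rw [h3, Units.mul_inv]
  have h2 := mul_antipode_eq (g : A)
  rw [h.comul_eq, ← tmul_one_mul_one_tmul, mul_assoc, lTensor_mul_left, mul'_left,
    mul'_lTensor_antipode_mul, ← Δ1_eq, mul_antipode_eq, piL_one, one_mul, h1] at h2
  rw [← one_mul (antipode (g : A)), ← Units.inv_mul g, mul_assoc, h2, mul_one]

theorem IsBalanced.isStandardMetric (h : IsBalanced g D) :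
    IsStandardMetric g fun q => D q / mult q A where
  metric := ⟨h.pos, h.implements, h.comul_eq, h.antipode_eq⟩
  left q ν hν φ hφ := by
    rw [isRightVac_iff] at hν
    rw [leftInverse_irrep (h.left q) hφ, hν]
    push_cast; rfl
  right q ν hν φ hφ := by
    rw [isLeftVac_iff] at hν
    rw [rightInverse_irrep (h.right q) hφ, hν]
    push_cast; rfl

/-- Positivity and the implementation of S² already make the slices positive multiples of the vacuum
projections. Evaluating the left and right inverses on ε itself identifies the multiples, because
ε(z^L) ≠ 0. -/
theorem IsStandardMetric.isBalanced {d : Sector A → ℝ} (h : IsStandardMetric g d) :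
    IsBalanced g fun q => d q * mult q A := by
  have key : ∀ {c e : ℂ} {μ : Vac A}, c • hit μ.zL (counit : A →ₗ[ℂ] ℂ) = e • hit μ.zL counit →
      c = e := by
    intro c e μ hce
    have := LinearMap.congr_fun hce 1
    simp only [LinearMap.smul_apply, hit, LinearMap.comp_apply, LinearMap.mulRight_apply, one_mul,
      smul_eq_mul] at this
    exact mul_right_cancel₀ (counit_zL_pos μ).ne' this
  have hL : ∀ q, ∃ D : ℝ, 0 < D ∧ D = d q * mult q A ∧
      sliceL (tr A) (((↑g⁻¹ * q.elt : A) ⊗ₜ[ℂ] (1 : A)) * Δ1 A) = (D : ℂ) • (rightVac q).zL := by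
    intro q
    obtain ⟨D, hD, hs, -, -⟩ := exists_dimL h.metric.pos h.metric.implements q
    refine ⟨D, hD, ?_, hs⟩
    have e := (leftInverse_irrep hs counit_mem_trivialRep).symm.trans
      (h.left q _ (isRightVac_iff.2 rfl) _ counit_mem_trivialRep)
    have e2 := key e
    rw [div_eq_iff (mult_ne_zero q)] at e2
    exact_mod_cast e2
  have hR : ∀ q, ∃ D : ℝ, D = d q * mult q A ∧
      sliceR (tr A) (((1 : A) ⊗ₜ[ℂ] (g * q.elt : A)) * Δ1 A) = (D : ℂ) • (leftVac q).zR := by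
    intro q
    obtain ⟨D, hD, hs, -, -⟩ := exists_dimR h.metric.pos h.metric.implements q
    refine ⟨D, ?_, hs⟩
    have e := (rightInverse_irrep hs counit_mem_trivialRep).symm.trans
      (h.right q _ (isLeftVac_iff.2 rfl) _ counit_mem_trivialRep)
    have e2 := key e
    rw [div_eq_iff (mult_ne_zero q)] at e2
    exact_mod_cast e2
  refine ⟨h.metric.pos, h.metric.implements, fun q => ?_, fun q => ?_, fun q => ?_⟩
  · obtain ⟨D, hD, rfl, -⟩ := hL q
    exact hD
  · obtain ⟨D, -, rfl, hs⟩ := hL q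
    exact hs
  · obtain ⟨D, rfl, hs⟩ := hR q
    exact hs

theorem existsUnique_isDimension : ∃! d : Sector A → ℝ, IsDimension d := by
  obtain ⟨g, D, h⟩ := exists_isBalanced (A := A)
  refine ⟨_, ⟨g, h.isStandardMetric⟩, ?_⟩
  rintro d ⟨g', h'⟩
  have := h'.isBalanced.unique h
  ext q
  have hq := congrFun this q
  have hm : (mult q A : ℝ) ≠ 0 := Nat.cast_ne_zero.2 (mult_self_pos q).ne'
  change d q * mult q A = D q at hq
  rw [eq_div_iff hm, hq]

end Inverses

/-! ### The L²-norm of a nonnegative matrix -/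

section Matrices

variable {m n : Type*} [Fintype m] [Fintype n] [DecidableEq n] (M : Matrix m n ℝ)

theorem l2Norm_nonneg : 0 ≤ l2Norm M := norm_nonneg _

theorem sum_mulVec_sq_le (x : n → ℝ) :
    ∑ a, (∑ p, M a p * x p) ^ 2 ≤ l2Norm M ^ 2 * ∑ p, x p ^ 2 := by
  have h := (LinearMap.toContinuousLinearMap (Matrix.toEuclideanLin M)).le_opNorm (WithLp.toLp 2 x)
  have h2 := pow_le_pow_left₀ (norm_nonneg _) h 2
  rw [mul_pow, EuclideanSpace.real_norm_sq_eq, EuclideanSpace.real_norm_sq_eq] at h2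
  simpa [Matrix.mulVec, dotProduct, l2Norm] using h2

theorem l2Norm_sq_le {c : ℝ} (hc : 0 ≤ c)
    (h : ∀ x : n → ℝ, ∑ a, (∑ p, M a p * x p) ^ 2 ≤ c * ∑ p, x p ^ 2) : l2Norm M ^ 2 ≤ c := by
  rw [← Real.sq_sqrt hc]
  refine pow_le_pow_left₀ (norm_nonneg _) (ContinuousLinearMap.opNorm_le_bound _ (Real.sqrt_nonneg _)
    fun x => ?_) 2
  rw [← abs_of_nonneg (norm_nonneg _), ← abs_of_nonneg (mul_nonneg (Real.sqrt_nonneg c) (norm_nonneg x)),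
    ← sq_le_sq, mul_pow, Real.sq_sqrt hc, EuclideanSpace.real_norm_sq_eq,
    EuclideanSpace.real_norm_sq_eq]
  simpa [Matrix.mulVec, dotProduct] using h x

/-- The norm of a nonnegative matrix `M` is determined by a positive eigenvector of `Mᵀ M`. -/
theorem l2Norm_sq_eq [Nonempty n] (hM : ∀ a p, 0 ≤ M a p) {t : n → ℝ} (ht : ∀ p, 0 < t p) {c : ℝ}
    (h : ∀ q, ∑ a, M a q * ∑ p, M a p * t p = c * t q) : l2Norm M ^ 2 = c := by
  have hc : 0 ≤ c := by
    obtain ⟨q⟩ := ‹Nonempty n›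
    refine nonneg_of_mul_nonneg_left ?_ (ht q)
    rw [← h]
    exact Finset.sum_nonneg fun a _ => mul_nonneg (hM a q)
      (Finset.sum_nonneg fun p _ => mul_nonneg (hM a p) (ht p).le)
  refine le_antisymm (l2Norm_sq_le M hc fun x => ?_) ?_
  -- Schur test: weighted Cauchy–Schwarz with weights t_p bounds the norm by c. The vector t itself
  -- shows that the bound is attained.
  · calc ∑ a, (∑ p, M a p * x p) ^ 2
        ≤ ∑ a, (∑ p, M a p * t p) * ∑ p, M a p * (x p ^ 2 / t p) := by
          refine Finset.sum_le_sum fun a _ => Finset.sum_sq_le_sum_mul_sum_of_sq_le_mul _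
            (fun p _ => mul_nonneg (hM a p) (ht p).le)
            (fun p _ => mul_nonneg (hM a p) (div_nonneg (sq_nonneg _) (ht p).le)) fun p _ => le_of_eq ?_
          field_simp [(ht p).ne']
      _ = ∑ q, (x q ^ 2 / t q) * ∑ a, M a q * ∑ p, M a p * t p := by
          have e : ∀ a, (∑ p, M a p * t p) * ∑ p, M a p * (x p ^ 2 / t p) =
              ∑ q, (x q ^ 2 / t q) * (M a q * ∑ p, M a p * t p) := fun a => by
            rw [Finset.mul_sum]
            exact Finset.sum_congr rfl fun q _ => by ring
          simp only [e]
          rw [Finset.sum_comm]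
          exact Finset.sum_congr rfl fun q _ => (Finset.mul_sum _ _ _).symm
      _ = c * ∑ p, x p ^ 2 := by
          rw [Finset.mul_sum]
          refine Finset.sum_congr rfl fun q _ => ?_
          rw [h]
          field_simp [(ht q).ne']
  · have h1 := sum_mulVec_sq_le M t
    have h2 : ∑ a, (∑ p, M a p * t p) ^ 2 = c * ∑ p, t p ^ 2 := by
      calc ∑ a, (∑ p, M a p * t p) ^ 2 = ∑ q, t q * ∑ a, M a q * ∑ p, M a p * t p := by
            simp only [Finset.mul_sum]
            rw [Finset.sum_comm]
            refine Finset.sum_congr rfl fun a _ => ?_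
            rw [sq, Finset.sum_mul]
            refine Finset.sum_congr rfl fun q _ => ?_
            rw [Finset.mul_sum]
            exact Finset.sum_congr rfl fun p _ => by ring
        _ = c * ∑ p, t p ^ 2 := by
            rw [Finset.mul_sum]
            exact Finset.sum_congr rfl fun q _ => by rw [h]; ring
    rw [h2] at h1
    exact le_of_mul_le_mul_right h1 (Finset.sum_pos (fun p _ => by have := ht p; positivity)
      Finset.univ_nonempty)

theorem exists_unit_maximizer [Nonempty n] :
    ∃ x : n → ℝ, ∑ p, x p ^ 2 = 1 ∧ l2Norm M ^ 2 ≤ ∑ a, (∑ p, M a p * x p) ^ 2 := by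
  let T := LinearMap.toContinuousLinearMap (Matrix.toEuclideanLin M)
  obtain ⟨x, hx, hmax⟩ := (isCompact_sphere (0 : EuclideanSpace ℝ n) 1).exists_isMaxOn
    (NormedSpace.sphere_nonempty.2 zero_le_one) (f := fun x => ‖T x‖)
    (T.continuous.norm.continuousOn)
  have hx1 : ‖x‖ = 1 := by simpa using hx
  have hle : l2Norm M ≤ ‖T x‖ := by
    refine ContinuousLinearMap.opNorm_le_of_unit_norm (norm_nonneg _) fun y hy => ?_
    exact hmax (by simpa using hy)
  refine ⟨x, ?_, ?_⟩
  · rw [← EuclideanSpace.real_norm_sq_eq, hx1, one_pow]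
  · have := pow_le_pow_left₀ (l2Norm_nonneg M) hle 2
    rw [EuclideanSpace.real_norm_sq_eq] at this
    simpa [T, Matrix.mulVec, dotProduct] using this

end Matrices

/-! ### Perron–Frobenius theory for symmetric matrices -/

section PerronFrobenius

variable {n : Type*} [Fintype n] [DecidableEq n] {M : Matrix n n ℝ}

/-- The absolute value y of a norm-maximizing unit vector is again maximizing. Equality in the norm
estimates gives M²y = c²y with c the norm, so My + cy is an eigenvector for c if c > 0, and y is one
if c = 0. -/
theorem exists_nonneg_eigenvector [Nonempty n] (hM : ∀ a p, 0 ≤ M a p) (hs : ∀ a p, M a p = M p a) :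
    ∃ f : n → ℝ, (∀ i, 0 ≤ f i) ∧ (∃ i, 0 < f i) ∧ ∀ i, ∑ j, M i j * f j = l2Norm M * f i := by
  obtain ⟨x, hx1, hx2⟩ := exists_unit_maximizer M
  set c := l2Norm M with hc
  have hc0 : 0 ≤ c := l2Norm_nonneg M
  let y : n → ℝ := fun i => |x i|
  have hy0 : ∀ i, 0 ≤ y i := fun i => abs_nonneg _
  have hy1 : ∑ p, y p ^ 2 = 1 := by simpa [y] using hx1
  have hypos : ∃ i, 0 < y i := by
    by_contra! h
    have : ∀ i, y i = 0 := fun i => le_antisymm (h i) (hy0 i)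
    simp [this] at hy1
  let v : n → ℝ := fun i => ∑ p, M i p * y p
  have hv0 : ∀ i, 0 ≤ v i := fun i => Finset.sum_nonneg fun p _ => mul_nonneg (hM i p) (hy0 p)
  have hv2 : c ^ 2 ≤ ∑ i, v i ^ 2 := by
    refine hx2.trans (Finset.sum_le_sum fun i _ => ?_)
    rw [← sq_abs (∑ p, M i p * x p)]
    refine pow_le_pow_left₀ (abs_nonneg _) ((Finset.abs_sum_le_sum_abs _ _).trans_eq ?_) 2
    exact Finset.sum_congr rfl fun p _ => by rw [abs_mul, abs_of_nonneg (hM i p)]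
  have hv2' : ∑ i, v i ^ 2 ≤ c ^ 2 := by
    have := sum_mulVec_sq_le M y
    rwa [hy1, mul_one] at this
  have hv : ∑ i, v i ^ 2 = c ^ 2 := le_antisymm hv2' hv2
  let w : n → ℝ := fun i => ∑ p, M i p * v p
  have hw2 : ∑ i, w i ^ 2 ≤ c ^ 2 * c ^ 2 := by
    have := sum_mulVec_sq_le M v
    rwa [hv] at this
  have hwy : ∑ i, w i * y i = c ^ 2 := by
    rw [← hv]
    simp only [w, Finset.sum_mul]
    rw [Finset.sum_comm]
    refine Finset.sum_congr rfl fun p _ => ?_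
    rw [sq]
    simp only [v]
    rw [Finset.mul_sum]
    refine Finset.sum_congr rfl fun i _ => ?_
    rw [hs i p]; ring
  have hdiff : ∑ i, (w i - c ^ 2 * y i) ^ 2 ≤ 0 := by
    have : ∑ i, (w i - c ^ 2 * y i) ^ 2 =
        ∑ i, w i ^ 2 - 2 * c ^ 2 * ∑ i, w i * y i + c ^ 2 * c ^ 2 * ∑ i, y i ^ 2 := by
      rw [Finset.mul_sum, Finset.mul_sum, ← Finset.sum_sub_distrib, ← Finset.sum_add_distrib]
      exact Finset.sum_congr rfl fun i _ => by ring
    rw [this, hwy, hy1]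
    linarith
  have hw : ∀ i, w i = c ^ 2 * y i := by
    intro i
    have h0 := (Finset.sum_eq_zero_iff_of_nonneg fun i _ => sq_nonneg (w i - c ^ 2 * y i)).1
      (le_antisymm hdiff (Finset.sum_nonneg fun i _ => sq_nonneg _)) i (Finset.mem_univ i)
    exact sub_eq_zero.1 (pow_eq_zero_iff two_ne_zero |>.1 h0)
  rcases hc0.eq_or_lt with h0 | hpos
  · refine ⟨y, hy0, hypos, fun i => ?_⟩
    have : v i = 0 := by
      have h1 : ∑ i, v i ^ 2 = 0 := by rw [hv, ← h0]; ring
      have := (Finset.sum_eq_zero_iff_of_nonneg fun i _ => sq_nonneg (v i)).1 h1 i (Finset.mem_univ i)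
      exact pow_eq_zero_iff two_ne_zero |>.1 this
    rw [← h0, zero_mul]
    exact this
  · refine ⟨fun i => v i + c * y i, fun i => add_nonneg (hv0 i) (mul_nonneg hc0 (hy0 i)), ?_,
      fun i => ?_⟩
    · obtain ⟨i, hi⟩ := hypos
      exact ⟨i, add_pos_of_nonneg_of_pos (hv0 i) (mul_pos hpos hi)⟩
    · have e1 : ∑ j, M i j * (v j + c * y j) = w i + c * v i := by
        simp only [w, v]
        rw [Finset.mul_sum, ← Finset.sum_add_distrib]
        exact Finset.sum_congr rfl fun j _ => by ring
      rw [e1, hw]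
      ring

/-- A symmetric irreducible nonnegative matrix has a positive eigenvector, whose eigenvalue is the
norm of the matrix. -/
theorem exists_pos_eigenvector [Nonempty n] (hM : ∀ a p, 0 ≤ M a p) (hs : ∀ a p, M a p = M p a)
    (hirr : ∀ U : Set n, U.Nonempty → (∀ i ∈ U, ∀ j ∉ U, M i j = 0) → U = Set.univ) :
    ∃ f : n → ℝ, (∀ i, 0 < f i) ∧ ∀ i, ∑ j, M i j * f j = l2Norm M * f i := by
  obtain ⟨f, hf0, hf1, hf⟩ := exists_nonneg_eigenvector hM hs
  refine ⟨f, fun i => ?_, hf⟩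
  -- The support of f is closed under the matrix: where f_j = 0 the eigenvalue equation is a
  -- vanishing sum of nonnegative terms, so M_{ji} = 0 for every i in the support.
  have hU := hirr {i | 0 < f i} hf1 fun i (hi : 0 < f i) j (hj : ¬ 0 < f j) => ?_
  · have : i ∈ {i | 0 < f i} := hU ▸ Set.mem_univ i
    exact this
  · have h0 : f j = 0 := le_antisymm (not_lt.1 hj) (hf0 j)
    have h1 := hf j
    rw [h0, mul_zero] at h1
    have h2 := (Finset.sum_eq_zero_iff_of_nonneg fun k _ => mul_nonneg (hM j k) (hf0 k)).1 h1 i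
      (Finset.mem_univ i)
    rw [hs i j]
    exact (mul_eq_zero.1 h2).resolve_right hi.ne'

end PerronFrobenius

/-! ### Index and norm of the inclusion matrix -/

section Inclusion

variable {A : Type*} [CStarAlgebra A] [FiniteDimensional ℂ A] {τ : A →ₗ[ℂ] ℂ}
  {N : Subalgebra ℂ A}

theorem modTr_irrep_elt_pos (q : Sector A) : 0 < modTr (irrep q) q.elt := by
  have h1 := tr_mul_elt q q.elt
  rw [q.idem] at h1
  have h2 := tr_elt_pos q
  rw [h1, mul_comm] at h2
  exact pos_of_mul_pos_of_pos h2 (by exact_mod_cast mult_self_pos q)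

theorem IsFaithfulTrace.elt_pos (hτ : IsFaithfulTrace τ) {C : Subalgebra ℂ A}
    (q : MinCentralIdem C) : 0 < τ q.elt := by
  have := hτ.pos q.elt q.2.ne_zero
  rwa [star_elt, q.idem] at this

theorem IsFaithfulTrace.prim_pos (hτ : IsFaithfulTrace τ) (q : Sector A) : 0 < τ (prim q) := by
  have h := hτ.elt_pos q
  rw [← q.idem, trace_mul_elt hτ.trace] at h
  exact pos_of_mul_pos_of_pos h (modTr_irrep_elt_pos q)

theorem IsFaithfulTrace.prim_eq_re (hτ : IsFaithfulTrace τ) (q : Sector A) :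
    τ (prim q) = ((τ (prim q)).re : ℂ) :=
  Complex.eq_re_of_ofReal_le (r := 0) (hτ.prim_pos q).le

theorem sum_subtype_of_support {ι R : Type*} [Fintype ι] [AddCommMonoid R] (P : ι → Prop)
    [Fintype {i // P i}] {f : ι → R} (h : ∀ i, ¬ P i → f i = 0) :
    ∑ i : {i // P i}, f i.1 = ∑ i, f i := by
  classical
  rw [← Finset.sum_filter_add_sum_filter_not Finset.univ P f,
    Finset.sum_eq_zero (s := Finset.univ.filter fun i => ¬ P i) fun i hi => h i (Finset.mem_filter.1 hi).2,
    add_zero]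
  exact (Finset.sum_subtype (Finset.univ.filter P) (fun i => by simp) f).symm

variable [IsSemisimpleRing N]

theorem mult_eq_modTr_sub (a : Sector N) (q : Sector A) :
    (mult (B := N) a (irrep q) : ℂ) = modTr (irrep q) ((prim a : N) : A) := mult_eq_modTr (B := N) a (irrep q)

theorem trace_prim_sub (hτ : ∀ a b, τ (a * b) = τ (b * a)) (a : Sector N) :
    τ ((prim a : N) : A) = ∑ p : Sector A, (mult (B := N) a (irrep p) : ℂ) * τ (prim p) := by
  rw [trace_eq_sum hτ]
  exact Finset.sum_congr rfl fun p _ => by rw [mult_eq_modTr_sub, mul_comm]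

theorem index_mul_prim (hτ : IsFaithfulTrace τ) (hN : ∀ x ∈ N, star x ∈ N) {E : A →ₗ[ℂ] A} {c : A}
    (hE : IsCondExp τ N E) (hc : HasIndex E c) (q : Sector A) :
    τ (c * prim q) = ∑ a : Sector N, (mult (B := N) a (irrep q) : ℂ) * τ ((prim a : N) : A) := by
  obtain ⟨E', c', hE', hc', h, -⟩ := exists_condExp_index hτ hN
  obtain rfl := hE.unique hτ hN hE'
  obtain rfl := hc.unique hc'
  exact h q

theorem scalar_eq_of_mult_ne_zero {y : A} {α β : ℂ} {a : Sector N} {q : Sector A}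
    (ha : y * (a.elt : A) = α • (a.elt : A)) (hq : y * q.elt = β • q.elt)
    (hm : mult (B := N) a (irrep q) ≠ 0) : α = β := by
  have hm' : modTr (irrep q) ((prim a : N) : A) ≠ 0 := by
    rw [← mult_eq_modTr_sub]; exact_mod_cast hm
  have hpa : (a.elt : A) * ((prim a : N) : A) = ((prim a : N) : A) := congrArg Subtype.val (elt_mul_prim a)
  have h1 : modTr (irrep q) (y * ((prim a : N) : A)) = α * modTr (irrep q) ((prim a : N) : A) := by
    rw [← hpa, ← mul_assoc, ha, smul_mul_assoc, map_smul, smul_eq_mul]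
  have h2 : modTr (irrep q) (y * ((prim a : N) : A)) = β * modTr (irrep q) ((prim a : N) : A) := by
    rw [← modTr_irrep_mul_elt, mul_assoc, q.comm, ← mul_assoc, hq, smul_mul_assoc, map_smul,
      smul_eq_mul, ← q.comm, modTr_irrep_mul_elt]
  exact mul_right_cancel₀ hm' (h1.symm.trans h2)

theorem mul_elt_iff_of_mult_ne_zero {z : A} (hz : z ∈ N) (hzc : z ∈ Subalgebra.center ℂ A)
    {a : Sector N} {q : Sector A} (hm : mult (B := N) a (irrep q) ≠ 0) :
    z * (a.elt : A) = a.elt ↔ z * q.elt = q.elt := by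
  obtain ⟨α, hα⟩ := exists_mul_elt_eq_smul (B := N) (C := ⊤) (x := ⟨z, hz⟩) trivial
    (Subalgebra.mem_center_iff.2 fun b => Subtype.ext (Subalgebra.mem_center_iff.1 hzc b)) a
  replace hα : z * (a.elt : A) = α • (a.elt : A) := congrArg Subtype.val hα
  obtain ⟨β, hβ⟩ := exists_mul_elt_eq_smul (C := ⊤) trivial hzc q
  have h := scalar_eq_of_mult_ne_zero hα hβ hm
  have ha : (a.elt : A) ≠ 0 := fun h0 => a.2.ne_zero (Subtype.ext h0)
  have hq : q.elt ≠ 0 := q.2.ne_zero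
  rw [hα, hβ, h]
  constructor
  · intro h1
    have : (β - 1) • (a.elt : A) = 0 := by rw [sub_smul, h1, one_smul, sub_self]
    rw [sub_eq_zero.1 ((smul_eq_zero.1 this).resolve_right ha), one_smul]
  · intro h1
    have : (β - 1) • q.elt = 0 := by rw [sub_smul, h1, one_smul, sub_self]
    rw [sub_eq_zero.1 ((smul_eq_zero.1 this).resolve_right hq), one_smul]

/-- The vector t_q = τ(p_q) is positive, τ(p_a) = ∑ Λ_{ap} t_p for the irreducibles a of N, and the
index formula reads ΛᵀΛt = γt on the block of z. Multiplicities vanish between irreducibles inside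
and outside z, so sums over the block and sums over everything agree. -/
theorem inclusionNorm_sq (hτ : IsFaithfulTrace τ) (hN : ∀ x ∈ N, star x ∈ N) {E : A →ₗ[ℂ] A} {c : A}
    (hE : IsCondExp τ N E) (hc : HasIndex E c) {z : A} (hz : z ∈ N)
    (hzc : z ∈ Subalgebra.center ℂ A) (hzi : z * z = z) (hz0 : z ≠ 0) {γ : ℝ}
    (hγ : ∀ q : Sector A, z * q.elt = q.elt → c * q.elt = (γ : ℂ) • q.elt) :
    inclusionNorm N z ^ 2 = γ := by
  have : Nonempty {q : Sector A // z * q.elt = q.elt} := by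
    obtain ⟨q, hq⟩ := exists_mul_elt_ne_zero hz0
    exact ⟨q, (mul_elt_eq_zero_or hzc hzi q).resolve_left hq⟩
  classical
  have hM : ∀ a p, 0 ≤ inclusionMatrix N z a p := fun a p => Nat.cast_nonneg _
  have ht : ∀ q : {q : Sector A // z * q.elt = q.elt}, 0 < (τ (prim q.1)).re :=
    fun q => (Complex.lt_def.1 (hτ.prim_pos q.1)).1
  suffices h : _ by
    unfold inclusionNorm
    convert l2Norm_sq_eq (inclusionMatrix N z) hM ht h
  intro q
  have h1 := index_mul_prim hτ hN hE hc q.1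
  rw [← elt_mul_prim q.1, ← mul_assoc, hγ _ q.2, smul_mul_assoc, elt_mul_prim, map_smul, smul_eq_mul,
    hτ.prim_eq_re] at h1
  have h2 : ∀ a : Sector N, τ ((prim a : N) : A) =
      ((∑ p : Sector A, (mult (B := N) a (irrep p) : ℝ) * (τ (prim p)).re : ℝ) : ℂ) := fun a => by
    rw [trace_prim_sub hτ.trace]
    push_cast
    exact Finset.sum_congr rfl fun p _ => by rw [← hτ.prim_eq_re]
  simp only [h2] at h1
  have h3 : γ * (τ (prim q.1)).re = ∑ a : Sector N, (mult (B := N) a (irrep q.1) : ℝ) *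
      ∑ p : Sector A, (mult (B := N) a (irrep p) : ℝ) * (τ (prim p)).re := by
    exact_mod_cast h1
  rw [h3]
  simp only [inclusionMatrix]
  refine Eq.trans ?_ (sum_subtype_of_support (fun a : Sector N => z * (a.elt : A) = a.elt)
    (f := fun a : Sector N => (mult (B := N) a (irrep q.1) : ℝ) *
      ∑ p : Sector A, (mult (B := N) a (irrep p) : ℝ) * (τ (prim p)).re) fun a ha => ?_)
  · refine Finset.sum_congr rfl fun a _ => ?_
    congr 1
    refine sum_subtype_of_support (fun p : Sector A => z * p.elt = p.elt)
      (f := fun p : Sector A => (mult (B := N) a.1 (irrep p) : ℝ) * (τ (prim p)).re) fun p hp => ?_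
    by_cases hm : mult (B := N) a.1 (irrep p) = 0
    · rw [hm, Nat.cast_zero, zero_mul]
    · exact absurd ((mul_elt_iff_of_mult_ne_zero hz hzc hm).1 a.2) hp
  · by_cases hm : mult (B := N) a (irrep q.1) = 0
    · rw [hm, Nat.cast_zero, zero_mul]
    · exact absurd ((mul_elt_iff_of_mult_ne_zero hz hzc hm).2 q.2) ha

end Inclusion

/-! ### The inclusions of A^L and A^R at a vacuum -/

section MarkovInclusion

open Coalgebra CStarWeakHopfAlgebra

variable {A : Type*} [CStarAlgebra A] [CStarWeakHopfAlgebra A] [FiniteDimensional ℂ A]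

instance : IsSemisimpleRing (leftSub A) := isSemisimpleRing_of_star_mem fun _ => star_mem_leftSub

instance : IsSemisimpleRing (rightSub A) := isSemisimpleRing_of_star_mem fun _ => star_mem_rightSub

theorem antipode_of_mem_inf {x : A} (hx : x ∈ leftSub A ⊓ rightSub A) : antipode x = x := by
  rw [antipode_of_mem_rightSub hx.2, piL_of_mem hx.1]

theorem Vac.InHyp.mul_zR {μ : Vac A} {H : Hyp A} (h : μ.InHyp H) : H.elt * μ.zR = μ.zR := by
  have := congrArg antipode h
  have h0 : antipode H.elt = H.elt := antipode_of_mem_inf H.2.mem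
  rw [antipode_mul_rev, h0] at this
  rw [← H.comm]
  exact this

theorem isConnectedInclusion_leftSub (μ : Vac A) : IsConnectedInclusion (leftSub A) μ.zL := by
  refine ⟨μ.2.ne_zero, fun x hx hzx hcomm => ?_⟩
  have hc : x ∈ Subalgebra.center ℂ A := by
    rw [Subalgebra.mem_center_iff]
    intro y
    have hxz : x * μ.zL = x := by rw [μ.zL_comm, hzx]
    have := hcomm y
    rw [← mul_assoc, hxz, ← μ.zL_comm, mul_assoc, hzx] at this
    exact this.symm
  obtain ⟨c, h⟩ := exists_mul_elt_eq_smul hx hc μ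
  refine ⟨c, ?_⟩
  rw [← hzx, ← μ.zL_comm]
  exact h

/-- S carries A^R ∩ Center A into A^L ∩ Center A and z^R to z^L, so minimality of z^L decides the
matter. -/
theorem isConnectedInclusion_rightSub (μ : Vac A) : IsConnectedInclusion (rightSub A) μ.zR := by
  refine ⟨μ.zR_ne_zero, fun x hx hzx hcomm => ?_⟩
  have hc : x ∈ Subalgebra.center ℂ A := by
    rw [Subalgebra.mem_center_iff]
    intro y
    have hxz : x * μ.zR = x := by rw [μ.zR_comm, hzx]
    have := hcomm y
    rw [← mul_assoc, hxz, ← μ.zR_comm, mul_assoc, hzx] at this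
    exact this.symm
  obtain ⟨c, h⟩ := exists_mul_elt_eq_smul (antipode_mem_leftSub hx) (antipode_mem_center hc) μ
  refine ⟨c, antipode_injective ?_⟩
  rw [map_smul, μ.antipode_zR, ← hzx, antipode_mul_rev, μ.antipode_zR]
  exact h

theorem IsMarkovTrace.inclusion {τ : A →ₗ[ℂ] ℂ} {c : A} (h : IsMarkovTrace τ c) {γ : ℝ} {H : Hyp A}
    (hγ : c * H.elt = (γ : ℂ) • H.elt) {μ : Vac A} (hμ : μ.InHyp H) :
    inclusionNorm (leftSub A) μ.zL ^ 2 = γ ∧ inclusionNorm (rightSub A) μ.zR ^ 2 = γ := by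
  obtain ⟨E, hE, hc⟩ := h.left
  obtain ⟨E', hE', hc'⟩ := h.right
  refine ⟨inclusionNorm_sq h.trace (fun _ => star_mem_leftSub) hE hc μ.zL_mem μ.zL_mem_center
    μ.zL_idem μ.2.ne_zero fun q hq => ?_, inclusionNorm_sq h.trace (fun _ => star_mem_rightSub)
    hE' hc' μ.zR_mem μ.zR_mem_center μ.zR_idem μ.zR_ne_zero fun q hq => ?_⟩
  · have h1 : H.elt * μ.zL = μ.zL := hμ
    rw [← hq, ← h1, mul_assoc, ← mul_assoc, hγ, smul_mul_assoc]
  · rw [← hq, ← hμ.mul_zR, mul_assoc, ← mul_assoc, hγ, smul_mul_assoc]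

end MarkovInclusion

/-! ### The Galois map and the index as a convolution -/

section ConvolutionTrace

open Coalgebra CStarWeakHopfAlgebra

variable {A : Type*} [CStarAlgebra A] [CStarWeakHopfAlgebra A] [FiniteDimensional ℂ A]

/-- `x₍₁₎ ⊗ S(x₍₂₎) x₍₃₎ = (id ⊗ ⊓ᴿ)Δ(x)`. -/
theorem sum_lTensor_antipode_comul {x : A} {n : ℕ} {a b : Fin n → A}
    (h : comul (R := ℂ) x = ∑ i, a i ⊗ₜ[ℂ] b i) :
    ∑ i, antipode.lTensor A (comul (R := ℂ) (a i)) * ((1 : A) ⊗ₜ[ℂ] b i) =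
      piRₗ.lTensor A (comul (R := ℂ) x) := by
  have := coassoc_sum ((LinearMap.mul' ℂ A).lTensor A ∘ₗ (antipode.rTensor A).lTensor A) h
  refine Eq.trans ?_ (this.trans ?_)
  · refine Finset.sum_congr rfl fun i _ => ?_
    obtain ⟨m, c, d, h'⟩ := exists_tensor_rep (comul (R := ℂ) (a i))
    rw [h']
    simp [TensorProduct.sum_tmul, Finset.sum_mul]
  · rw [h, map_sum]
    refine Finset.sum_congr rfl fun i _ => ?_
    simp [piRₗ_apply, ← antipode_mul_eq]

/-- `a ⊗ v ↦ Δ(a)(1 ⊗ v)`. -/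
noncomputable def galois : A ⊗[ℂ] A →ₗ[ℂ] A ⊗[ℂ] A :=
  LinearMap.mul' ℂ (A ⊗[ℂ] A) ∘ₗ
    TensorProduct.map (comul (R := ℂ)) (TensorProduct.mk ℂ A A 1)

/-- `a ⊗ v ↦ a₍₁₎ ⊗ S(a₍₂₎) v`. -/
noncomputable def galoisInv : A ⊗[ℂ] A →ₗ[ℂ] A ⊗[ℂ] A :=
  LinearMap.mul' ℂ (A ⊗[ℂ] A) ∘ₗ
    TensorProduct.map (antipode.lTensor A ∘ₗ comul (R := ℂ)) (TensorProduct.mk ℂ A A 1)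

theorem galois_tmul (a v : A) :
    galois (a ⊗ₜ[ℂ] v) = comul (R := ℂ) a * ((1 : A) ⊗ₜ[ℂ] v) := rfl

theorem galoisInv_tmul (a v : A) :
    galoisInv (a ⊗ₜ[ℂ] v) = antipode.lTensor A (comul (R := ℂ) a) * ((1 : A) ⊗ₜ[ℂ] v) := rfl

theorem galois_comp_galoisInv : galois ∘ₗ galoisInv = LinearMap.mulLeft ℂ (Δ1 A) := by
  refine TensorProduct.ext' fun a v => ?_
  obtain ⟨n, b, c, h⟩ := exists_tensor_rep (comul (R := ℂ) a)
  rw [LinearMap.comp_apply, galoisInv_tmul, LinearMap.mulLeft_apply]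
  have : (a ⊗ₜ[ℂ] v : A ⊗[ℂ] A) = (a ⊗ₜ[ℂ] (1 : A)) * ((1 : A) ⊗ₜ[ℂ] v) := by simp
  rw [this, ← mul_assoc, ← sum_comul_antipode h, h]
  simp only [map_sum, Finset.sum_mul, LinearMap.lTensor_tmul, Algebra.TensorProduct.tmul_mul_tmul,
    mul_one, galois_tmul]
  refine Finset.sum_congr rfl fun i _ => ?_
  rw [mul_assoc, one_tmul_mul_one_tmul]

/-- The composite sends c ⊗ v to c₍₁₎ ⊗ S(c₍₂₎)c₍₃₎v. Here S(c₍₂₎)c₍₃₎ = ⊓ᴿ(c₍₂₎), and (id ⊗ ⊓ᴿ)Δ(c)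
= (c ⊗ 1)(1₍₁₎ ⊗ S(1₍₂₎)). So `galois` is inverted only up to the separability element of A^R. -/
theorem galoisInv_comp_galois {n : ℕ} {a b : Fin n → A} (h : Δ1 A = ∑ i, a i ⊗ₜ[ℂ] b i) :
    galoisInv ∘ₗ galois = ∑ i, TensorProduct.map (LinearMap.mulRight ℂ (a i))
      (LinearMap.mulLeft ℂ (antipode (b i))) := by
  refine TensorProduct.ext' fun c v => ?_
  obtain ⟨m, d, e, h'⟩ := exists_tensor_rep (comul (R := ℂ) c)
  have h1 := sum_lTensor_antipode_comul h'
  rw [lTensor_piR_comul', h] at h1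
  have h2 := congrArg (· * ((1 : A) ⊗ₜ[ℂ] v)) h1
  rw [LinearMap.comp_apply, galois_tmul, h']
  simp only [map_sum, Finset.sum_mul, Finset.mul_sum, LinearMap.lTensor_tmul, mul_assoc,
    Algebra.TensorProduct.tmul_mul_tmul, mul_one, one_mul, galoisInv_tmul] at h2 ⊢
  rw [h2, LinearMap.sum_apply]
  rfl

theorem trace_mulLeft_tensor (t : A ⊗[ℂ] A) :
    LinearMap.trace ℂ _ (LinearMap.mulLeft ℂ t) = pairing (tr A) (tr A) t := by
  induction t with
  | zero => simp
  | tmul a b =>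
    have : LinearMap.mulLeft ℂ (a ⊗ₜ[ℂ] b : A ⊗[ℂ] A) =
        TensorProduct.map (LinearMap.mulLeft ℂ a) (LinearMap.mulLeft ℂ b) :=
      TensorProduct.ext' fun c d => by simp
    rw [this, LinearMap.trace_tensorProduct', pairing_tmul]
    rfl
  | add a b ha hb =>
    have : LinearMap.mulLeft ℂ (a + b) = LinearMap.mulLeft ℂ a + LinearMap.mulLeft ℂ b :=
      LinearMap.ext fun c => add_mul a b c
    rw [this, map_add, ha, hb, map_add]

/-- Left multiplication by (1 ⊗ θ)Δ(x) factors as `galois` ∘ (x ⊗ θ) ∘ `galoisInv`. Cyclicity of the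
operator trace then brings in `galoisInv` ∘ `galois`, and the trace factors over the two legs. -/
theorem pairing_comul_eq_sum_biTr {n : ℕ} {a b : Fin n → A} (h : Δ1 A = ∑ i, a i ⊗ₜ[ℂ] b i)
    {θ : A} (hθ : θ ∈ Subalgebra.center ℂ A) (x : A) :
    pairing (tr A) (mulLeftFunctional (tr A) θ) (comul (R := ℂ) x) =
      ∑ i, biTr x (a i) * mulLeftFunctional (tr A) θ (antipode (b i)) := by
  have h0 : ∀ t : A ⊗[ℂ] A, pairing (tr A) (mulLeftFunctional (tr A) θ) t =
      pairing (tr A) (tr A) (((1 : A) ⊗ₜ[ℂ] θ) * t) := by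
    intro t
    induction t with
    | zero => simp
    | tmul a b => simp [mulLeftFunctional]
    | add a b ha hb => simp only [map_add, mul_add, ha, hb]
  have h1 : LinearMap.mulLeft ℂ (((1 : A) ⊗ₜ[ℂ] θ) * comul (R := ℂ) x) =
      galois ∘ₗ (LinearMap.mulLeft ℂ (x ⊗ₜ[ℂ] θ) ∘ₗ galoisInv) := by
    have h2 : galois ∘ₗ LinearMap.mulLeft ℂ (x ⊗ₜ[ℂ] θ) =
        LinearMap.mulLeft ℂ (((1 : A) ⊗ₜ[ℂ] θ) * comul (R := ℂ) x) ∘ₗ galois := by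
      refine TensorProduct.ext' fun c v => ?_
      simp only [LinearMap.comp_apply, LinearMap.mulLeft_apply,
        Algebra.TensorProduct.tmul_mul_tmul, galois_tmul, comul_mul]
      rw [← one_tmul_mul_one_tmul, ← mul_assoc,
        ← central_tmul_comm (Subalgebra.one_mem _) hθ (comul (R := ℂ) x * comul (R := ℂ) c)]
      simp only [mul_assoc]
    rw [← LinearMap.comp_assoc, h2, LinearMap.comp_assoc, galois_comp_galoisInv,
      ← LinearMap.mulLeft_mul, mul_assoc, ← comul_eq_mul_Δ1]
  rw [h0, ← trace_mulLeft_tensor, h1, LinearMap.trace_comp_comm', LinearMap.comp_assoc,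
    galoisInv_comp_galois h]
  change LinearMap.trace ℂ _ (LinearMap.mulLeft ℂ (x ⊗ₜ[ℂ] θ) * ∑ i, _) = _
  rw [Finset.mul_sum, map_sum]
  refine Finset.sum_congr rfl fun i _ => ?_
  have h3 : LinearMap.mulLeft ℂ (x ⊗ₜ[ℂ] θ : A ⊗[ℂ] A) =
      TensorProduct.map (LinearMap.mulLeft ℂ x) (LinearMap.mulLeft ℂ θ) :=
    TensorProduct.ext' fun c d => by simp
  rw [h3]
  change LinearMap.trace ℂ _ (TensorProduct.map _ _ ∘ₗ TensorProduct.map _ _) = _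
  rw [← TensorProduct.map_comp, LinearMap.trace_tensorProduct', ← LinearMap.mulLeft_mul]
  rfl

theorem mulLeftFunctional_trace {θ : A} (hθ : θ ∈ Subalgebra.center ℂ A) (a b : A) :
    mulLeftFunctional (tr A) θ (a * b) = mulLeftFunctional (tr A) θ (b * a) := by
  change tr A (θ * (a * b)) = tr A (θ * (b * a))
  rw [← mul_assoc, tr_mul_comm, ← mul_assoc, Subalgebra.mem_center_iff.1 hθ, mul_assoc]

theorem trace_antipode_antipode {τ : A →ₗ[ℂ] ℂ} (hτ : ∀ a b, τ (a * b) = τ (b * a)) (x : A) :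
    τ (antipode (antipode x : A)) = τ x := by
  obtain ⟨k, -, hk⟩ := exists_implements (A := A)
  rw [hk, hτ, ← mul_assoc, Units.inv_mul, one_mul]

theorem pairing_comul_antipode (f g : A →ₗ[ℂ] ℂ) (x : A) :
    pairing f g (comul (R := ℂ) (antipode x : A)) =
      pairing (g ∘ₗ antipode) (f ∘ₗ antipode) (comul (R := ℂ) x) := by
  obtain ⟨n, a, b, h⟩ := exists_tensor_rep (comul (R := ℂ) x)
  rw [comul_antipode_eq h, h]
  simp [mul_comm]

theorem tr_comp_antipode : tr A ∘ₗ antipode = tr A := LinearMap.ext tr_antipode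

theorem mulLeftFunctional_comp_antipode (θ : A) :
    mulLeftFunctional (tr A) θ ∘ₗ antipode = mulLeftFunctional (tr A) (antipodeInv θ) := by
  refine LinearMap.ext fun x => ?_
  change tr A (θ * antipode x) = tr A (antipodeInv θ * x)
  conv_lhs => rw [← antipode_antipodeInv θ, ← antipode_mul_rev, tr_antipode, tr_mul_comm]

theorem pairing_comul_eq_sum_biTr' {n : ℕ} {a b : Fin n → A} (h : Δ1 A = ∑ i, a i ⊗ₜ[ℂ] b i)
    {θ : A} (hθ : θ ∈ Subalgebra.center ℂ A) (y : A) :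
    pairing (mulLeftFunctional (tr A) θ) (tr A) (comul (R := ℂ) y) =
      ∑ i, biTr y (antipode (a i)) * mulLeftFunctional (tr A) θ (b i) := by
  obtain ⟨x, rfl⟩ : ∃ x, antipode x = y := ⟨_, antipode_antipodeInv y⟩
  rw [pairing_comul_antipode, tr_comp_antipode, mulLeftFunctional_comp_antipode,
    pairing_comul_eq_sum_biTr h (antipodeInv_mem_center hθ), ← mulLeftFunctional_comp_antipode]
  refine Finset.sum_congr rfl fun i _ => ?_
  rw [LinearMap.comp_apply, trace_antipode_antipode (mulLeftFunctional_trace hθ), biTr_antipode,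
    biTr_comm]

/-- The index of the `τ`-preserving conditional expectation onto `Aᴿ`. -/
theorem trace_index_rightSub {θ : A} (hθ : θ ∈ Subalgebra.center ℂ A)
    (hτ : IsFaithfulTrace (mulLeftFunctional (tr A) θ)) :
    ∃ E c, IsCondExp (mulLeftFunctional (tr A) θ) (rightSub A) E ∧ HasIndex E c ∧
      ∀ x, mulLeftFunctional (tr A) θ (c * x) =
        pairing (tr A) (mulLeftFunctional (tr A) θ) (comul (R := ℂ) x) := by
  obtain ⟨E, c, hE, hc, -, h⟩ := exists_condExp_index hτ fun _ => star_mem_rightSub (A := A)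
  refine ⟨E, c, hE, hc, fun x => ?_⟩
  obtain ⟨n, r, l, hr, hl, h1⟩ := exists_Δ1_rep (A := A)
  -- The Galois trace formula is matched with the index formula for the separability element 1₍₁₎ ⊗
  -- S(1₍₂₎) of A^R.
  rw [pairing_comul_eq_sum_biTr h1 hθ]
  refine h r (fun i => antipode (l i)) hr (fun i => antipode_mem_rightSub (hl i)) (fun y hy => ?_)
    (sum_Δ1_mul_antipode h1) x
  simpa [h1, Finset.sum_mul, Finset.mul_sum] using right_separability hy

/-- The index of the `τ`-preserving conditional expectation onto `Aᴸ`. -/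
theorem trace_index_leftSub {θ : A} (hθ : θ ∈ Subalgebra.center ℂ A)
    (hτ : IsFaithfulTrace (mulLeftFunctional (tr A) θ)) :
    ∃ E c, IsCondExp (mulLeftFunctional (tr A) θ) (leftSub A) E ∧ HasIndex E c ∧
      ∀ x, mulLeftFunctional (tr A) θ (c * x) =
        pairing (mulLeftFunctional (tr A) θ) (tr A) (comul (R := ℂ) x) := by
  obtain ⟨E, c, hE, hc, -, h⟩ := exists_condExp_index hτ fun _ => star_mem_leftSub (A := A)
  refine ⟨E, c, hE, hc, fun x => ?_⟩
  obtain ⟨n, r, l, hr, hl, h1⟩ := exists_Δ1_rep (A := A)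
  rw [pairing_comul_eq_sum_biTr' h1 hθ]
  refine h (fun i => antipode (r i)) l (fun i => antipode_mem_leftSub (hr i)) hl (fun y hy => ?_)
    (sum_Δ1_antipode_mul h1) x
  simpa [h1, Finset.sum_mul, Finset.mul_sum] using left_separability hy

theorem biTr_of_central {c : A} (hc : c ∈ Subalgebra.center ℂ A) (x : A) :
    biTr c x = tr A (c * x) := by
  rw [← biTr_one, biTr_comm (c * x)]
  rw [biTr, biTr]
  congr 1
  refine LinearMap.ext fun y => ?_
  change c * (y * x) = 1 * (y * (c * x))
  rw [one_mul, ← mul_assoc y, Subalgebra.mem_center_iff.1 hc, mul_assoc]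

/-- For central c and θ both sides are ∑ tr(c 1₍₁₎)tr(θS(1₍₂₎)), because Δ(1) is invariant under S ⊗
S followed by the flip and traces do not see S². This lets the index at c be computed from the
coproduct of the density θ. -/
theorem pairing_comul_central {c θ : A} (hc : c ∈ Subalgebra.center ℂ A)
    (hθ : θ ∈ Subalgebra.center ℂ A) :
    pairing (tr A) (mulLeftFunctional (tr A) θ) (comul (R := ℂ) c) =
      pairing (tr A) (mulLeftFunctional (tr A) c) (comul (R := ℂ) θ) := by
  obtain ⟨n, a, b, h⟩ := exists_tensor_rep (Δ1 A)
  rw [pairing_comul_eq_sum_biTr h hθ, pairing_comul_eq_sum_biTr (antipode_flip_Δ1 h).symm hc]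
  refine Finset.sum_congr rfl fun i _ => ?_
  rw [biTr_of_central hc, biTr_of_central hθ, trace_antipode_antipode (mulLeftFunctional_trace hc),
    mul_comm]
  rfl

end ConvolutionTrace

/-! ### The vacuum matrix, its symmetry and its irreducible blocks -/

section VacuumMatrix

open Coalgebra CStarWeakHopfAlgebra

variable {A : Type*} [CStarAlgebra A] [CStarWeakHopfAlgebra A] [FiniteDimensional ℂ A]

theorem Vac.hyp_mul_zL (μ : Vac A) (H : Hyp A) : H.elt * μ.zL = 0 ∨ μ.InHyp H := by
  refine μ.2.minimal _ (Subalgebra.mul_mem _ H.2.mem.1 μ.zL_mem)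
    (Subalgebra.mul_mem _ H.2.central μ.zL_mem_center) ?_ ?_
  · rw [mul_assoc, ← mul_assoc _ H.elt, H.comm, mul_assoc, μ.zL_idem, ← mul_assoc, H.idem]
  · exact (mul_assoc _ _ _).trans (congrArg _ μ.zL_idem)

theorem Vac.exists_inHyp (μ : Vac A) : ∃ H, μ.InHyp H := by
  by_contra! h
  refine μ.2.ne_zero ?_
  change μ.zL = 0
  rw [← one_mul μ.zL, ← sum_elt (leftSub A ⊓ rightSub A), Finset.sum_mul]
  exact Finset.sum_eq_zero fun H _ => (μ.hyp_mul_zL H).resolve_right (h H)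

theorem exists_inHyp (H : Hyp A) : ∃ μ : Vac A, μ.InHyp H := by
  by_contra! h
  refine H.2.ne_zero ?_
  change H.elt = 0
  rw [← mul_one H.elt, ← Vac.sum_zL, Finset.mul_sum]
  exact Finset.sum_eq_zero fun μ _ => (μ.hyp_mul_zL H).resolve_right (h μ)

theorem inHyp_unique {μ : Vac A} {H K : Hyp A} (h : μ.InHyp H) (h' : μ.InHyp K) : H = K := by
  by_contra hne
  refine μ.2.ne_zero ?_
  change μ.zL = 0
  have h1 : H.elt * μ.zL = μ.zL := h
  have h2 : K.elt * μ.zL = μ.zL := h'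
  rw [← h1, ← h2, ← mul_assoc, MinCentralIdem.mul_eq_zero H K hne, zero_mul]

theorem leftVac_inHyp_iff {q : Sector A} {H : Hyp A} :
    (leftVac q).InHyp H ↔ H.elt * q.elt = q.elt := by
  refine ⟨fun h => ?_, fun h => ((leftVac q).hyp_mul_zL H).resolve_left fun h0 => ?_⟩
  · have h1 : H.elt * (leftVac q).zL = (leftVac q).zL := h
    rw [← zL_leftVac_mul q, ← mul_assoc, h1]
  · refine q.2.ne_zero (h.symm.trans ?_)
    rw [← zL_leftVac_mul q, ← mul_assoc, h0, zero_mul]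

theorem rightVac_inHyp_iff {q : Sector A} {H : Hyp A} :
    (rightVac q).InHyp H ↔ H.elt * q.elt = q.elt := by
  refine ⟨fun h => ?_, fun h => ((rightVac q).hyp_mul_zL H).resolve_left fun h0 => ?_⟩
  · rw [← zR_rightVac_mul q, ← mul_assoc, h.mul_zR]
  · have h1 := congrArg antipode h0
    have h2 : antipode H.elt = H.elt := antipode_of_mem_inf H.2.mem
    rw [antipode_mul_rev, h2, map_zero, H.comm] at h1
    refine q.2.ne_zero (h.symm.trans ?_)
    rw [← zR_rightVac_mul q, ← mul_assoc]
    exact (congrArg (· * q.elt) h1).trans (zero_mul _)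

open Classical in
/-- The matrix `∑ D_q`, summed over the sectors with given left and right vacua. -/
noncomputable def vacMatrix (D : Sector A → ℝ) : Matrix (Vac A) (Vac A) ℝ :=
  fun μ ν => ∑ q : Sector A with leftVac q = μ ∧ rightVac q = ν, D q

open Classical in
theorem sum_elt_vac (μ ν : Vac A) :
    ∑ q : Sector A with leftVac q = μ ∧ rightVac q = ν, q.elt = μ.zL * ν.zR := by
  have h := sum_elt (⊤ : Subalgebra ℂ A)
  rw [← mul_one (μ.zL * ν.zR), ← h, Finset.mul_sum, Finset.sum_filter]
  refine Finset.sum_congr rfl fun q _ => ?_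
  rw [mul_assoc]
  split_ifs with hq
  · rw [← hq.1, ← hq.2, zR_rightVac_mul, zL_leftVac_mul]
  · rw [not_and_or] at hq
    rcases hq with hq | hq
    · rw [← mul_assoc, Vac.zR_comm, mul_assoc, zL_mul_elt_of_ne (Ne.symm hq), mul_zero]
    · rw [zR_mul_elt_of_ne (Ne.symm hq), mul_zero]

variable {g : Aˣ} {D : Sector A → ℝ}

theorem IsBalanced.antipode_inv (h : IsBalanced g D) : antipode (↑g⁻¹ : A) = g := by
  rw [← h.antipode_eq, h.implements, mul_assoc, Units.mul_inv, mul_one]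

theorem IsBalanced.vacMatrix_mul_left (h : IsBalanced g D) (μ ν : Vac A) :
    (vacMatrix D μ ν : ℂ) * counit (R := ℂ) ν.zL = tr A (↑g⁻¹ * (μ.zL * ν.zR)) := by
  classical
  rw [← sum_elt_vac, Finset.mul_sum, map_sum, vacMatrix, Complex.ofReal_sum, Finset.sum_mul]
  refine Finset.sum_congr (by congr) fun q hq => ?_
  rw [h.tr_inv_mul_elt, (Finset.mem_filter.1 hq).2.2]

theorem IsBalanced.vacMatrix_mul_right (h : IsBalanced g D) (μ ν : Vac A) :
    (vacMatrix D μ ν : ℂ) * counit (R := ℂ) μ.zL = tr A (g * (μ.zL * ν.zR)) := by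
  classical
  rw [← sum_elt_vac, Finset.mul_sum, map_sum, vacMatrix, Complex.ofReal_sum, Finset.sum_mul]
  refine Finset.sum_congr (by congr) fun q hq => ?_
  rw [h.tr_mul_elt, (Finset.mem_filter.1 hq).2.1]

/-- The entry at (μ, ν) times ε(z_ν^L) is tr(g⁻¹z_μ^L z_ν^R). The trace is S-invariant, and S turns
the argument into that of tr(g z_ν^L z_μ^R), which computes the transposed entry times the same
weight. -/
theorem IsBalanced.vacMatrix_symm (h : IsBalanced g D) (μ ν : Vac A) :
    vacMatrix D μ ν = vacMatrix D ν μ := by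
  have h1 := h.vacMatrix_mul_left μ ν
  rw [← tr_antipode, antipode_mul_rev, antipode_mul_rev, h.antipode_inv, ν.antipode_zR,
    tr_mul_comm] at h1
  have h2 := h1.trans (h.vacMatrix_mul_right ν μ).symm
  exact_mod_cast mul_right_cancel₀ (counit_zL_pos ν).ne' h2

theorem IsBalanced.vacMatrix_nonneg (h : IsBalanced g D) (μ ν : Vac A) : 0 ≤ vacMatrix D μ ν :=
  Finset.sum_nonneg fun q _ => (h.dim_pos q).le

theorem IsBalanced.vacMatrix_pos (h : IsBalanced g D) (q : Sector A) :
    0 < vacMatrix D (leftVac q) (rightVac q) := by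
  classical
  exact Finset.sum_pos (fun q _ => h.dim_pos q) ⟨q, Finset.mem_filter.2 ⟨Finset.mem_univ _, rfl, rfl⟩⟩

theorem vacMatrix_eq_zero {μ ν : Vac A} {H : Hyp A} (hμ : μ.InHyp H) (hν : ¬ ν.InHyp H) :
    vacMatrix D μ ν = 0 := by
  classical
  refine Finset.sum_eq_zero fun q hq => ?_
  obtain ⟨-, rfl, rfl⟩ := Finset.mem_filter.1 hq
  exact absurd (rightVac_inHyp_iff.2 (leftVac_inHyp_iff.1 hμ)) hν

/-- No sector joins U to its complement in the block, so the left vacuum of a sector is in U exactly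
when its right vacuum is. Hence z = ∑_{μ∈U} z_μ^L satisfies S(z) = z and lies in the hypercenter
below z_H; being nonzero, it equals z_H. -/
theorem IsBalanced.block_irreducible (h : IsBalanced g D) {H : Hyp A} {U : Set (Vac A)}
    (hUH : ∀ μ ∈ U, μ.InHyp H) (hU : U.Nonempty)
    (hD : ∀ μ ∈ U, ∀ ν, ν.InHyp H → ν ∉ U → vacMatrix D μ ν = 0) {μ : Vac A} (hμ : μ.InHyp H) :
    μ ∈ U := by
  classical
  have hlr : ∀ q : Sector A, leftVac q ∈ U → rightVac q ∈ U := fun q hq => by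
    by_contra hn
    exact (h.vacMatrix_pos q).ne'
      (hD _ hq _ (rightVac_inHyp_iff.2 (leftVac_inHyp_iff.1 (hUH _ hq))) hn)
  have hrl : ∀ q : Sector A, rightVac q ∈ U → leftVac q ∈ U := fun q hq => by
    by_contra hn
    refine (h.vacMatrix_pos q).ne' ?_
    rw [h.vacMatrix_symm]
    exact hD _ hq _ (leftVac_inHyp_iff.2 (rightVac_inHyp_iff.1 (hUH _ hq))) hn
  set c : Vac A → ℂ := fun μ => if μ ∈ U then 1 else 0 with hc
  set z : A := diag c with hz
  have hzS : antipode z = z := eq_of_mul_elt_eq fun q => by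
    rw [(IsBalanced.weight_mul_elt c q).1, (IsBalanced.weight_mul_elt c q).2, hc]
    simp only [show rightVac q ∈ U ↔ leftVac q ∈ U from ⟨hrl q, hlr q⟩]
  have hzL : z ∈ leftSub A := diag_mem _
  have hzc : z ∈ Subalgebra.center ℂ A := diag_mem_center _
  have hzR : z ∈ rightSub A := hzS ▸ antipode_mem_rightSub hzL
  have hzz : z * z = z := by
    rw [hz, diag_mul_diag]; congr 1; ext μ; simp [hc]
  have hzH : z * H.elt = z := by
    rw [H.comm, hz, diag, Finset.mul_sum]
    refine Finset.sum_congr rfl fun μ _ => ?_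
    by_cases hμU : μ ∈ U
    · have h1 : H.elt * μ.elt = μ.elt := hUH μ hμU
      rw [mul_smul_comm, h1]
    · simp [hc, hμU]
  have hmul : ∀ μ : Vac A, z * μ.zL = c μ • μ.zL := fun μ => diag_mul_elt c μ
  rcases H.2.minimal z ⟨hzL, hzR⟩ hzc hzz hzH with h0 | h0
  · obtain ⟨ν, hν⟩ := hU
    have := hmul ν
    rw [h0, zero_mul, hc] at this
    simp only [hν, if_true, one_smul] at this
    exact absurd this.symm ν.2.ne_zero
  · have h1 := hmul μ
    have h2 : z * μ.zL = μ.zL := by rw [h0]; exact hμ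
    by_contra hn
    rw [h2, hc] at h1
    simp only [hn, if_false, zero_smul] at h1
    exact μ.2.ne_zero h1

/-- The blocks of the matrix `∑ D_q` have Perron–Frobenius eigenvectors. -/
theorem IsBalanced.exists_weights (h : IsBalanced g D) : ∃ f : Vac A → ℝ, (∀ μ, 0 < f μ) ∧
    ∀ (H : Hyp A) (μ : Vac A), μ.InHyp H →
      ∑ ν, vacMatrix D μ ν * f ν = blockNorm (vacMatrix D) H * f μ := by
  classical
  have key : ∀ H : Hyp A, ∃ f : {μ : Vac A // μ.InHyp H} → ℝ, (∀ i, 0 < f i) ∧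
      ∀ i, ∑ j, vacMatrix D i.1 j.1 * f j = blockNorm (vacMatrix D) H * f i := by
    intro H
    have : Nonempty {μ : Vac A // μ.InHyp H} := nonempty_subtype.2 (exists_inHyp H)
    obtain ⟨f, hf, he⟩ := exists_pos_eigenvector (M := (vacMatrix D).submatrix
      (fun μ : {μ : Vac A // μ.InHyp H} => μ.1) fun ν : {ν : Vac A // ν.InHyp H} => ν.1)
      (fun i j => h.vacMatrix_nonneg _ _) (fun i j => h.vacMatrix_symm _ _) fun U hU hM => by
        refine Set.eq_univ_of_forall fun μ => ?_
        have := h.block_irreducible (H := H) (U := Subtype.val '' U) (by rintro _ ⟨i, -, rfl⟩; exact i.2)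
          (hU.image _) (by
            rintro _ ⟨i, hi, rfl⟩ ν hν hn
            exact hM i hi ⟨ν, hν⟩ fun hν' => hn ⟨_, hν', rfl⟩) μ.2
        obtain ⟨i, hi, hiμ⟩ := this
        rwa [← Subtype.ext hiμ]
    refine ⟨f, hf, fun i => ?_⟩
    rw [blockNorm]
    convert he i
    rfl
  choose f hf he using key
  choose hyp hhyp using fun μ : Vac A => μ.exists_inHyp
  refine ⟨fun μ => f (hyp μ) ⟨μ, hhyp μ⟩, fun μ => hf _ _, fun H μ hμ => ?_⟩
  obtain rfl := inHyp_unique (hhyp μ) hμ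
  rw [← he (hyp μ) ⟨μ, hμ⟩, ← sum_subtype_of_support (fun ν : Vac A => ν.InHyp (hyp μ)) fun ν hν => by
    rw [vacMatrix_eq_zero hμ hν, zero_mul]]
  refine Finset.sum_congr rfl fun ν _ => ?_
  congr 1
  have : ∀ (K : Hyp A) (hK : ν.1.InHyp K) (e : K = hyp μ), f K ⟨ν.1, hK⟩ = f (hyp μ) ν := by
    rintro K hK rfl; rfl
  exact this _ _ (inHyp_unique (hhyp ν.1) ν.2)

end VacuumMatrix

/-! ### Construction of the Markov trace -/

section MarkovTrace

open Coalgebra CStarWeakHopfAlgebra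

theorem trace_ext {A : Type*} [CStarAlgebra A] [FiniteDimensional ℂ A] {σ τ : A →ₗ[ℂ] ℂ}
    (hσ : ∀ a b, σ (a * b) = σ (b * a)) (hτ : ∀ a b, τ (a * b) = τ (b * a))
    (h : ∀ q : Sector A, σ q.elt = τ q.elt) : σ = τ := by
  refine LinearMap.ext fun x => ?_
  rw [trace_eq_sum hσ, trace_eq_sum hτ]
  refine Finset.sum_congr rfl fun q _ => ?_
  have := h q
  rw [← q.idem, trace_mul_elt hσ, trace_mul_elt hτ] at this
  rw [mul_right_cancel₀ (modTr_irrep_elt_pos q).ne' this]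

theorem IsFaithfulTrace.comp_mulLeft {A : Type*} [CStarAlgebra A] {τ : A →ₗ[ℂ] ℂ}
    (hτ : IsFaithfulTrace τ) {r : A} (hr : r ∈ Subalgebra.center ℂ A) (hs : Star.star r = r)
    {r' : A} (hr' : r * r' = 1) : IsFaithfulTrace (mulLeftFunctional τ (r * r)) where
  trace a b := by
    change τ (r * r * (a * b)) = τ (r * r * (b * a))
    rw [← mul_assoc, hτ.trace, ← mul_assoc, Subalgebra.mem_center_iff.1 (Subalgebra.mul_mem _ hr hr),
      mul_assoc]
  pos a ha := by
    have h : r * r * (Star.star a * a) = Star.star (a * r) * (a * r) := by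
      rw [star_mul, hs, Subalgebra.mem_center_iff.1 hr a]
      simp only [mul_assoc]
      rw [← mul_assoc (Star.star a) r a, Subalgebra.mem_center_iff.1 hr (Star.star a), mul_assoc]
    change 0 < τ (r * r * (Star.star a * a))
    rw [h]
    refine hτ.pos _ fun h0 => ha ?_
    rw [← mul_one a, ← hr', ← mul_assoc, h0, zero_mul]

theorem IsFaithfulTrace.comp_diag {A : Type*} [CStarAlgebra A] [FiniteDimensional ℂ A]
    {τ : A →ₗ[ℂ] ℂ} (hτ : IsFaithfulTrace τ) {C : Subalgebra ℂ A} {c : MinCentralIdem C → ℝ}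
    (hc : ∀ e, 0 < c e) : IsFaithfulTrace (mulLeftFunctional τ (diag fun e => (c e : ℂ))) := by
  have h0 : ∀ e, ((Real.sqrt (c e) : ℝ) : ℂ) ≠ 0 := fun e => by
    exact_mod_cast (Real.sqrt_pos.2 (hc e)).ne'
  have h1 : (diag fun e : MinCentralIdem C => (c e : ℂ)) =
      diag (fun e => ((Real.sqrt (c e) : ℝ) : ℂ)) * diag fun e => ((Real.sqrt (c e) : ℝ) : ℂ) := by
    rw [diag_mul_diag]
    congr 1; ext e
    rw [← Complex.ofReal_mul, Real.mul_self_sqrt (hc e).le]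
  rw [h1]
  refine hτ.comp_mulLeft (diag_mem_center _) ?_ (diag_mul_inv h0)
  rw [star_diag]
  congr 1; ext e
  exact Complex.conj_ofReal _

theorem IsCondExp.comp_mulLeft {A : Type*} [CStarAlgebra A] {τ : A →ₗ[ℂ] ℂ} {N : Subalgebra ℂ A}
    {E : A →ₗ[ℂ] A} (h : IsCondExp τ N E) {s : A} (hs : s ∈ N) :
    IsCondExp (mulLeftFunctional τ s) N E :=
  { h with
    preserves := fun a => by
      change τ (s * E a) = τ (s * a)
      rw [← h.mul_left s hs, h.preserves] }

variable {A : Type*} [CStarAlgebra A] [CStarWeakHopfAlgebra A] [FiniteDimensional ℂ A]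
variable {g : Aˣ} {D : Sector A → ℝ}

theorem diag_mul_zL (c : Hyp A → ℂ) {H : Hyp A} {μ : Vac A} (h : μ.InHyp H) :
    diag c * μ.zL = c H • μ.zL := by
  have h1 : H.elt * μ.zL = μ.zL := h
  rw [← h1, ← mul_assoc, diag_mul_elt, smul_mul_assoc]

namespace IsBalanced

theorem comul_inv (h : IsBalanced g D) :
    comul (R := ℂ) (↑g⁻¹ : A) = Δ1 A * ((↑g⁻¹ : A) ⊗ₜ[ℂ] (↑g⁻¹ : A)) := by
  have h2 : comul (R := ℂ) (↑g⁻¹ : A) * ((g : A) ⊗ₜ[ℂ] (g : A)) = Δ1 A := by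
    rw [comul_eq_mul_Δ1, mul_assoc, ← h.comul_eq', ← comul_mul, Units.inv_mul]; rfl
  rw [← h2, mul_assoc, tmul_mul_inv, mul_one]

variable {f : Vac A → ℝ} {ι : Hyp A → ℝ}

/-- The sector q contributes f_{q^L} D_q times z^L of q^R. The coefficient of z_ν^L is therefore a
column sum of the vacuum matrix against f; symmetry and the eigenvector equation turn it into ι f_ν.
-/
theorem sliceL_weights (h : IsBalanced g D) (hf : ∀ (H : Hyp A) (μ : Vac A), μ.InHyp H →
      ∑ ν, vacMatrix D μ ν * f ν = ι H * f μ) :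
    sliceL (tr A) (((↑g⁻¹ * diag fun μ : Vac A => (f μ : ℂ)) ⊗ₜ[ℂ] (1 : A)) * Δ1 A) =
      (diag fun H : Hyp A => (ι H : ℂ)) * diag fun μ : Vac A => (f μ : ℂ) := by
  classical
  have h1 : (↑g⁻¹ * diag fun μ : Vac A => (f μ : ℂ) : A) =
      ∑ q : Sector A, (f (leftVac q) : ℂ) • (↑g⁻¹ * q.elt : A) := by
    conv_lhs => rw [← mul_one (diag _), ← sum_elt (⊤ : Subalgebra ℂ A)]
    rw [Finset.mul_sum, Finset.mul_sum]
    refine Finset.sum_congr rfl fun q _ => ?_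
    rw [(weight_mul_elt _ q).1, mul_smul_comm]
  have h2 : ∀ ν : Vac A, (diag fun H : Hyp A => (ι H : ℂ)) * ((f ν : ℂ) • ν.zL) =
      ∑ μ, ∑ q : Sector A, if leftVac q = μ ∧ rightVac q = ν then ((D q : ℂ) * f μ) • ν.zL else 0 := by
    intro ν
    obtain ⟨H, hH⟩ := ν.exists_inHyp
    rw [mul_smul_comm, diag_mul_zL _ hH, smul_smul, mul_comm, ← Complex.ofReal_mul, ← hf H ν hH]
    push_cast
    rw [Finset.sum_smul]
    refine Finset.sum_congr rfl fun μ _ => ?_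
    rw [h.vacMatrix_symm, vacMatrix, Complex.ofReal_sum, Finset.sum_mul, Finset.sum_smul,
      Finset.sum_filter]
  conv_rhs => enter [2]; rw [diag]
  rw [Finset.mul_sum]
  refine Eq.trans ?_ (Finset.sum_congr rfl fun ν _ => (h2 ν).symm)
  rw [h1, TensorProduct.sum_tmul, Finset.sum_mul, map_sum]
  rw [Finset.sum_congr rfl fun ν _ => Finset.sum_comm, Finset.sum_comm]
  refine Finset.sum_congr rfl fun q _ => ?_
  rw [← TensorProduct.smul_tmul', smul_mul_assoc, map_smul, h.left, smul_smul,
    Finset.sum_eq_single (rightVac q), Finset.sum_eq_single (leftVac q)]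
  · simp [mul_comm]
  · intro μ _ hμ
    simp [hμ.symm]
  · simp
  · intro ν _ hν
    simp [hν.symm]
  · simp

/-- The pairing with a central element, in terms of the Perron–Frobenius weights. -/
theorem pairing_comul_weights (h : IsBalanced g D) (hf : ∀ (H : Hyp A) (μ : Vac A), μ.InHyp H →
      ∑ ν, vacMatrix D μ ν * f ν = ι H * f μ) (c : A) {n' : A} (hn : n' ∈ rightSub A) (hnc : n' ∈ Subalgebra.center ℂ A) :
    pairing (tr A) (mulLeftFunctional (tr A) c)
      (comul (R := ℂ) ((diag fun μ : Vac A => (f μ : ℂ)) * (n' * ↑g⁻¹))) =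
      tr A (c * ((diag fun H : Hyp A => (ι H : ℂ)) * ((diag fun μ : Vac A => (f μ : ℂ)) *
        (n' * ↑g⁻¹)))) := by
  set F : A := diag fun μ : Vac A => (f μ : ℂ) with hF
  have hFL : F ∈ leftSub A := diag_mem _
  have hFc : F ∈ Subalgebra.center ℂ A := diag_mem_center _
  have hFg := Subalgebra.mem_center_iff.1 hFc (↑g⁻¹ : A)
  have h0 : ∀ t : A ⊗[ℂ] A, pairing (tr A) (mulLeftFunctional (tr A) c) t =
      pairing (tr A) (tr A) (((1 : A) ⊗ₜ[ℂ] c) * t) := by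
    intro t
    induction t with
    | zero => simp
    | tmul a b => simp [mulLeftFunctional]
    | add a b ha hb => simp only [map_add, mul_add, ha, hb]
  -- Factors from A^L and A^R leave Δ on the first and second leg respectively, and Δ(g⁻¹) =
  -- Δ(1)(g⁻¹ ⊗ g⁻¹). The first leg then carries exactly the slice evaluated in `sliceL_weights`.
  rw [comul_mul_left hFL, comul_mul_right hn, h.comul_inv, h0]
  have h1 : ((1 : A) ⊗ₜ[ℂ] c) * ((F ⊗ₜ[ℂ] (1 : A)) * (((1 : A) ⊗ₜ[ℂ] n') *
      (Δ1 A * ((↑g⁻¹ : A) ⊗ₜ[ℂ] (↑g⁻¹ : A))))) =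
      ((F ⊗ₜ[ℂ] (c * n')) * Δ1 A) * ((↑g⁻¹ : A) ⊗ₜ[ℂ] (↑g⁻¹ : A)) := by
    simp only [← mul_assoc, Algebra.TensorProduct.tmul_mul_tmul, one_mul, mul_one]
  have h2 : ((↑g⁻¹ : A) ⊗ₜ[ℂ] (↑g⁻¹ : A)) * ((F ⊗ₜ[ℂ] (c * n')) * Δ1 A) =
      ((1 : A) ⊗ₜ[ℂ] (↑g⁻¹ * (c * n') : A)) * (((↑g⁻¹ * F : A) ⊗ₜ[ℂ] (1 : A)) * Δ1 A) := by
    simp only [← mul_assoc, Algebra.TensorProduct.tmul_mul_tmul, one_mul, mul_one]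
  rw [h1, pairing_trace tr_mul_comm tr_mul_comm, h2, ← apply_sliceL, sliceL_mul_left,
    h.sliceL_weights hf, ← hF]
  rw [mul_assoc, tr_mul_comm, mul_assoc c n', ← Subalgebra.mem_center_iff.1 hnc]
  simp only [mul_assoc]

variable (D f) in
/-- The central density of the Markov trace with respect to the trace of the regular
representation. -/
noncomputable def density : A :=
  diag fun q : Sector A => ((f (leftVac q) * f (rightVac q) * D q / (tr A q.elt).re : ℝ) : ℂ)

variable (f) in
/-- The element `f^L f^R n_R⁻¹ g⁻¹` which has the same central component as the density of the
Markov trace. -/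
noncomputable def weightElt (g : Aˣ) : A :=
  (diag fun μ : Vac A => (f μ : ℂ)) *
    (antipode (diag fun μ : Vac A => (f μ : ℂ) * (counit (R := ℂ) μ.zL)⁻¹) * ↑g⁻¹)

theorem density_mem_center : density D f ∈ Subalgebra.center ℂ A := diag_mem_center _

theorem tr_density_mul_elt (q : Sector A) :
    tr A (density D f * q.elt) = f (leftVac q) * f (rightVac q) * D q := by
  have h1 : ((tr A q.elt).re : ℂ) = tr A q.elt :=
    (Complex.eq_re_of_ofReal_le (r := 0) (tr_elt_pos q).le).symm
  rw [density, diag_mul_elt, map_smul, smul_eq_mul]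
  push_cast
  rw [h1, div_mul_cancel₀ _ (tr_elt_pos q).ne']

theorem tr_weightElt_mul_elt (h : IsBalanced g D) (q : Sector A) :
    tr A (weightElt f g * q.elt) = f (leftVac q) * f (rightVac q) * D q := by
  have h1 : weightElt f g * q.elt =
      ((f (leftVac q) : ℂ) * (f (rightVac q) * (counit (R := ℂ) (rightVac q).zL)⁻¹)) •
        (↑g⁻¹ * q.elt : A) := by
    rw [weightElt, mul_assoc, mul_assoc, q.comm, ← mul_assoc (antipode _), (weight_mul_elt _ q).2,
      smul_mul_assoc, mul_smul_comm, ← mul_assoc, (weight_mul_elt _ q).1, smul_mul_assoc, smul_smul,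
      mul_comm]
  rw [h1, map_smul, h.tr_inv_mul_elt, smul_eq_mul]
  field_simp [(counit_zL_pos (rightVac q)).ne']

theorem tr_antipode_weightElt_mul_elt (h : IsBalanced g D) (q : Sector A) :
    tr A (antipode (weightElt f g) * q.elt) = f (leftVac q) * f (rightVac q) * D q := by
  have h1 : antipode (weightElt f g) * q.elt =
      ((f (rightVac q) : ℂ) * (f (leftVac q) * (counit (R := ℂ) (leftVac q).zL)⁻¹)) •
        (g * q.elt : A) := by
    rw [weightElt, antipode_mul_rev, antipode_mul_rev, h.antipode_inv,
      antipode_antipode_of_central (diag_mem _) (diag_mem_center _), mul_assoc,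
      (weight_mul_elt _ q).2, mul_smul_comm, mul_assoc, (weight_mul_elt _ q).1, mul_smul_comm,
      smul_smul]
  rw [h1, map_smul, h.tr_mul_elt, smul_eq_mul]
  field_simp [(counit_zL_pos (leftVac q)).ne']

/-- `weightElt` and its image under S have on every sector the same regular trace f_{q^L} f_{q^R}
D_q as the density, and tr is S-invariant. -/
theorem density_comp_antipode (h : IsBalanced g D) :
    mulLeftFunctional (tr A) (density D f) ∘ₗ antipode = mulLeftFunctional (tr A) (density D f) := by
  have hθ := density_mem_center (D := D) (f := f)
  refine trace_ext (fun a b => ?_) (mulLeftFunctional_trace hθ) fun q => ?_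
  · rw [LinearMap.comp_apply, LinearMap.comp_apply, antipode_mul_rev, antipode_mul_rev,
      mulLeftFunctional_trace hθ]
  · have hc := antipode_mem_center q.2.central
    have h1 : mulLeftFunctional (tr A) (antipode q.elt) (density D f) =
        mulLeftFunctional (tr A) (antipode q.elt) (weightElt f g) :=
      trace_eq_of_tr_elt (mulLeftFunctional_trace hc) fun p => by
        rw [tr_density_mul_elt, h.tr_weightElt_mul_elt]
    change tr A (density D f * antipode q.elt) = tr A (density D f * q.elt)
    rw [tr_mul_comm]
    refine h1.trans ?_
    change tr A (antipode q.elt * weightElt f g) = _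
    rw [tr_density_mul_elt, ← h.tr_antipode_weightElt_mul_elt, ← tr_antipode (antipode q.elt * _),
      antipode_mul_rev, h.implements, q.comm, mul_assoc q.elt, Units.mul_inv, mul_one]

/-- By `pairing_comul_central` the density moves under the coproduct. There only its sector traces
matter, so it may be exchanged for `weightElt`, whose coproduct is explicit, and exchanged back
afterwards. -/
theorem pairing_density_central (h : IsBalanced g D) (hf : ∀ (H : Hyp A) (μ : Vac A), μ.InHyp H →
      ∑ ν, vacMatrix D μ ν * f ν = ι H * f μ) {c : A} (hc : c ∈ Subalgebra.center ℂ A) :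
    pairing (tr A) (mulLeftFunctional (tr A) (density D f)) (comul (R := ℂ) c) =
      mulLeftFunctional (tr A) (density D f) ((diag fun H : Hyp A => (ι H : ℂ)) * c) := by
  have hI : (diag fun H : Hyp A => (ι H : ℂ)) ∈ Subalgebra.center ℂ A := diag_mem_center _
  have hP : ∀ q : Sector A, tr A (density D f * q.elt) = tr A (weightElt f g * q.elt) := fun q => by
    rw [tr_density_mul_elt, h.tr_weightElt_mul_elt]
  let κ : A →ₗ[ℂ] ℂ := pairing (tr A) (mulLeftFunctional (tr A) c) ∘ₗ comul (R := ℂ)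
  have hκ : ∀ a b, κ (a * b) = κ (b * a) := fun a b => by
    change pairing _ _ (comul (R := ℂ) (a * b)) = pairing _ _ (comul (R := ℂ) (b * a))
    rw [comul_mul, comul_mul, pairing_trace tr_mul_comm (mulLeftFunctional_trace hc)]
  have h1 : κ (density D f) = κ (weightElt f g) := trace_eq_of_tr_elt hκ hP
  rw [pairing_comul_central hc density_mem_center]
  refine h1.trans ((h.pairing_comul_weights hf c (antipode_mem_rightSub (diag_mem _))
    (antipode_mem_center (diag_mem_center _))).trans ?_)
  rw [← mul_assoc]
  have hcI := Subalgebra.mul_mem _ hc hI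
  refine (trace_eq_of_tr_elt (mulLeftFunctional_trace hcI) hP).symm.trans ?_
  change tr A (c * _ * density D f) = tr A (density D f * (_ * c))
  rw [tr_mul_comm, Subalgebra.mem_center_iff.1 hI c]

/-- For the index c onto A^R, τ(cx) = (tr ⊗ τ)Δ(x) is a trace in x, so c is determined by the values
at central x; these are τ(Ix). For A^L the same follows after applying S, under which τ and I are
invariant. -/
theorem isMarkov_index (h : IsBalanced g D) (hf : ∀ (H : Hyp A) (μ : Vac A), μ.InHyp H →
      ∑ ν, vacMatrix D μ ν * f ν = ι H * f μ)
    (hτ : IsFaithfulTrace (mulLeftFunctional (tr A) (density D f))) :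
    (∃ E, IsCondExp (mulLeftFunctional (tr A) (density D f)) (leftSub A) E ∧
      HasIndex E (diag fun H : Hyp A => (ι H : ℂ))) ∧
    (∃ E, IsCondExp (mulLeftFunctional (tr A) (density D f)) (rightSub A) E ∧
      HasIndex E (diag fun H : Hyp A => (ι H : ℂ))) := by
  have hθ := density_mem_center (D := D) (f := f)
  set τ := mulLeftFunctional (tr A) (density D f) with hτd
  set I : A := diag fun H : Hyp A => (ι H : ℂ) with hI
  have hIc : I ∈ Subalgebra.center ℂ A := diag_mem_center _
  have hIS : antipode I = I := antipode_of_mem_inf (diag_mem _)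
  have hIt : ∀ a b, mulLeftFunctional τ I (a * b) = mulLeftFunctional τ I (b * a) := fun a b => by
    change τ (I * (a * b)) = τ (I * (b * a))
    rw [← mul_assoc, hτ.trace, ← mul_assoc, Subalgebra.mem_center_iff.1 hIc, mul_assoc]
  have key : ∀ {c : A}, (∀ a b, τ (c * (a * b)) = τ (c * (b * a))) →
      (∀ z ∈ Subalgebra.center ℂ A, τ (c * z) = τ (I * z)) → c = I := by
    intro c h1 h2
    have h3 : mulLeftFunctional τ c = mulLeftFunctional τ I :=
      trace_ext h1 hIt fun q => h2 _ q.2.central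
    exact hτ.ext_mem (N := ⊤) (fun _ _ => trivial) trivial trivial fun x _ => LinearMap.congr_fun h3 x
  constructor
  · obtain ⟨E, c, hE, hc, hx⟩ := trace_index_leftSub hθ hτ
    obtain rfl : c = I := key (fun a b => by
      rw [hx, hx, comul_mul, comul_mul, pairing_trace (mulLeftFunctional_trace hθ) tr_mul_comm])
      fun z hz => by
        obtain ⟨w, rfl⟩ : ∃ w, antipode w = z := ⟨_, antipode_antipodeInv z⟩
        have hw : w ∈ Subalgebra.center ℂ A := by
          have := antipodeInv_mem_center hz
          rwa [antipodeInv_antipode] at this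
        rw [hx, pairing_comul_antipode, tr_comp_antipode, ← hτd, h.density_comp_antipode, ← hτd,
          h.pairing_density_central hf hw, ← hI, ← hτd]
        conv_lhs => rw [hτd, ← h.density_comp_antipode, LinearMap.comp_apply, antipode_mul_rev, hIS]
        rw [hτ.trace]
    exact ⟨E, hE, hc⟩
  · obtain ⟨E, c, hE, hc, hx⟩ := trace_index_rightSub hθ hτ
    obtain rfl : c = I := key (fun a b => by
      rw [hx, hx, comul_mul, comul_mul, pairing_trace tr_mul_comm (mulLeftFunctional_trace hθ)])
      fun z hz => (hx z).trans (h.pairing_density_central hf hz)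
    exact ⟨E, hE, hc⟩

end IsBalanced

/-- Existence of the Markov trace. -/
theorem exists_isMarkovTrace (h : IsBalanced g D) : ∃ τ : A →ₗ[ℂ] ℂ,
    IsMarkovTrace τ (diag fun H : Hyp A => (blockNorm (vacMatrix D) H : ℂ)) := by
  obtain ⟨f, hf0, hf⟩ := h.exists_weights
  have hτ : IsFaithfulTrace (mulLeftFunctional (tr A) (IsBalanced.density D f)) :=
    tr_faithful.comp_diag fun q => div_pos (mul_pos (mul_pos (hf0 _) (hf0 _)) (h.dim_pos q))
      (Complex.lt_def.1 (tr_elt_pos q)).1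
  obtain ⟨⟨E, hE, hc⟩, E', hE', hc'⟩ := h.isMarkov_index hf hτ
  set τ := mulLeftFunctional (tr A) (IsBalanced.density D f)
  have hre : ∀ H : Hyp A, ((τ H.elt).re : ℂ) = τ H.elt := fun H =>
    (Complex.eq_re_of_ofReal_le (r := 0) (hτ.elt_pos H).le).symm
  -- The rescaling factor is hypercentral, hence in both A^L and A^R. The rescaled trace is
  -- therefore preserved by the same conditional expectations, and the indices do not change.
  have hs : (diag fun H : Hyp A => (((τ H.elt).re⁻¹ : ℝ) : ℂ)) ∈ leftSub A ⊓ rightSub A := diag_mem _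
  refine ⟨mulLeftFunctional τ (diag fun H : Hyp A => (((τ H.elt).re⁻¹ : ℝ) : ℂ)),
    hτ.comp_diag fun H => inv_pos.2 (Complex.lt_def.1 (hτ.elt_pos H)).1,
    ⟨diag_mem _, diag_mem_center _⟩, ⟨E, hE.comp_mulLeft hs.1, hc⟩, ⟨E', hE'.comp_mulLeft hs.2, hc'⟩,
    fun H => ?_⟩
  change τ (_ * H.elt) = 1
  rw [diag_mul_elt, map_smul, smul_eq_mul]
  push_cast
  rw [hre, inv_mul_cancel₀ (hτ.elt_pos H).ne']

end MarkovTrace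

/-! ### Rigidity of positive eigenvectors -/

section CommonEigenvector

variable {m n : Type*} [Fintype m] [Fintype n] {M : Matrix m n ℝ}

/-- Two positive eigenvectors of `Mᵀ M` with the same eigenvalues are proportional along the
connected components of `M`. -/
theorem mul_eq_mul_of_common_eigenvalue (hM : ∀ a p, 0 ≤ M a p) {t t' c : n → ℝ} (ht : ∀ p, 0 < t p)
    (h : ∀ q, ∑ a, M a q * ∑ p, M a p * t p = c q * t q)
    (h' : ∀ q, ∑ a, M a q * ∑ p, M a p * t' p = c q * t' q) {a : m} {p q : n}
    (hp : M a p ≠ 0) (hq : M a q ≠ 0) : t' p / t p = t' q / t q := by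
  set y : n → ℝ := fun p => t' p / t p with hy
  have hyt : ∀ p, y p * t p = t' p := fun p => div_mul_cancel₀ _ (ht p).ne'
  let S : (n → n → ℝ) → ℝ := fun F => ∑ a, ∑ p, ∑ q, M a p * M a q * F p q
  have hS1 : ∀ u : n → ℝ, ∀ v : n → ℝ, S (fun p q => u q * v p) =
      ∑ q, u q * ∑ a, M a q * ∑ p, M a p * v p := by
    intro u v
    simp only [S, Finset.mul_sum]
    symm
    rw [Finset.sum_comm]
    refine Finset.sum_congr rfl fun a _ => ?_
    rw [Finset.sum_comm]
    exact Finset.sum_congr rfl fun p _ => Finset.sum_congr rfl fun q _ => by ring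
  have hsymm : ∀ F : n → n → ℝ, S F = S fun p q => F q p := by
    intro F
    refine Finset.sum_congr rfl fun a _ => ?_
    rw [Finset.sum_comm]
    exact Finset.sum_congr rfl fun p _ => Finset.sum_congr rfl fun q _ => by ring
  -- With y = t'/t, the Dirichlet form ∑ M_{ap}M_{aq}t_p t_q(y_p − y_q)² expands into terms that
  -- cancel by the two eigenvalue equations. All its summands are nonnegative, so each of them
  -- vanishes.
  have hadd : S (fun p q => t p * t q * (y p - y q) ^ 2) =
      S (fun p q => (y q ^ 2 * t q) * t p) + S (fun p q => (y p ^ 2 * t p) * t q) -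
        2 * S (fun p q => t' q * t' p) := by
    simp only [S, Finset.mul_sum, ← Finset.sum_add_distrib, ← Finset.sum_sub_distrib]
    refine Finset.sum_congr rfl fun a _ => Finset.sum_congr rfl fun p _ =>
      Finset.sum_congr rfl fun q _ => ?_
    rw [← hyt, ← hyt]; ring
  have hzero : S (fun p q => t p * t q * (y p - y q) ^ 2) = 0 := by
    rw [hadd, hsymm fun p q => (y p ^ 2 * t p) * t q, hS1 (fun q => y q ^ 2 * t q), hS1]
    simp only [h, h']
    rw [Finset.mul_sum, ← Finset.sum_add_distrib, ← Finset.sum_sub_distrib]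
    refine Finset.sum_eq_zero fun q _ => ?_
    rw [← hyt]; ring
  have hnn : ∀ a p q, 0 ≤ M a p * M a q * (t p * t q * (y p - y q) ^ 2) := fun a p q =>
    mul_nonneg (mul_nonneg (hM a p) (hM a q)) (mul_nonneg (mul_pos (ht p) (ht q)).le (sq_nonneg _))
  have h1 := (Finset.sum_eq_zero_iff_of_nonneg fun a _ => Finset.sum_nonneg fun p _ =>
    Finset.sum_nonneg fun q _ => hnn a p q).1 hzero a (Finset.mem_univ _)
  have h2 := (Finset.sum_eq_zero_iff_of_nonneg fun p _ =>
    Finset.sum_nonneg fun q _ => hnn a p q).1 h1 p (Finset.mem_univ _)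
  have h3 := (Finset.sum_eq_zero_iff_of_nonneg fun q _ => hnn a p q).1 h2 q (Finset.mem_univ _)
  have h4 := (mul_eq_zero.1 h3).resolve_left (mul_ne_zero hp hq)
  have h5 := (mul_eq_zero.1 h4).resolve_left (mul_pos (ht p) (ht q)).ne'
  exact sub_eq_zero.1 (pow_eq_zero_iff two_ne_zero |>.1 h5)

end CommonEigenvector

/-! ### Central elements that belong to a subalgebra -/

section Inclusion

variable {A : Type*} [CStarAlgebra A] [FiniteDimensional ℂ A] {τ τ' : A →ₗ[ℂ] ℂ}
  {N : Subalgebra ℂ A}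

theorem eq_zero_of_tr_idem {x : A} (hx : x * x = x) (h : tr A x = 0) : x = 0 := by
  have hid : IsIdempotentElem (LinearMap.mulLeft ℂ x) :=
    LinearMap.ext fun y => by
      change x * (x * y) = x * y
      rw [← mul_assoc, hx]
  have := LinearMap.congr_fun (LinearMap.IsIdempotentElem.eq_zero_of_trace_eq_zero hid h) 1
  simpa using this

variable [IsSemisimpleRing N]

/-- The product is an idempotent whose regular trace is a multiple of the character of V_q at
`a.elt`. That character vanishes with the multiplicity, and an idempotent of trace zero is zero. -/
theorem elt_mul_elt_eq_zero {a : Sector N} {q : Sector A} (h : mult (B := N) a (irrep q) = 0) :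
    ((a.elt : N) : A) * q.elt = 0 := by
  refine eq_zero_of_tr_idem ?_ ?_
  · have : ((a.elt : N) : A) * ((a.elt : N) : A) = ((a.elt : N) : A) := congrArg Subtype.val a.idem
    rw [mul_assoc, ← mul_assoc q.elt, ← q.comm, mul_assoc, q.idem, ← mul_assoc, this]
  · rw [tr_mul_elt]
    let σ : N →ₗ[ℂ] ℂ := modTr (irrep q) ∘ₗ N.val.toLinearMap
    have hσ : ∀ x y, σ (x * y) = σ (y * x) := fun x y => modTr_mul_comm _ _ _
    have h1 : σ (prim a) = 0 := by
      have := mult_eq_modTr_sub a q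
      rw [h, Nat.cast_zero] at this
      exact this.symm
    have h2 : σ a.elt = 0 := by
      rw [← one_mul a.elt, trace_eq_sum hσ]
      refine Finset.sum_eq_zero fun b _ => ?_
      by_cases hb : b = a
      · rw [hb, h1, zero_mul]
      · rw [modTr_irrep_mul_elt_ne hb, mul_zero]
    have h3 : modTr (irrep q) ((a.elt : N) : A) = 0 := h2
    rw [h3, mul_zero]

/-- A central element whose eigenvalues agree on the sectors containing a common sector of the
subalgebra `N` belongs to `N`. -/
theorem diag_mem_of_forall_mult {y : Sector A → ℂ}
    (h : ∀ (a : Sector N) (p q : Sector A), mult (B := N) a (irrep p) ≠ 0 →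
      mult (B := N) a (irrep q) ≠ 0 → y p = y q) : diag y ∈ N := by
  classical
  have hα : ∀ a : Sector N, ∃ α : ℂ, ∀ p : Sector A, mult (B := N) a (irrep p) ≠ 0 → y p = α := by
    intro a
    by_cases ha : ∃ p : Sector A, mult (B := N) a (irrep p) ≠ 0
    · obtain ⟨p, hp⟩ := ha
      exact ⟨y p, fun q hq => h a q p hq hp⟩
    · push Not at ha
      exact ⟨0, fun q hq => absurd (ha q) hq⟩
  choose α hα using hα
  have h1 : ∑ a : Sector N, ((a.elt : N) : A) = 1 := by
    have := congrArg Subtype.val (sum_elt (⊤ : Subalgebra ℂ N))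
    simpa using this
  have : diag y = ∑ a : Sector N, α a • ((a.elt : N) : A) := eq_of_mul_elt_eq fun q => by
    rw [diag_mul_elt]
    conv_lhs => rw [← one_mul q.elt, ← h1, Finset.sum_mul, Finset.smul_sum]
    rw [Finset.sum_mul]
    refine Finset.sum_congr rfl fun a _ => ?_
    by_cases hm : mult (B := N) a (irrep q) = 0
    · rw [smul_mul_assoc, elt_mul_elt_eq_zero hm, smul_zero, smul_zero]
    · rw [smul_mul_assoc, hα a q hm]
  rw [this]
  exact Subalgebra.sum_mem _ fun a _ => Subalgebra.smul_mem _ a.elt.2 _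

/-- The eigenvalue equation of the traces of minimal projections. -/
theorem sum_mult_prim (hτ : IsFaithfulTrace τ) (hN : ∀ x ∈ N, star x ∈ N) {E : A →ₗ[ℂ] A} {c : A}
    (hE : IsCondExp τ N E) (hc : HasIndex E c) {q : Sector A} {γ : ℂ}
    (hγ : c * q.elt = γ • q.elt) :
    ((∑ a : Sector N, (mult (B := N) a (irrep q) : ℝ) *
      ∑ p : Sector A, (mult (B := N) a (irrep p) : ℝ) * (τ (prim p)).re : ℝ) : ℂ) =
      γ * ((τ (prim q)).re : ℝ) := by
  have h1 := index_mul_prim hτ hN hE hc q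
  rw [← elt_mul_prim q, ← mul_assoc, hγ, smul_mul_assoc, elt_mul_prim, map_smul, smul_eq_mul,
    hτ.prim_eq_re] at h1
  rw [h1]
  push_cast
  refine Finset.sum_congr rfl fun a _ => ?_
  rw [trace_prim_sub hτ.trace]
  congr 1
  exact Finset.sum_congr rfl fun p _ => by rw [← hτ.prim_eq_re]

end Inclusion

/-! ### Uniqueness of the Markov trace and conclusion -/

section Main

open Coalgebra CStarWeakHopfAlgebra

variable {A : Type*} [CStarAlgebra A] [CStarWeakHopfAlgebra A] [FiniteDimensional ℂ A]
  {τ τ' : A →ₗ[ℂ] ℂ}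

theorem exists_inHyp_sector (H : Hyp A) : ∃ q : Sector A, H.elt * q.elt = q.elt := by
  obtain ⟨q, hq⟩ := exists_mul_elt_ne_zero (elt_ne_zero H)
  exact ⟨q, (mul_elt_eq_zero_or H.2.central H.2.idem q).resolve_left hq⟩

/-- In the eigenvalue equation for the traces of minimal projections everything except the
coefficient of the index is known to be real, and t_q > 0. -/
theorem IsMarkovTrace.exists_real_index {c : A} (h : IsMarkovTrace τ c) :
    ∃ ι : Hyp A → ℝ, c = diag fun H => (ι H : ℂ) := by
  obtain ⟨γ, hγ⟩ := exists_eq_sum_elt h.hypercentral.1 h.hypercentral.2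
  obtain ⟨E, hE, hc⟩ := h.left
  refine ⟨fun H => (γ H).re, hγ.trans (Finset.sum_congr rfl fun H _ => ?_)⟩
  congr 1
  obtain ⟨q, hq⟩ := exists_inHyp_sector H
  have h1 : c * q.elt = γ H • q.elt := by
    rw [hγ, ← hq, ← mul_assoc, sum_smul_elt_mul_elt, smul_mul_assoc]
  have h2 := sum_mult_prim h.trace (fun _ => star_mem_leftSub) hE hc h1
  have ht : (0 : ℝ) < (τ (prim q)).re := (Complex.lt_def.1 (h.trace.prim_pos q)).1
  have h3 := congrArg Complex.im h2
  rw [Complex.ofReal_im, Complex.im_mul_ofReal] at h3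
  exact Complex.ext rfl ((mul_eq_zero.1 h3.symm).resolve_right ht.ne')

/-- The coefficients of either index are squared norms of the same inclusion matrices, which do not
involve the trace. -/
theorem IsMarkovTrace.index_unique {c c' : A} (h : IsMarkovTrace τ c) (h' : IsMarkovTrace τ' c') :
    c' = c := by
  obtain ⟨ι, rfl⟩ := h.exists_real_index
  obtain ⟨ι', rfl⟩ := h'.exists_real_index
  refine congrArg diag (funext fun H => ?_)
  obtain ⟨μ, hμ⟩ := exists_inHyp H
  have h1 := (h.inclusion (diag_mul_elt _ H) hμ).1
  have h2 := (h'.inclusion (diag_mul_elt _ H) hμ).1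
  exact congrArg Complex.ofReal (h2.symm.trans h1)

/-- The Markov trace is unique. -/
theorem IsMarkovTrace.unique {c : A} (h : IsMarkovTrace τ c) (h' : IsMarkovTrace τ' c) : τ' = τ := by
  let t : Sector A → ℝ := fun p => (τ (prim p)).re
  let t' : Sector A → ℝ := fun p => (τ' (prim p)).re
  have ht : ∀ p, 0 < t p := fun p => (Complex.lt_def.1 (h.trace.prim_pos p)).1
  let y : Sector A → ℂ := fun p => ((t' p / t p : ℝ) : ℂ)
  obtain ⟨ι, hι⟩ := h.exists_real_index
  choose hyp hhyp using fun q : Sector A => (leftVac q).exists_inHyp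
  have hcq : ∀ q : Sector A, c * q.elt = ((ι (hyp q) : ℝ) : ℂ) • q.elt := fun q => by
    rw [← leftVac_inHyp_iff.1 (hhyp q), hι, ← mul_assoc, diag_mul_elt, smul_mul_assoc]
  -- The ratio y of the two traces is constant on sectors sharing an irreducible of N, so ∑ y_q e_q
  -- lies in N. Used for both A^L and A^R, this puts it in the hypercenter, where the normalization
  -- determines it.
  have key : ∀ (N : Subalgebra ℂ A) [IsSemisimpleRing N], (∀ x ∈ N, star x ∈ N) →
      (∃ E, IsCondExp τ N E ∧ HasIndex E c) → (∃ E, IsCondExp τ' N E ∧ HasIndex E c) →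
      diag y ∈ N := by
    rintro N _ hN ⟨E, hE, hc⟩ ⟨E', hE', hc'⟩
    refine diag_mem_of_forall_mult fun a p q hp hq => congrArg Complex.ofReal ?_
    refine mul_eq_mul_of_common_eigenvalue (M := fun (a : Sector N) (p : Sector A) =>
      (mult (B := N) a (irrep p) : ℝ)) (fun _ _ => Nat.cast_nonneg _) (c := fun q => ι (hyp q)) ht
      (fun q => ?_) (fun q => ?_) (a := a) (Nat.cast_ne_zero.2 hp) (Nat.cast_ne_zero.2 hq)
    · exact_mod_cast sum_mult_prim h.trace hN hE hc (hcq q)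
    · exact_mod_cast sum_mult_prim h'.trace hN hE' hc' (hcq q)
  have hyL := key (leftSub A) (fun _ => star_mem_leftSub) h.left h'.left
  have hyR := key (rightSub A) (fun _ => star_mem_rightSub) h.right h'.right
  obtain ⟨β, hβ⟩ := exists_eq_sum_elt (C := leftSub A ⊓ rightSub A) ⟨hyL, hyR⟩ (diag_mem_center y)
  have hyt : τ' = mulLeftFunctional τ (diag y) := by
    refine trace_ext h'.trace.trace (fun a b => ?_) fun q => ?_
    · change τ (diag y * (a * b)) = τ (diag y * (b * a))
      rw [← mul_assoc, h.trace.trace, ← mul_assoc, diag_comm, mul_assoc]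
    · change _ = τ (diag y * q.elt)
      rw [diag_mul_elt, map_smul, smul_eq_mul, ← q.idem, trace_mul_elt h.trace.trace,
        trace_mul_elt h'.trace.trace, h.trace.prim_eq_re, h'.trace.prim_eq_re, ← mul_assoc,
        ← Complex.ofReal_mul]
      congr 2
      exact (div_mul_cancel₀ _ (ht q).ne').symm
  have hβ1 : ∀ H, β H = 1 := fun H => by
    have h1 := h'.normalized H
    rw [hyt] at h1
    change τ (diag y * H.elt) = 1 at h1
    rwa [hβ, sum_smul_elt_mul_elt, map_smul, h.normalized, smul_eq_mul, mul_one] at h1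
  have hy1 : diag y = 1 := by
    rw [hβ]
    simp only [hβ1, one_smul]
    exact sum_elt _
  rw [hyt, hy1]
  exact LinearMap.ext fun x => congrArg τ (one_mul x)

theorem dimMatrix_self (d : Sector A → ℝ) :
    dimMatrix d A = vacMatrix fun q => d q * mult q A := by
  classical
  ext μ ν
  rw [dimMatrix, vacMatrix]
  refine Finset.sum_congr (Finset.ext fun q => ?_) fun q _ => mul_comm _ _
  rw [Finset.mem_filter, Finset.mem_filter, isLeftVac_iff, isRightVac_iff]

end Main

end WHA

theorem mainTheorem1 {A : Type*} [CStarAlgebra A] [FiniteDimensional ℂ A]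
    [CStarWeakHopfAlgebra A] :
    (∃! d : WHA.Sector A → ℝ, WHA.IsDimension d) ∧
    ∃ (τ : A →ₗ[ℂ] ℂ) (I : A) (ι : WHA.Hyp A → ℝ),
      WHA.IsMarkovTrace τ I ∧
      (∀ τ' I', WHA.IsMarkovTrace τ' I' → τ' = τ ∧ I' = I) ∧
      I = ∑ H, (ι H : ℂ) • H.elt ∧
      (∀ (H : WHA.Hyp A) (μ : WHA.Vac A), μ.InHyp H →
        WHA.IsConnectedInclusion (WHA.leftSub A) μ.zL ∧
        WHA.IsConnectedInclusion (WHA.rightSub A) μ.zR ∧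
        WHA.inclusionNorm (WHA.leftSub A) μ.zL ^ 2 = ι H ∧
        WHA.inclusionNorm (WHA.rightSub A) μ.zR ^ 2 = ι H) ∧
      (∀ d : WHA.Sector A → ℝ, WHA.IsDimension d →
        (∀ H : WHA.Hyp A, WHA.blockNorm (WHA.dimMatrix d A) H = ι H) ∧
        ∃ f : WHA.Vac A → ℝ, (∀ μ, 0 < f μ) ∧
          ∀ (H : WHA.Hyp A) (μ : WHA.Vac A), μ.InHyp H →
            ∑ ν, WHA.dimMatrix d A μ ν * f ν = ι H * f μ) := by
  obtain ⟨g, D, h⟩ := WHA.exists_isBalanced (A := A)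
  obtain ⟨τ, hτ⟩ := WHA.exists_isMarkovTrace h
  refine ⟨WHA.existsUnique_isDimension, τ, _, WHA.blockNorm (WHA.vacMatrix D), hτ,
    fun τ' I' h' => ?_, rfl, fun H μ hμ => ?_, fun d hd => ?_⟩
  · obtain rfl := hτ.index_unique h'
    exact ⟨hτ.unique h', rfl⟩
  · have := hτ.inclusion (WHA.diag_mul_elt _ H) hμ
    exact ⟨WHA.isConnectedInclusion_leftSub μ, WHA.isConnectedInclusion_rightSub μ, this.1, this.2⟩
  · obtain ⟨g', hg'⟩ := hd
    -- A dimension function d yields the balanced values d_q times `mult q A`. By uniqueness these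
    -- are the numbers D that define the index, and the dimension matrix of A becomes the vacuum
    -- matrix.
    obtain rfl := hg'.isBalanced.unique h
    rw [WHA.dimMatrix_self]
    exact ⟨fun H => rfl, h.exists_weights⟩
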